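/- All graphs are finite and simple. A maximal planar graph is a planar graph to which no edge can be added (on the same vertex set) while preserving planarity. The Kleetope $KG$ of a connected plane graph $G$ is obtained by adding, within every face of the planar drawing of $G$, a new vertex adjacent to all the vertices of that face; for a maximal planar graph with at least four vertices the drawing is unique up to reflection, $KG$ is again maximal planar, and $K^3G=K(K(KG))$. The 2-blowup of a graph $H$ replaces each vertex $v$ by two non-adjacent copies and joins two copies whenever they are copies of adjacent vertices of $H$. A graph is biplanar (has a biplanar drawing) if it is the union of two planar graphs on its vertex set. A drawing of $H$ with split thickness two is a planar drawing of a graph whose vertices are images of the vertices of $H$, at most two images for each vertex, in which every edge joins images of two adjacent vertices of $H$ and each edge of $H$ appears exactly once, between some image of one endpoint and some image of the other. \textbf{Theorem.} Let $G$ be a maximal planar graph with $n$ vertices. If $n\ge 49$, then the 2-blowup of $K^3G$ is not biplanar, and if $n\ge 73$, then the 2-blowup of $K^3G$ has no drawing with split thickness two. In particular, Gethner's conjecture that the 2-blowup of every planar graph is biplanar is false: there is a planar graph whose 2-blowup is not biplanar. -/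

import Mathlib

namespace SimpleGraph

/-- A rotation system (combinatorial embedding of a graph in an oriented closed surface): a
permutation of the darts (oriented edges) whose cycles are exactly the sets of darts leaving a
common vertex. The permutation `rot` sends each dart to the next one in the cyclic order of the
drawing around their common origin. -/
structure RotationSystem {V : Type*} (G : SimpleGraph V) where
  rot : Equiv.Perm G.Dart
  rot_fst : ∀ d : G.Dart, (rot d).fst = d.fst
  sameCycle_of_fst_eq : ∀ d d' : G.Dart, d.fst = d'.fst → rot.SameCycle d d'

namespace RotationSystem

variable {V : Type*} {G : SimpleGraph V}

/-- One step of the walk along the boundary of a face: traverse the dart `d`, then leave its end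
along the next dart in the rotation there. -/
def facePerm (M : G.RotationSystem) : Equiv.Perm G.Dart :=
  (Function.Involutive.toPerm Dart.symm Dart.symm_involutive).trans M.rot

/-- The facial walks of a rotation system: the cycles of `facePerm`. When the graph is connected
and has an edge these are the faces of the embedding. -/
def Face (M : G.RotationSystem) : Type _ :=
  Quotient (Equiv.Perm.SameCycle.setoid M.facePerm)

/-- The vertex `v` is on the boundary of the face `f`. -/
def Incident (M : G.RotationSystem) (v : V) (f : M.Face) : Prop :=
  ∃ d : G.Dart, d.fst = v ∧ (Quotient.mk (Equiv.Perm.SameCycle.setoid M.facePerm) d : M.Face) = f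

/-- The rotation system describes an embedding in the sphere (equivalently, a drawing in the
plane without crossings), that is, every connected component has genus zero. An isolated vertex
carries no dart but, drawn on a sphere of its own, has one face. Since `V - E + F` is at
most `2` for each component, the sum over the components equals twice their number exactly when
every component satisfies Euler's formula `V - E + F = 2`. -/
def IsPlanar [Finite V] (M : G.RotationSystem) : Prop :=
  Nat.card V + (Nat.card M.Face + Nat.card {v : V // G.IsIsolated v}) =
    Nat.card G.edgeSet + 2 * Nat.card G.ConnectedComponent

end RotationSystem

variable {V : Type*}

/-- A planar drawing of a finite graph, given by its rotation system. -/
structure PlanarDrawing [Finite V] (G : SimpleGraph V) extends RotationSystem G where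
  isPlanar : toRotationSystem.IsPlanar

/-- A finite graph is planar if it has a planar drawing. -/
def IsPlanar [Finite V] (G : SimpleGraph V) : Prop :=
  Nonempty G.PlanarDrawing

/-- A maximal planar graph: it is planar, and no edge can be added to it (on the same vertex set)
while preserving planarity. -/
def IsMaximalPlanar [Finite V] (G : SimpleGraph V) : Prop :=
  Maximal (fun H : SimpleGraph V => H.IsPlanar) G

instance RotationSystem.finite_face [Finite V] {G : SimpleGraph V} (M : G.RotationSystem) :
    Finite M.Face := by
  have : Finite G.Dart := Finite.of_injective _ (Dart.toProd_injective (G := G))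
  exact Quotient.finite _

/-- The Kleetope of a connected graph with a given planar drawing: within every face a new vertex
is added, which is adjacent to all the vertices of that face. -/
def PlanarDrawing.kleetope [Finite V] {G : SimpleGraph V} (D : G.PlanarDrawing) :
    SimpleGraph (V ⊕ D.Face) where
  Adj
    | .inl u, .inl v => G.Adj u v
    | .inl u, .inr f => D.Incident u f
    | .inr f, .inl u => D.Incident u f
    | .inr _, .inr _ => False
  symm := ⟨by
    rintro (u | f) (v | g) h
    · exact Adj.symm h
    · exact h
    · exact h
    · exact h⟩
  loopless := ⟨by
    rintro (u | f) h
    · exact G.loopless.irrefl u h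
    · exact h⟩

/-- The (open) `k`-blowup: each vertex `v` is replaced by `k` copies `(v, i)`, and two vertices are
adjacent exactly when they are copies of adjacent vertices. -/
def blowup (G : SimpleGraph V) (k : ℕ) : SimpleGraph (V × Fin k) :=
  G.comap Prod.fst

/-- A graph is biplanar (has thickness at most two) if it is the union of two planar graphs on
its vertex set. -/
def IsBiplanar [Finite V] (G : SimpleGraph V) : Prop :=
  ∃ G₁ G₂ : SimpleGraph V, G₁.IsPlanar ∧ G₂.IsPlanar ∧ G₁ ⊔ G₂ = G

/-- The graph `G` has a drawing with split thickness `k`: there is a planar drawing with at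
most `k` images `(v, i)` of each vertex `v` (an image that is not needed is an isolated vertex),
all of whose edges connect images of adjacent vertices, and in which each edge of `G` appears
exactly once, between some image of one endpoint and some image of the other. -/
def HasSplitThicknessDrawing [Finite V] (G : SimpleGraph V) (k : ℕ) : Prop :=
  ∃ H : SimpleGraph (V × Fin k), H.IsPlanar ∧
    (∀ x y, H.Adj x y → G.Adj x.1 y.1) ∧
    ∀ e ∈ G.edgeSet, ∃! e' : Sym2 (V × Fin k), e' ∈ H.edgeSet ∧ e'.map Prod.fst = e

end SimpleGraph

/-!
Drawings are handled through their rotation systems: a permutation of the darts whose cycles are the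
vertices, with the face permutation as second generator, so that planarity is Euler's formula for
numbers of cycles. Multiplying by a transposition merges two cycles or splits one, and this is all
the topology that is used. It shows that edges can be inserted between two components or inside a
face (`IsPlanar.sup_edge_of_not_reachable`, `PlanarDrawing.isPlanar_sup_edge`), and that inserting
edges does not lower the genus (`exists_setoid_genus_le`). Consequently a maximal planar graph with
at least three vertices is connected and all its faces are triangles
(`IsMaximalPlanar.isTriangulation`), and the Kleetope of a triangulation is again a planar
triangulation (`PlanarDrawing.kleetope_isTriangulation`, `PlanarDrawing.kleetope_isPlanar`).

Both a biplanar drawing of the 2-blowup of `H = K³G` and a drawing of it with split thickness two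
give a planar graph `P` with two images of each vertex of the blowup, all of whose edges are images
of edges of the blowup and which has at least one image of every edge. If `H` has `N` vertices, then
`P` has `4N` vertices and at least `4(3N - 6) = 3(4N) - 24` edges, so `P` is a triangulation
but for a bounded number of defects: faces that are not triangles, isolated vertices, edges
with several images, and additional components. Counted with the darts they occupy, there are
at most `96` of them.

On the other hand each face `s` of `KG` causes a defect. The vertex put into `s` by the second
Kleetope step has degree three there, and the third step surrounds it by three vertices of degree
three. If there is no defect nearby, then all faces of `P` around the images of these four
vertices are triangles, and no edge there has a second image. A vertex of degree three in `H` then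
must have images of degree exactly three, each capping a triangle
(`LocalDrawing.exists_cap`), and the images of one copy of `s` are surrounded by three such caps
(`LocalDrawing.exists_caps`). The edges at the far side of these caps have no second image, which
forces the second copy of `s` with its own three caps onto the other side of the same triangle. The
two sides close up to a component of `P` that sees nothing but `s` and its surroundings
(`LocalDrawing.exists_isClosedAround`), and such a component is itself a defect that belongs to
`s` alone. Hence `KG` has at most `96` faces (`card_face_le_of_cover`). But it has `6n - 12` faces,
which is more than `96` for `n ≥ 49`, in the biplanar and in the split case alike. As `K³G` is
planar, it is also a planar graph whose 2-blowup is not biplanar.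
-/

/-! ### Counting the cycles of permutations -/

namespace Equiv.Perm

variable {D : Type*}

/-- The number of cycles of a permutation, fixed points included. -/
noncomputable def numCycles (f : Perm D) : ℕ := Nat.card (Quotient (SameCycle.setoid f))

/-- The equivalence relation obtained from `s` by identifying the classes of `x` and `y`. -/
def glue (s : Setoid D) (x y : D) : Setoid D where
  r u v := s u v ∨ (s u x ∧ s y v) ∨ (s u y ∧ s x v)
  iseqv := by
    refine ⟨fun u => Or.inl (s.refl u), ?_, ?_⟩
    · rintro u v (h | ⟨h, h'⟩ | ⟨h, h'⟩)
      · exact Or.inl (s.symm h)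
      · exact Or.inr (Or.inr ⟨s.symm h', s.symm h⟩)
      · exact Or.inr (Or.inl ⟨s.symm h', s.symm h⟩)
    · rintro u v w (h | ⟨h, h'⟩ | ⟨h, h'⟩) (k | ⟨k, k'⟩ | ⟨k, k'⟩)
      · exact Or.inl (s.trans h k)
      · exact Or.inr (Or.inl ⟨s.trans h k, k'⟩)
      · exact Or.inr (Or.inr ⟨s.trans h k, k'⟩)
      · exact Or.inr (Or.inl ⟨h, s.trans h' k⟩)
      · exact Or.inr (Or.inl ⟨h, k'⟩)
      · exact Or.inl (s.trans h k')
      · exact Or.inr (Or.inr ⟨h, s.trans h' k⟩)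
      · exact Or.inl (s.trans h k')
      · exact Or.inr (Or.inr ⟨h, k'⟩)

theorem le_glue (s : Setoid D) (x y : D) : s ≤ glue s x y := fun _ _ h => Or.inl h

theorem glue_rel (s : Setoid D) (x y : D) : glue s x y x y :=
  Or.inr (Or.inl ⟨s.refl x, s.refl y⟩)

theorem glue_le {s t : Setoid D} {x y : D} (h : s ≤ t) (hxy : t x y) : glue s x y ≤ t := by
  rintro u v (k | ⟨k, k'⟩ | ⟨k, k'⟩)
  · exact h k
  · exact t.trans (h k) (t.trans hxy (h k'))
  · exact t.trans (h k) (t.trans (t.symm hxy) (h k'))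

theorem glue_eq_self {s : Setoid D} {x y : D} (h : s x y) : glue s x y = s :=
  le_antisymm (glue_le le_rfl h) (le_glue s x y)

theorem card_glue_of_not [Finite D] {s : Setoid D} {x y : D} (h : ¬ s x y) :
    Nat.card (Quotient (glue s x y)) + 1 = Nat.card (Quotient s) := by
  classical
  let F : {q : Quotient s // q ≠ ⟦y⟧} → Quotient (glue s x y) := fun q =>
    Quotient.map' (s₁ := s) (s₂ := glue s x y) id (fun _ _ h => le_glue s x y h) q.1
  have hF : Function.Bijective F := by
    constructor
    · rintro ⟨q, hq⟩ ⟨r, hr⟩ hqr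
      induction q using Quotient.inductionOn with | _ u
      induction r using Quotient.inductionOn with | _ v
      have huv : glue s x y u v := Quotient.exact hqr
      have hu : ¬ s u y := fun k => hq (Quotient.sound k)
      have hv : ¬ s y v := fun k => hr (Quotient.sound (s.symm k))
      apply Subtype.ext
      rcases huv with k | ⟨k, k'⟩ | ⟨k, k'⟩
      · exact Quotient.sound k
      · exact absurd k' hv
      · exact absurd k hu
    · intro q
      induction q using Quotient.inductionOn with | _ u
      by_cases hu : s u y
      · refine ⟨⟨⟦x⟧, fun k => h (Quotient.exact k)⟩, ?_⟩
        exact Quotient.sound (s := glue s x y)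
          ((glue s x y).trans (glue_rel s x y) (le_glue s x y (s.symm hu)))
      · exact ⟨⟨⟦u⟧, fun k => hu (Quotient.exact k)⟩, rfl⟩
  rw [← Nat.card_congr (Equiv.ofBijective F hF)]
  have := Nat.card_congr (Equiv.optionSubtypeNe (⟦y⟧ : Quotient s))
  rw [← this, Finite.card_option]

theorem setoid_le {f : Perm D} [Finite D] {s : Setoid D} (h : ∀ u, s u (f u)) :
    SameCycle.setoid f ≤ s := by
  intro u v huv
  obtain ⟨n, hn⟩ := SameCycle.exists_nat_pow_eq huv
  subst hn
  induction n with
  | zero => exact s.refl u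
  | succ n ih =>
    rw [pow_succ', Perm.mul_apply]
    exact s.trans (ih ⟨n, by simp⟩) (h _)

theorem sameCycle_permCongr {D' : Type*} (e : D ≃ D') (f : Perm D) (u v : D) :
    SameCycle (e.permCongr f) (e u) (e v) ↔ SameCycle f u v := by
  have h : ∀ n : ℤ, (e.permCongr f ^ n) (e u) = e ((f ^ n) u) := by
    intro n
    have : e.permCongr f ^ n = e.permCongr (f ^ n) := by
      rw [← Equiv.permCongrHom_coe, ← map_zpow]
    rw [this]; simp
  constructor
  · rintro ⟨n, hn⟩; exact ⟨n, e.injective (by rw [← h, hn])⟩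
  · rintro ⟨n, hn⟩; exact ⟨n, by rw [h, hn]⟩

theorem numCycles_permCongr {D' : Type*} (e : D ≃ D') (f : Perm D) :
    numCycles (e.permCongr f) = numCycles f :=
  (Nat.card_congr (Quotient.congr e fun u v => (sameCycle_permCongr e f u v).symm)).symm

theorem apply_eq_of_sameCycle [Finite D] {α : Type*} {f : Perm D} (p : D → α)
    (h : ∀ u, p (f u) = p u) {u v : D} (huv : SameCycle f u v) : p u = p v :=
  setoid_le (s := Setoid.ker p) (fun u => (h u).symm) huv

theorem sameCycle_sumCongr_inl {D' : Type*} (f : Perm D) (g : Perm D') (u v : D) :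
    SameCycle (Equiv.sumCongr f g) (Sum.inl u) (Sum.inl v) ↔ SameCycle f u v := by
  have h : ∀ n : ℤ, ((Equiv.sumCongr f g : Perm (D ⊕ D')) ^ n) (Sum.inl u) =
      Sum.inl ((f ^ n) u) := by
    intro n
    have : (Equiv.sumCongr f g : Perm (D ⊕ D')) = sumCongrHom D D' (f, g) := rfl
    rw [this, ← map_zpow]; rfl
  simp only [SameCycle, h, Sum.inl.injEq]

theorem sameCycle_sumCongr_inr {D' : Type*} (f : Perm D) (g : Perm D') (u v : D') :
    SameCycle (Equiv.sumCongr f g) (Sum.inr u) (Sum.inr v) ↔ SameCycle g u v := by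
  have h : ∀ n : ℤ, ((Equiv.sumCongr f g : Perm (D ⊕ D')) ^ n) (Sum.inr u) =
      Sum.inr ((g ^ n) u) := by
    intro n
    have : (Equiv.sumCongr f g : Perm (D ⊕ D')) = sumCongrHom D D' (f, g) := rfl
    rw [this, ← map_zpow]; rfl
  simp only [SameCycle, h, Sum.inr.injEq]

theorem numCycles_sumCongr [Finite D] {D' : Type*} [Finite D'] (f : Perm D) (g : Perm D') :
    numCycles (Equiv.sumCongr f g) = numCycles f + numCycles g := by
  rw [numCycles, numCycles, numCycles, ← Nat.card_sum]
  let F : Quotient (SameCycle.setoid f) ⊕ Quotient (SameCycle.setoid g) →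
      Quotient (SameCycle.setoid (Equiv.sumCongr f g)) :=
    Sum.elim
      (Quotient.map' (s₁ := SameCycle.setoid f) (s₂ := SameCycle.setoid (Equiv.sumCongr f g))
        Sum.inl fun u v h => (sameCycle_sumCongr_inl f g u v).2 h)
      (Quotient.map' (s₁ := SameCycle.setoid g) (s₂ := SameCycle.setoid (Equiv.sumCongr f g))
        Sum.inr fun u v h => (sameCycle_sumCongr_inr f g u v).2 h)
  refine (Nat.card_congr (Equiv.ofBijective F ⟨?_, ?_⟩)).symm
  · have hside : ∀ u v, SameCycle (Equiv.sumCongr f g) u v → u.isLeft = v.isLeft :=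
      fun u v => apply_eq_of_sameCycle _ (by rintro (u | u) <;> rfl)
    rintro (q | q) (r | r) hqr <;> induction q using Quotient.inductionOn with | _ u <;>
      induction r using Quotient.inductionOn with | _ v
    · exact congrArg _ (Quotient.sound ((sameCycle_sumCongr_inl f g u v).1 (Quotient.exact hqr)))
    · simpa using hside (.inl u) (.inr v) (Quotient.exact hqr)
    · simpa using hside (.inr u) (.inl v) (Quotient.exact hqr)
    · exact congrArg _ (Quotient.sound ((sameCycle_sumCongr_inr f g u v).1 (Quotient.exact hqr)))
  · intro q
    induction q using Quotient.inductionOn with | _ u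
    rcases u with u | u
    · exact ⟨.inl ⟦u⟧, rfl⟩
    · exact ⟨.inr ⟦u⟧, rfl⟩

theorem numCycles_one : numCycles (1 : Perm D) = Nat.card D := by
  refine (Nat.card_congr (Equiv.ofBijective
    (fun u => (Quotient.mk (SameCycle.setoid (1 : Perm D)) u)) ⟨fun u v h => ?_, ?_⟩)).symm
  · exact sameCycle_one.1 (Quotient.exact h)
  · exact Quotient.mk_surjective

theorem numCycles_mul_comm (f g : Perm D) : numCycles (f * g) = numCycles (g * f) := by
  rw [← numCycles_permCongr f (g * f)]
  congr 1
  ext u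
  simp

theorem card_le_three_mul_numCycles [Finite D] {f : Perm D} (h : ∀ u, f (f (f u)) = u) :
    Nat.card D ≤ 3 * numCycles f := by
  have hsurj : Function.Surjective
      (fun x : Quotient (SameCycle.setoid f) × Fin 3 => (f ^ (x.2 : ℕ)) x.1.out) := by
    intro u
    have hu : SameCycle f (Quotient.mk (SameCycle.setoid f) u).out u :=
      Quotient.exact (Quotient.out_eq (Quotient.mk (SameCycle.setoid f) u))
    obtain ⟨n, hn⟩ := hu.exists_nat_pow_eq
    refine ⟨(Quotient.mk _ u, ⟨n % 3, Nat.mod_lt _ (by norm_num)⟩), ?_⟩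
    have h3 : f ^ 3 = 1 := by ext u; simpa [pow_succ] using h u
    have : f ^ (n % 3) = f ^ n := by
      conv_rhs => rw [← Nat.mod_add_div n 3, pow_add, pow_mul, h3, one_pow, mul_one]
    simp only [this, hn]
  have := Nat.card_le_card_of_surjective _ hsurj
  rwa [Nat.card_prod, Nat.card_eq_fintype_card (α := Fin 3), Fintype.card_fin, mul_comm] at this

/-- A weighted count of the cycles of a permutation without fixed points: a cycle of length
two contributes `2 * (3 + 3)`, one of length three `3 * (3 + 1)`, and a longer one at least `4 * 3`
to the right-hand side. -/
theorem twelve_mul_numCycles_le [Finite D] (f : Perm D) (hf : ∀ u, f u ≠ u) :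
    12 * numCycles f ≤ 3 * Nat.card D + 3 * {u | f (f u) = u}.ncard +
      {u | f (f (f u)) = u}.ncard := by
  classical
  have := Fintype.ofFinite D
  have := Fintype.ofFinite (Quotient (SameCycle.setoid f))
  let w : D → ℕ := fun u => 3 + (if f (f u) = u then 3 else 0) + (if f (f (f u)) = u then 1 else 0)
  have hsum : ∑ u, w u = 3 * Nat.card D + 3 * {u | f (f u) = u}.ncard +
      {u | f (f (f u)) = u}.ncard := by
    simp only [w, Finset.sum_add_distrib, Finset.sum_ite, Finset.sum_const,
      Set.ncard_eq_toFinset_card', Set.toFinset_ofPred, smul_eq_mul, Finset.card_univ,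
      Nat.card_eq_fintype_card]
    ring
  rw [← hsum, ← Finset.sum_fiberwise (s := Finset.univ)
    (g := fun u => (Quotient.mk (SameCycle.setoid f) u)) (f := w), numCycles,
    Nat.card_eq_fintype_card, mul_comm]
  rw [← Finset.card_univ, ← smul_eq_mul]
  apply Finset.card_nsmul_le_sum
  intro q _
  induction q using Quotient.inductionOn with | _ u
  have hsub : ∀ s : Finset D, (∀ v ∈ s, SameCycle f v u) → ∑ v ∈ s, w v ≤
      ∑ v ∈ Finset.univ with (Quotient.mk (SameCycle.setoid f) v) = ⟦u⟧, w v := by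
    intro s hs
    apply Finset.sum_le_sum_of_subset
    intro v hv
    simp only [Finset.mem_filter, Finset.mem_univ, true_and]
    exact Quotient.sound (hs v hv)
  have h01 : u ≠ f u := (hf u).symm
  have h12 : f u ≠ f (f u) := (hf _).symm
  have h23 : f (f u) ≠ f (f (f u)) := (hf _).symm
  by_cases h2 : f (f u) = u
  · refine le_trans ?_ (hsub {u, f u} ?_)
    · rw [Finset.sum_pair h01]; simp [w, h2]; omega
    · simp [SameCycle.rfl]
  have h02 : u ≠ f (f u) := Ne.symm h2
  have h13 : f u ≠ f (f (f u)) := fun h => h2 (f.injective h.symm)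
  by_cases h3 : f (f (f u)) = u
  · refine le_trans ?_ (hsub {u, f u, f (f u)} ?_)
    · rw [Finset.sum_insert (by simp [h01, h02]), Finset.sum_pair h12]; simp [w, h3]; omega
    · simp [SameCycle.rfl]
  refine le_trans ?_ (hsub {u, f u, f (f u), f (f (f u))} ?_)
  · rw [Finset.sum_insert (by simp [h01, h02, Ne.symm h3]), Finset.sum_insert (by simp [h12, h13]),
      Finset.sum_pair h23]
    simp only [w]; omega
  · simp [SameCycle.rfl]

theorem three_mul_numCycles [Finite D] {f : Perm D} (hf : ∀ u, f u ≠ u)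
    (h : ∀ u, f (f (f u)) = u) : 3 * numCycles f = Nat.card D := by
  have h1 := card_le_three_mul_numCycles h
  have h2 := twelve_mul_numCycles_le f hf
  have h3 : {u | f (f u) = u} = ∅ := Set.eq_empty_of_forall_notMem fun u (hu : f (f u) = u) =>
    hf u (by conv_rhs => rw [← h u, hu])
  have h4 : {u | f (f (f u)) = u} = _root_.Set.univ :=
    Set.eq_univ_of_forall h
  rw [h3, h4, Set.ncard_empty, Set.ncard_univ] at h2
  omega

variable [DecidableEq D]

theorem setoid_mul_swap_le_glue [Finite D] (f : Perm D) (x y : D) :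
    SameCycle.setoid (f * swap x y) ≤ glue (SameCycle.setoid f) x y := by
  apply setoid_le
  intro u
  have hf : ∀ u, SameCycle f u (f u) := fun u => sameCycle_apply_right.2 SameCycle.rfl
  by_cases hx : u = x
  · subst hx; simp only [Perm.mul_apply, swap_apply_left]
    exact Or.inr (Or.inl ⟨SameCycle.rfl, hf y⟩)
  by_cases hy : u = y
  · subst hy; simp only [Perm.mul_apply, swap_apply_right]
    exact Or.inr (Or.inr ⟨SameCycle.rfl, hf x⟩)
  rw [Perm.mul_apply, swap_apply_of_ne_of_ne hx hy]
  exact Or.inl (hf u)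

theorem setoid_le_glue_mul_swap [Finite D] (f : Perm D) (x y : D) :
    SameCycle.setoid f ≤ glue (SameCycle.setoid (f * swap x y)) x y := by
  simpa [mul_assoc] using setoid_mul_swap_le_glue (f * swap x y) x y

theorem sameCycle_mul_swap_of_not [Finite D] {f : Perm D} {x y : D} (h : ¬ SameCycle f x y) :
    SameCycle (f * swap x y) x y := by
  have hyy : SameCycle f y y := SameCycle.rfl
  obtain ⟨m, hm0, -, hm⟩ := hyy.exists_pow_eq''
  -- `m` is a positive period of `y`; take the least one
  have hex : ∃ m, 0 < m ∧ (f ^ m) y = y := ⟨m, hm0, hm⟩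
  classical
  obtain ⟨h0, h1⟩ := Nat.find_spec hex
  have hmin := fun k => @Nat.find_min _ _ hex k
  set m := Nat.find hex
  have key : ∀ k, k < m → ((f * swap x y) ^ (k + 1)) x = (f ^ (k + 1)) y := by
    intro k
    induction k with
    | zero => intro _; simp
    | succ k ih =>
      intro hk
      rw [pow_succ', Perm.mul_apply, ih (by omega), Perm.mul_apply, swap_apply_of_ne_of_ne,
        ← Perm.mul_apply, ← pow_succ']
      · intro hx
        exact h (SameCycle.symm ⟨(k + 1 : ℕ), by rw [zpow_natCast]; exact hx⟩)
      · exact fun hy => hmin (k + 1) hk ⟨by omega, hy⟩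
  refine ⟨m, ?_⟩
  obtain ⟨k, hk⟩ := Nat.exists_eq_succ_of_ne_zero h0.ne'
  rw [zpow_natCast, hk, Nat.succ_eq_add_one, key k (by omega), ← h1, hk]
  simpa [hk] using h1

theorem not_sameCycle_mul_swap [Finite D] {f : Perm D} {x y : D} (h : SameCycle f x y)
    (hne : x ≠ y) : ¬ SameCycle (f * swap x y) x y := by
  classical
  obtain ⟨m, hm⟩ := h.exists_nat_pow_eq
  have hex : ∃ m, (f ^ m) x = y := ⟨m, hm⟩
  have h1 := Nat.find_spec hex
  have hmin := fun k => @Nat.find_min _ _ hex k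
  set m := Nat.find hex
  -- the arc from `f x` to `y` is closed under `f * swap x y`, and `x` is not on it
  have key : ∀ n, ∃ i, 1 ≤ i ∧ i ≤ m ∧ ((f * swap x y) ^ n) y = (f ^ i) x := by
    have hm0 : m ≠ 0 := by
      intro h0; rw [h0] at h1; exact hne h1
    intro n
    induction n with
    | zero => exact ⟨m, by omega, le_rfl, h1.symm⟩
    | succ n ih =>
      obtain ⟨i, hi1, him, hi⟩ := ih
      rw [pow_succ', Perm.mul_apply, hi, Perm.mul_apply]
      rcases him.eq_or_lt with rfl | hlt
      · rw [h1]; exact ⟨1, le_rfl, by omega, by simp⟩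
      · rw [swap_apply_of_ne_of_ne, ← Perm.mul_apply, ← pow_succ']
        · exact ⟨i + 1, by omega, by omega, rfl⟩
        · intro hx
          refine hmin (m - i) (by omega) ?_
          rw [← h1]
          conv_lhs => rw [← hx]
          rw [← Perm.mul_apply, ← pow_add]
          congr 2; omega
        · exact fun hy => hmin i hlt hy
  intro hs
  obtain ⟨n, hn⟩ := hs.symm.exists_nat_pow_eq
  obtain ⟨i, hi1, him, hi⟩ := key n
  rw [hn] at hi
  rcases him.eq_or_lt with rfl | hlt
  · exact hne (hi.trans h1)
  · refine hmin (m - i) (by omega) ?_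
    rw [← h1]
    conv_lhs => rw [hi]
    rw [← Perm.mul_apply, ← pow_add]
    congr 2; omega

/-- Multiplication by a transposition of elements of different cycles merges the two cycles. -/
theorem setoid_mul_swap_of_not [Finite D] {f : Perm D} {x y : D} (h : ¬ SameCycle f x y) :
    SameCycle.setoid (f * swap x y) = glue (SameCycle.setoid f) x y :=
  le_antisymm (setoid_mul_swap_le_glue f x y)
    (glue_le ((setoid_le_glue_mul_swap f x y).trans
      (glue_eq_self (s := SameCycle.setoid (f * swap x y)) (sameCycle_mul_swap_of_not h)).le)
      (sameCycle_mul_swap_of_not h))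

/-- Multiplication by a transposition of two elements of the same cycle splits this cycle. -/
theorem setoid_eq_glue_mul_swap [Finite D] {f : Perm D} {x y : D} (h : SameCycle f x y) :
    SameCycle.setoid f = glue (SameCycle.setoid (f * swap x y)) x y :=
  le_antisymm (setoid_le_glue_mul_swap f x y)
    (glue_le ((setoid_mul_swap_le_glue f x y).trans
      (glue_eq_self (s := SameCycle.setoid f) h).le) h)

theorem numCycles_mul_swap_of_not [Finite D] {f : Perm D} {x y : D} (h : ¬ SameCycle f x y) :
    numCycles (f * swap x y) + 1 = numCycles f := by
  rw [numCycles, setoid_mul_swap_of_not h, card_glue_of_not (s := SameCycle.setoid f) h, numCycles]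

theorem numCycles_mul_swap [Finite D] {f : Perm D} {x y : D} (h : SameCycle f x y) (hne : x ≠ y) :
    numCycles (f * swap x y) = numCycles f + 1 := by
  rw [numCycles, numCycles, setoid_eq_glue_mul_swap h,
    card_glue_of_not (s := SameCycle.setoid (f * swap x y)) (not_sameCycle_mul_swap h hne)]

theorem sameCycle_of_mul_swap [Finite D] {f : Perm D} {x y u v : D} (h : SameCycle f x y)
    (huv : SameCycle (f * swap x y) u v) : SameCycle f u v := by
  have : glue (SameCycle.setoid (f * swap x y)) x y u v := Or.inl huv
  rw [← setoid_eq_glue_mul_swap h] at this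
  exact this

theorem sameCycle_mul_swap_of_sameCycle [Finite D] {f : Perm D} {x y u v : D}
    (h : ¬ SameCycle f x y) (huv : SameCycle f u v) : SameCycle (f * swap x y) u v := by
  have : glue (SameCycle.setoid f) x y u v := Or.inl huv
  rw [← setoid_mul_swap_of_not h] at this
  exact this

/-- The two parts into which a cycle is split cover it. -/
theorem sameCycle_mul_swap_split [Finite D] {f : Perm D} {x y u : D} (h : SameCycle f x y)
    (hu : SameCycle f x u) :
    SameCycle (f * swap x y) x u ∨ SameCycle (f * swap x y) y u := by
  have hu' : SameCycle.setoid f x u := hu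
  rw [setoid_eq_glue_mul_swap h] at hu'
  rcases hu' with k | ⟨_, k'⟩ | ⟨_, k'⟩
  · exact Or.inl k
  · exact Or.inr k'
  · exact Or.inl k'

theorem rel_swap {s : Setoid D} {x y : D} (h : s x y) (u : D) : s u (swap x y u) := by
  rcases eq_or_ne u x with rfl | h1
  · rw [swap_apply_left]; exact h
  rcases eq_or_ne u y with rfl | h2
  · rw [swap_apply_right]; exact s.symm h
  rw [swap_apply_of_ne_of_ne h1 h2]

/-- Removal of one transposition from an involution. -/
theorem involutive_swap_mul [Finite D] {β : Perm D} (hβ : ∀ u, β (β u) = u) {x : D}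
    (hx : β x ≠ x) : (∀ u, (swap x (β x) * β) ((swap x (β x) * β) u) = u) ∧
      {u | (swap x (β x) * β) u ≠ u}.ncard + 2 = {u | β u ≠ u}.ncard := by
  set y := β x with hy
  have hyx : β y = x := hβ x
  set β' : Perm D := swap x y * β with hdef
  have hβ'x : β' x = x := by simp [β', ← hy]
  have hβ'y : β' y = y := by simp [β', hyx]
  have hβ' : ∀ u, u ≠ x → u ≠ y → β' u = β u := by
    intro u hux huy
    simp only [β', Perm.mul_apply]
    apply swap_apply_of_ne_of_ne
    · intro h; apply huy; rw [← hyx] at h; exact β.injective h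
    · intro h; exact hux (β.injective h)
  have hset : {u | β u ≠ u} = insert x (insert y {u | β' u ≠ u}) := by
    ext u
    by_cases hux : u = x
    · subst hux; simpa using hx
    by_cases huy : u = y
    · subst huy; simp [hyx, hx.symm]
    simp [hux, huy, hβ' u hux huy]
  constructor
  · intro u
    by_cases hux : u = x
    · subst hux; rw [hβ'x, hβ'x]
    by_cases huy : u = y
    · subst huy; rw [hβ'y, hβ'y]
    rw [hβ' u hux huy, hβ', hβ]
    · intro h; apply huy; rw [← hyx] at h; exact β.injective h
    · intro h; exact hux (β.injective h)
  · rw [hset, Set.ncard_insert_of_notMem, Set.ncard_insert_of_notMem]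
    · simp [hβ'y]
    · simp [hβ'x, hx.symm]

/-- The genus does not decrease when edges are added. Here `φ` is the face permutation and
the classes of `s` are the components before, and `β` is the involution of the added edges; the
classes of `t` are the components and `φ * β` is the face permutation afterwards. Twice the genus of
a surface is `2c - V + E - F`, and `n` is twice the number of the added edges. -/
theorem exists_setoid_genus_le [Finite D] (n : ℕ) :
    ∀ (φ β : Perm D) (s : Setoid D), (∀ u, β (β u) = u) → {u | β u ≠ u}.ncard = n →
      SameCycle.setoid φ ≤ s → ∃ t : Setoid D, s ≤ t ∧ (∀ u, t u (β u)) ∧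
        4 * Nat.card (Quotient s) + 2 * numCycles (φ * β) ≤
          4 * Nat.card (Quotient t) + 2 * numCycles φ + n := by
  induction n using Nat.strong_induction_on with
  | _ n ih =>
  intro φ β s hβ hn hs
  by_cases h1 : ∃ x, β x ≠ x
  · obtain ⟨x, hx⟩ := h1
    obtain ⟨hinv, hcard⟩ := involutive_swap_mul hβ hx
    set y := β x with hy
    have hprod : φ * swap x y * (swap x y * β) = φ * β := by
      simp [mul_assoc]
    obtain ⟨t, hst, ht, hle⟩ := ih _ (by omega) (φ * swap x y) (swap x y * β) (glue s x y) hinv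
      rfl ((setoid_mul_swap_le_glue φ x y).trans
        (glue_le (hs.trans (le_glue s x y)) (glue_rel s x y)))
    refine ⟨t, (le_glue s x y).trans hst, fun u => ?_, ?_⟩
    · have := t.trans (ht u) (rel_swap (hst (glue_rel s x y)) _)
      simpa using this
    · rw [hprod] at hle
      have hstep : 4 * Nat.card (Quotient s) + 2 * numCycles (φ * swap x y) ≤
          4 * Nat.card (Quotient (glue s x y)) + 2 * numCycles φ + 2 := by
        by_cases hsxy : s x y
        · rw [glue_eq_self hsxy]
          by_cases hφ : SameCycle φ x y
          · rw [numCycles_mul_swap hφ (Ne.symm hx)]; omega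
          · have := numCycles_mul_swap_of_not hφ; omega
        · have h2 := card_glue_of_not hsxy
          have := numCycles_mul_swap_of_not (fun h => hsxy (hs h) : ¬ SameCycle φ x y)
          omega
      omega
  · push Not at h1
    have hβ1 : β = 1 := Equiv.ext h1
    refine ⟨s, le_rfl, fun u => by rw [h1], ?_⟩
    simp [hβ1]

end Equiv.Perm

/-! ### Planarity of graphs described by permutations -/

namespace SimpleGraph

open Equiv.Perm

variable {V : Type*}

instance finite_dart [Finite V] (G : SimpleGraph V) : Finite G.Dart :=
  Finite.of_injective _ (Dart.toProd_injective (G := G))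

theorem two_mul_card_edgeSet [Finite V] (G : SimpleGraph V) :
    2 * Nat.card G.edgeSet = Nat.card G.Dart := by
  classical
  have := Fintype.ofFinite V
  rw [Nat.card_eq_fintype_card, Nat.card_eq_fintype_card, dart_card_eq_twice_card_edges,
    edgeFinset_card]

/-- The reversal of darts as a permutation. -/
def dartSymm (G : SimpleGraph V) : Equiv.Perm G.Dart :=
  Function.Involutive.toPerm Dart.symm Dart.symm_involutive

@[simp] theorem dartSymm_apply (G : SimpleGraph V) (d : G.Dart) : G.dartSymm d = d.symm := rfl

namespace RotationSystem

variable {G : SimpleGraph V}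

theorem facePerm_eq (M : G.RotationSystem) : M.facePerm = M.rot * G.dartSymm := rfl

theorem facePerm_apply (M : G.RotationSystem) (d : G.Dart) : M.facePerm d = M.rot d.symm := rfl

theorem card_face (M : G.RotationSystem) : Nat.card M.Face = numCycles M.facePerm := rfl

theorem facePerm_fst (M : G.RotationSystem) (d : G.Dart) : (M.facePerm d).fst = d.snd := by
  rw [facePerm_apply, M.rot_fst]; rfl

theorem facePerm_ne (M : G.RotationSystem) (d : G.Dart) : M.facePerm d ≠ d := by
  intro h
  have := M.facePerm_fst d
  rw [h] at this
  exact d.fst_ne_snd this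

end RotationSystem

/-- Planarity from a description of the darts, their rotation and their reversal on another
type. -/
theorem isPlanar_of_model [Finite V] {G : SimpleGraph V} {D : Type*} (e : D ≃ G.Dart)
    (σ α : Equiv.Perm D) (hα : ∀ d, e (α d) = (e d).symm)
    (hfst : ∀ d, (e (σ d)).fst = (e d).fst)
    (hcyc : ∀ d d', (e d).fst = (e d').fst → σ.SameCycle d d')
    (hE : Nat.card V + (numCycles (σ * α) + Nat.card {v : V // G.IsIsolated v}) =
      Nat.card G.edgeSet + 2 * Nat.card G.ConnectedComponent) : G.IsPlanar := by
  let M : G.RotationSystem :=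
    { rot := e.permCongr σ
      rot_fst := fun d => by
        have := hfst (e.symm d)
        simpa using this
      sameCycle_of_fst_eq := fun d d' h => by
        have := (sameCycle_permCongr e σ (e.symm d) (e.symm d')).2 (hcyc _ _ (by simpa using h))
        simpa using this }
  have hM : M.facePerm = e.permCongr (σ * α) := by
    ext1 d
    rw [M.facePerm_apply]
    have := hα (e.symm d)
    simp only [Equiv.apply_symm_apply] at this
    simp [M, ← this]
  refine ⟨⟨M, ?_⟩⟩
  rw [RotationSystem.IsPlanar, M.card_face, hM, numCycles_permCongr, hE]

theorem card_connectedComponent (G : SimpleGraph V) :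
    Nat.card G.ConnectedComponent = Nat.card (Quotient G.reachableSetoid) := rfl

theorem reachableSetoid_sup_edge (G : SimpleGraph V) (u v : V) (huv : u ≠ v) :
    (G ⊔ edge u v).reachableSetoid = glue G.reachableSetoid u v := by
  apply le_antisymm
  · rintro a b ⟨p⟩
    induction p with
    | nil => exact Setoid.refl' _ _
    | cons h _ ih =>
      refine Setoid.trans' _ ?_ ih
      rcases h with h | h
      · exact Or.inl h.reachable
      · rw [edge_adj] at h
        rcases h with ⟨⟨rfl, rfl⟩ | ⟨rfl, rfl⟩, -⟩
        · exact glue_rel _ _ _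
        · exact Setoid.symm' _ (glue_rel _ _ _)
  · refine glue_le (fun a b (h : G.Reachable a b) => h.mono le_sup_left) ?_
    exact Adj.reachable (Or.inr (by rw [edge_adj]; exact ⟨Or.inl ⟨rfl, rfl⟩, huv⟩))

theorem isIsolated_sup_edge (G : SimpleGraph V) (u v : V) (huv : u ≠ v) (w : V) :
    (G ⊔ edge u v).IsIsolated w ↔ G.IsIsolated w ∧ w ≠ u ∧ w ≠ v := by
  simp only [IsIsolated, sup_adj, edge_adj, not_or]
  constructor
  · intro h
    refine ⟨fun x => (h x).1, ?_, ?_⟩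
    · rintro rfl; exact (h v).2 ⟨Or.inl ⟨rfl, rfl⟩, huv⟩
    · rintro rfl; exact (h u).2 ⟨Or.inr ⟨rfl, rfl⟩, huv.symm⟩
  · rintro ⟨h, h1, h2⟩ x
    refine ⟨h x, ?_⟩
    rintro ⟨⟨rfl, rfl⟩ | ⟨rfl, rfl⟩, -⟩
    · exact h1 rfl
    · exact h2 rfl

section Insertion

variable {G : SimpleGraph V} {u v : V}

/-- The darts of a graph with one more edge `uv`: `false` is the new dart from `u` to `v`, and
`true` the one from `v` to `u`. -/
noncomputable def dartSupEdge (huv : u ≠ v) (hadj : ¬ G.Adj u v) :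
    G.Dart ⊕ Bool ≃ (G ⊔ edge u v).Dart :=
  Equiv.ofBijective
    (Sum.elim (fun d => ⟨d.toProd, Or.inl d.adj⟩)
      (fun b => if b then ⟨(v, u), Or.inr (by rw [edge_adj]; exact ⟨Or.inr ⟨rfl, rfl⟩, huv.symm⟩)⟩
        else ⟨(u, v), Or.inr (by rw [edge_adj]; exact ⟨Or.inl ⟨rfl, rfl⟩, huv⟩)⟩)) <| by
    constructor
    · rintro (d | _ | _) (d' | _ | _) h <;> have h := congrArg Dart.toProd h <;>
        simp [Prod.ext_iff] at h
      · rw [Dart.ext d d' (Prod.ext h.1 h.2)]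
      · exact absurd (h.1 ▸ h.2 ▸ d.adj) hadj
      · exact absurd (h.1 ▸ h.2 ▸ d.adj.symm) hadj
      · exact absurd (h.1 ▸ h.2 ▸ d'.adj) hadj
      · rfl
      · exact absurd h.1 huv
      · exact absurd (h.1 ▸ h.2 ▸ d'.adj.symm) hadj
      · exact absurd h.1 huv.symm
      · rfl
    · rintro ⟨⟨a, b⟩, h | h⟩
      · exact ⟨.inl ⟨(a, b), h⟩, rfl⟩
      · rw [edge_adj] at h
        rcases h with ⟨⟨rfl, rfl⟩ | ⟨rfl, rfl⟩, -⟩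
        · exact ⟨.inr false, rfl⟩
        · exact ⟨.inr true, rfl⟩

open Classical in
/-- Right multiplication of the rotation by `A` inserts the new dart (leg) `l` into the rotation
at the vertex `w`: after an arbitrary dart, or alone if `w` is isolated. The number `i` of isolated
vertices that disappear is recorded. -/
def IsLegInsertion (G : SimpleGraph V) (w : V) (l : Bool) (A : Equiv.Perm (G.Dart ⊕ Bool))
    (i : ℕ) : Prop :=
  (A = 1 ∧ G.IsIsolated w ∧ i = 1) ∨
    ∃ x : G.Dart, x.fst = w ∧ A = Equiv.swap (.inl x) (.inr l) ∧ ¬ G.IsIsolated w ∧ i = 0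

theorem exists_isLegInsertion (G : SimpleGraph V) (w : V) (l : Bool) :
    ∃ A i, IsLegInsertion G w l A i := by
  classical
  by_cases h : G.IsIsolated w
  · exact ⟨1, 1, Or.inl ⟨rfl, h, rfl⟩⟩
  · obtain ⟨x, hx⟩ := exists_adj_iff_not_isIsolated.2 h
    exact ⟨_, 0, Or.inr ⟨⟨(w, x), hx⟩, rfl, rfl, h, rfl⟩⟩

/-- Edge insertion: a rotation with two legs inserted describes the graph with the new edge, so
that only Euler's formula is left to check. -/
theorem isPlanar_sup_edge_aux [Finite V] (huv : u ≠ v) (hadj : ¬ G.Adj u v) (M : G.RotationSystem)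
    {A B : Equiv.Perm (G.Dart ⊕ Bool)} {i j : ℕ} (hA : IsLegInsertion G u false A i)
    (hB : IsLegInsertion G v true B j)
    (hE : Nat.card V + (numCycles (Equiv.sumCongr M.rot 1 * A * B *
      Equiv.sumCongr G.dartSymm (Equiv.swap false true)) +
        Nat.card {w : V // (G ⊔ edge u v).IsIsolated w}) =
      Nat.card G.edgeSet + 1 + 2 * Nat.card (G ⊔ edge u v).ConnectedComponent) :
    (G ⊔ edge u v).IsPlanar := by
  classical
  have hcard : Nat.card (G ⊔ edge u v).edgeSet = Nat.card G.edgeSet + 1 := by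
    have h1 := two_mul_card_edgeSet (G ⊔ edge u v)
    have h2 := two_mul_card_edgeSet G
    rw [← Nat.card_congr (dartSupEdge huv hadj), Nat.card_sum] at h1
    rw [Nat.card_eq_fintype_card (α := Bool), Fintype.card_bool] at h1
    omega
  let q : G.Dart ⊕ Bool → V := fun d => (dartSupEdge huv hadj d).fst
  have hqA : ∀ d, q (A d) = q d := by
    rcases hA with ⟨rfl, -⟩ | ⟨x, hx, rfl, -⟩
    · intro d; rfl
    · intro d
      rcases eq_or_ne d (.inl x) with rfl | h1
      · rw [Equiv.swap_apply_left]; exact hx.symm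
      rcases eq_or_ne d (.inr false) with rfl | h2
      · rw [Equiv.swap_apply_right]; exact hx
      rw [Equiv.swap_apply_of_ne_of_ne h1 h2]
  have hqB : ∀ d, q (B d) = q d := by
    rcases hB with ⟨rfl, -⟩ | ⟨x, hx, rfl, -⟩
    · intro d; rfl
    · intro d
      rcases eq_or_ne d (.inl x) with rfl | h1
      · rw [Equiv.swap_apply_left]; exact hx.symm
      rcases eq_or_ne d (.inr true) with rfl | h2
      · rw [Equiv.swap_apply_right]; exact hx
      rw [Equiv.swap_apply_of_ne_of_ne h1 h2]
  have hqσ : ∀ d, q ((Equiv.sumCongr M.rot 1 : Equiv.Perm (G.Dart ⊕ Bool)) d) = q d := by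
    rintro (d | d)
    · exact M.rot_fst d
    · rfl
  set σ0 : Equiv.Perm (G.Dart ⊕ Bool) := Equiv.sumCongr M.rot 1 with hσ0
  have h0 : ∀ d d' : G.Dart, d.fst = d'.fst → σ0.SameCycle (.inl d) (.inl d') :=
    fun d d' h => (sameCycle_sumCongr_inl _ _ _ _).2 (M.sameCycle_of_fst_eq d d' h)
  have hfix : ∀ (b : Bool) (d), σ0.SameCycle d (.inr b) → d = .inr b :=
    fun b d h => h.eq_of_right rfl
  have hA1 : (∀ d d' : G.Dart, d.fst = d'.fst → (σ0 * A).SameCycle (.inl d) (.inl d')) ∧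
      (∀ d : G.Dart, d.fst = u → (σ0 * A).SameCycle (.inl d) (.inr false)) ∧
      (∀ d, (σ0 * A).SameCycle d (.inr true) → d = .inr true) := by
    rcases hA with ⟨rfl, hiso, -⟩ | ⟨x, hx, rfl, -⟩
    · refine ⟨by simpa using h0, ?_, by simpa using hfix true⟩
      rintro d rfl
      exact absurd d.adj (hiso _)
    · have hn : ¬ σ0.SameCycle (.inl x) (.inr false) := fun h => by simpa using hfix _ _ h
      refine ⟨fun d d' h => sameCycle_mul_swap_of_sameCycle hn (h0 d d' h), fun d h => ?_, ?_⟩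
      · exact (sameCycle_mul_swap_of_sameCycle hn (h0 d x (h.trans hx.symm))).trans
          (sameCycle_mul_swap_of_not hn)
      · intro d hd
        refine hd.eq_of_right ?_
        show (σ0 * Equiv.swap (.inl x) (.inr false) : Equiv.Perm (G.Dart ⊕ Bool)) _ = _
        rw [Equiv.Perm.mul_apply, Equiv.swap_apply_of_ne_of_ne (by simp) (by simp)]
        rfl
  have hB1 : (∀ d d' : G.Dart, d.fst = d'.fst → (σ0 * A * B).SameCycle (.inl d) (.inl d')) ∧
      (∀ d : G.Dart, d.fst = u → (σ0 * A * B).SameCycle (.inl d) (.inr false)) ∧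
      (∀ d : G.Dart, d.fst = v → (σ0 * A * B).SameCycle (.inl d) (.inr true)) := by
    rcases hB with ⟨rfl, hiso, -⟩ | ⟨x, hx, rfl, -⟩
    · refine ⟨by simpa using hA1.1, by simpa using hA1.2.1, ?_⟩
      rintro d rfl
      exact absurd d.adj (hiso _)
    · have hn : ¬ (σ0 * A).SameCycle (.inl x) (.inr true) := fun h => by simpa using hA1.2.2 _ h
      refine ⟨fun d d' h => sameCycle_mul_swap_of_sameCycle hn (hA1.1 d d' h), fun d h =>
        sameCycle_mul_swap_of_sameCycle hn (hA1.2.1 d h), fun d h => ?_⟩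
      exact (sameCycle_mul_swap_of_sameCycle hn (hA1.1 d x (h.trans hx.symm))).trans
          (sameCycle_mul_swap_of_not hn)
  refine isPlanar_of_model (dartSupEdge huv hadj) (σ0 * A * B)
    (Equiv.sumCongr G.dartSymm (Equiv.swap false true)) ?_ ?_ ?_ (by rw [hE, hcard])
  · rintro (d | _ | _) <;> rfl
  · intro d
    exact (hqσ _).trans ((hqA _).trans (hqB _))
  · obtain ⟨h1, h2, h3⟩ := hB1
    rintro (d | _ | _) (d' | _ | _) h
    · exact h1 d d' h
    · exact h2 d h
    · exact h3 d h
    · exact (h2 d' h.symm).symm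
    · exact SameCycle.rfl
    · exact absurd h huv
    · exact (h3 d' h.symm).symm
    · exact absurd h huv.symm
    · exact SameCycle.rfl

open Classical in
/-- The leg insertions `A` and `B` carried over from the rotation to the face permutation. The new
face permutation is that of the drawing with two dangling legs, `ψ`, times the transposition that
joins the legs. A leg at an isolated vertex is a face of its own in `ψ`, and any other leg is
part of an old face. The faces of `ψ` stay within a component, and contain both legs if these are
inserted into corners of the same face. -/
theorem exists_numCycles_legs [Finite V] (M : G.RotationSystem)
    {A B : Equiv.Perm (G.Dart ⊕ Bool)} {i j : ℕ} (hA : IsLegInsertion G u false A i)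
    (hB : IsLegInsertion G v true B j) :
    ∃ ψ : Equiv.Perm (G.Dart ⊕ Bool),
      Equiv.sumCongr M.rot 1 * A * B * Equiv.sumCongr G.dartSymm (Equiv.swap false true) =
        ψ * Equiv.swap (.inr false) (.inr true) ∧
      numCycles ψ = numCycles M.facePerm + i + j ∧
      (∀ p : V → Prop, (∀ a b, G.Adj a b → (p a ↔ p b)) → ∀ d d', ψ.SameCycle d d' →
        (p (Sum.elim (fun d => d.fst) (fun b => if b then v else u) d) ↔
          p (Sum.elim (fun d => d.fst) (fun b => if b then v else u) d'))) ∧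
      ∀ x y : G.Dart, A = Equiv.swap (.inl x) (.inr false) → B = Equiv.swap (.inl y) (.inr true) →
        M.facePerm.SameCycle x.symm y.symm → ψ.SameCycle (.inr false) (.inr true) := by
  set σ0 : Equiv.Perm (G.Dart ⊕ Bool) := Equiv.sumCongr M.rot 1 with hσ0
  set α0 : Equiv.Perm (G.Dart ⊕ Bool) := Equiv.sumCongr G.dartSymm 1 with hα0
  set ψ0 : Equiv.Perm (G.Dart ⊕ Bool) := Equiv.sumCongr M.facePerm 1 with hψ0
  have hψ : σ0 * α0 = ψ0 := by
    ext1 d; rcases d with d | d <;> rfl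
  have hτ : (Equiv.sumCongr G.dartSymm (Equiv.swap false true) : Equiv.Perm (G.Dart ⊕ Bool)) =
      α0 * Equiv.swap (.inr false) (.inr true) := by
    ext1 d
    rcases d with d | _ | _
    · rw [Equiv.Perm.mul_apply, Equiv.swap_apply_of_ne_of_ne (by simp) (by simp)]; rfl
    · rw [Equiv.Perm.mul_apply, Equiv.swap_apply_left]; rfl
    · rw [Equiv.Perm.mul_apply, Equiv.swap_apply_right]; rfl
  have hconj : ∀ (x : G.Dart) (b : Bool), Equiv.swap (.inl x) (.inr b) * α0 =
      α0 * Equiv.swap (.inl x.symm) (.inr b) := by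
    intro x b
    rw [Equiv.swap_mul_eq_mul_swap]; rfl
  have hconj' : ∀ w l C k, IsLegInsertion G w l C k → ∃ C', C * α0 = α0 * C' ∧
      ((C = 1 ∧ C' = 1 ∧ k = 1) ∨ ∃ x : G.Dart, x.fst = w ∧ C = Equiv.swap (.inl x) (.inr l) ∧
        C' = Equiv.swap (.inl x.symm) (.inr l) ∧ k = 0) := by
    rintro w l C k (⟨rfl, -, rfl⟩ | ⟨x, hx, rfl, -, rfl⟩)
    · exact ⟨1, by simp, Or.inl ⟨rfl, rfl, rfl⟩⟩
    · exact ⟨_, hconj x l, Or.inr ⟨x, hx, rfl, rfl, rfl⟩⟩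
  obtain ⟨A', hAA', hA'⟩ := hconj' _ _ _ _ hA
  obtain ⟨B', hBB', hB'⟩ := hconj' _ _ _ _ hB
  have hfix : ∀ (b : Bool) (d), ψ0.SameCycle d (.inr b) → d = .inr b :=
    fun b d h => h.eq_of_right rfl
  have hn0 : numCycles ψ0 = numCycles M.facePerm + 2 := by
    rw [hψ0, numCycles_sumCongr]
    congr 1
    exact numCycles_one.trans (by rw [Nat.card_eq_fintype_card, Fintype.card_bool])
  have hA1 : numCycles (ψ0 * A') + 1 = numCycles ψ0 + i ∧
      (∀ d, (ψ0 * A').SameCycle d (.inr true) → d = .inr true) := by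
    rcases hA' with ⟨-, rfl, rfl⟩ | ⟨x, hx, -, rfl, rfl⟩
    · refine ⟨by simp, by simpa using hfix true⟩
    · refine ⟨numCycles_mul_swap_of_not fun h => by simpa using hfix _ _ h, ?_⟩
      intro d hd
      refine hd.eq_of_right ?_
      show (ψ0 * Equiv.swap (.inl x.symm) (.inr false) : Equiv.Perm (G.Dart ⊕ Bool)) _ = _
      rw [Equiv.Perm.mul_apply, Equiv.swap_apply_of_ne_of_ne (by simp) (by simp)]
      rfl
  have hB1 : numCycles (ψ0 * A' * B') + 1 = numCycles (ψ0 * A') + j := by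
    rcases hB' with ⟨-, rfl, rfl⟩ | ⟨x, hx, -, rfl, rfl⟩
    · simp
    · exact numCycles_mul_swap_of_not fun h => by simpa using hA1.2 _ h
  refine ⟨ψ0 * A' * B', ?_, by omega, ?_, ?_⟩
  · rw [hτ, ← hψ]
    simp only [mul_assoc]
    rw [← mul_assoc B, hBB', mul_assoc α0 B', ← mul_assoc A, hAA', mul_assoc α0 A']
  · intro p hp d d' hdd
    set r : G.Dart ⊕ Bool → V := Sum.elim (fun d => d.fst) (fun b => if b then v else u)
    have hr0 : ∀ d, p (r (ψ0 d)) = p (r d) := by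
      rintro (d | d)
      · apply propext
        show p (M.facePerm d).fst ↔ p d.fst
        rw [M.facePerm_fst]
        exact (hp _ _ d.adj).symm
      · rfl
    have hsw : ∀ (x : G.Dart) (b : Bool), x.fst = (if b then v else u) →
        ∀ d, p (r (Equiv.swap (.inl x.symm) (.inr b) d)) = p (r d) := by
      intro x b hx d
      have hpx : p (r (.inl x.symm)) = p (r (.inr b)) := by
        apply propext
        show p x.snd ↔ p (if b then v else u)
        rw [← hx]
        exact (hp _ _ x.adj).symm
      rcases eq_or_ne d (.inl x.symm) with rfl | h1
      · rw [Equiv.swap_apply_left, hpx]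
      rcases eq_or_ne d (.inr b) with rfl | h2
      · rw [Equiv.swap_apply_right, hpx]
      rw [Equiv.swap_apply_of_ne_of_ne h1 h2]
    have hrA : ∀ d, p (r (A' d)) = p (r d) := by
      rcases hA' with ⟨-, rfl, -⟩ | ⟨x, hx, -, rfl, -⟩
      · intro d; rfl
      · exact hsw x false hx
    have hrB : ∀ d, p (r (B' d)) = p (r d) := by
      rcases hB' with ⟨-, rfl, -⟩ | ⟨x, hx, -, rfl, -⟩
      · intro d; rfl
      · exact hsw x true hx
    exact (apply_eq_of_sameCycle (fun d => p (r d))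
      (fun d => (hr0 (A' (B' d))).trans ((hrA (B' d)).trans (hrB d))) hdd).to_iff
  · intro x y hAx hBy hxy
    have hxyψ : ψ0.SameCycle (Sum.inl x.symm) (.inl y.symm) :=
      (sameCycle_sumCongr_inl _ _ _ _).2 hxy
    have hA2 : A' = Equiv.swap (.inl x.symm) (.inr false) := by
      rw [hAx, hconj] at hAA'; exact (mul_left_cancel hAA').symm
    have hB2 : B' = Equiv.swap (.inl y.symm) (.inr true) := by
      rw [hBy, hconj] at hBB'; exact (mul_left_cancel hBB').symm
    rw [hA2] at hA1 ⊢
    rw [hB2]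
    have hnA : ¬ ψ0.SameCycle (.inl x.symm) (.inr false) := fun h => by simpa using hfix _ _ h
    have hnB : ¬ (ψ0 * Equiv.swap (Sum.inl x.symm) (Sum.inr false)).SameCycle (.inl y.symm)
      (.inr true) := fun h => by simpa using hA1.2 _ h
    exact ((sameCycle_mul_swap_of_sameCycle hnB
      ((sameCycle_mul_swap_of_not hnA).symm.trans
        (sameCycle_mul_swap_of_sameCycle hnA hxyψ))).trans (sameCycle_mul_swap_of_not hnB))

/-- Two vertices of different components of a planar graph can be joined by an edge. -/
theorem IsPlanar.sup_edge_of_not_reachable [Finite V] (hG : G.IsPlanar) (h : ¬ G.Reachable u v) :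
    (G ⊔ edge u v).IsPlanar := by
  classical
  have huv : u ≠ v := by rintro rfl; exact h (Reachable.refl u)
  have hadj : ¬ G.Adj u v := fun k => h k.reachable
  obtain ⟨⟨M, hM⟩⟩ := hG
  obtain ⟨A, i, hA⟩ := exists_isLegInsertion G u false
  obtain ⟨B, j, hB⟩ := exists_isLegInsertion G v true
  refine isPlanar_sup_edge_aux huv hadj M hA hB ?_
  obtain ⟨ψ, hψ, hn, hp, -⟩ := exists_numCycles_legs M hA hB
  rw [hψ]
  have hnot : ¬ ψ.SameCycle (.inr false) (.inr true) := fun hs => by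
    have := hp (G.Reachable u) (fun a b hab => ⟨fun k => k.trans hab.reachable,
      fun k => k.trans hab.symm.reachable⟩) _ _ hs
    exact h (this.1 (Reachable.refl u))
  have h1 := numCycles_mul_swap_of_not hnot
  have h2 : Nat.card (G ⊔ edge u v).ConnectedComponent + 1 = Nat.card G.ConnectedComponent := by
    rw [card_connectedComponent, card_connectedComponent, reachableSetoid_sup_edge G u v huv]
    exact card_glue_of_not h
  have h3 : Nat.card {w : V // (G ⊔ edge u v).IsIsolated w} + i + j =
      Nat.card {w : V // G.IsIsolated w} := by
    have e1 : ∀ H : SimpleGraph V, Nat.card {w : V // H.IsIsolated w} =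
      {w : V | H.IsIsolated w}.ncard := fun H => rfl
    rw [e1, e1]
    have e2 : {w : V | (G ⊔ edge u v).IsIsolated w} = ({w : V | G.IsIsolated w} \ {u}) \ {v} := by
      ext w
      simp [isIsolated_sup_edge G u v huv, and_assoc]
    rw [e2]
    have hi : ({w : V | G.IsIsolated w} \ {u}).ncard + i = {w : V | G.IsIsolated w}.ncard := by
      rcases hA with ⟨-, hu, rfl⟩ | ⟨x, hx, -, hu, rfl⟩
      · exact Set.ncard_sdiff_singleton_add_one hu
      · rw [Set.sdiff_singleton_eq_self hu]; rfl
    have hj : (({w : V | G.IsIsolated w} \ {u}) \ {v}).ncard + j =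
        ({w : V | G.IsIsolated w} \ {u}).ncard := by
      rcases hB with ⟨-, hu, rfl⟩ | ⟨x, hx, -, hu, rfl⟩
      · exact Set.ncard_sdiff_singleton_add_one ⟨hu, huv.symm⟩
      · rw [Set.sdiff_singleton_eq_self (fun k => hu k.1)]; rfl
    omega
  rw [RotationSystem.IsPlanar, M.card_face] at hM
  omega

/-- Two nonadjacent vertices on the boundary of the same face can be joined by an edge. -/
theorem PlanarDrawing.isPlanar_sup_edge [Finite V] (M : G.PlanarDrawing) (huv : u ≠ v)
    (hadj : ¬ G.Adj u v) (x y : G.Dart) (hx : x.fst = u) (hy : y.fst = v)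
    (hxy : M.facePerm.SameCycle x y) : (G ⊔ edge u v).IsPlanar := by
  classical
  -- the corners of the face are just before the darts `x` and `y` in the rotation
  set x' := M.rot.symm x with hx'
  set y' := M.rot.symm y with hy'
  have hxx : M.rot x' = x := by simp [hx']
  have hyy : M.rot y' = y := by simp [hy']
  have hxf : x'.fst = u := by rw [← hx, ← hxx, M.rot_fst]
  have hyf : y'.fst = v := by rw [← hy, ← hyy, M.rot_fst]
  have hφx : M.facePerm x'.symm = x := by rw [M.facePerm_apply, Dart.symm_symm, hxx]
  have hφy : M.facePerm y'.symm = y := by rw [M.facePerm_apply, Dart.symm_symm, hyy]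
  have hs : M.facePerm.SameCycle x'.symm y'.symm := by
    rw [← sameCycle_apply_left, ← sameCycle_apply_right, hφx, hφy]; exact hxy
  have hiu : ¬ G.IsIsolated u := fun h => h x.snd (hx ▸ x.adj)
  have hiv : ¬ G.IsIsolated v := fun h => h y.snd (hy ▸ y.adj)
  have hA : IsLegInsertion G u false (Equiv.swap (.inl x') (.inr false)) 0 :=
    Or.inr ⟨x', hxf, rfl, hiu, rfl⟩
  have hB : IsLegInsertion G v true (Equiv.swap (.inl y') (.inr true)) 0 :=
    Or.inr ⟨y', hyf, rfl, hiv, rfl⟩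
  refine isPlanar_sup_edge_aux huv hadj M.toRotationSystem hA hB ?_
  obtain ⟨ψ, hψ, hn, hp, hsame⟩ := exists_numCycles_legs M.toRotationSystem hA hB
  rw [hψ, numCycles_mul_swap (hsame x' y' rfl rfl hs) (by simp)]
  have hreach : G.Reachable u v := by
    have := apply_eq_of_sameCycle (fun d : G.Dart => G.connectedComponentMk d.fst) (fun d => by
      rw [M.facePerm_fst]
      exact ConnectedComponent.sound d.adj.reachable.symm) hxy
    rw [hx, hy] at this
    exact ConnectedComponent.exact this
  have h2 : Nat.card (G ⊔ edge u v).ConnectedComponent = Nat.card G.ConnectedComponent := by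
    rw [card_connectedComponent, card_connectedComponent, reachableSetoid_sup_edge G u v huv,
      glue_eq_self hreach]
  have h3 : Nat.card {w : V // (G ⊔ edge u v).IsIsolated w} =
      Nat.card {w : V // G.IsIsolated w} := by
    refine Nat.card_congr (Equiv.subtypeEquivRight fun w => ?_)
    rw [isIsolated_sup_edge G u v huv]
    exact ⟨fun h => h.1, fun h => ⟨h, by rintro rfl; exact hiu h, by rintro rfl; exact hiv h⟩⟩
  have hM := M.isPlanar
  rw [RotationSystem.IsPlanar, RotationSystem.card_face] at hM
  omega

end Insertion

end SimpleGraph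

/-! ### Triangulations and Euler's formula -/

namespace SimpleGraph

open Equiv.Perm

variable {V : Type*}

/-- A connected graph with at least three vertices and with as many edges as a triangulation of
the sphere. Planarity is not included: it comes with the drawings of the graph. -/
structure IsTriangulation [Finite V] (G : SimpleGraph V) : Prop where
  connected : G.Connected
  three_le : 3 ≤ Nat.card V
  card_edgeSet : Nat.card G.edgeSet + 6 = 3 * Nat.card V

theorem Connected.exists_adj [Finite V] {G : SimpleGraph V} (hG : G.Connected)
    (hV : 2 ≤ Nat.card V) (v : V) : ∃ w, G.Adj v w := by
  have : Nontrivial V := Finite.one_lt_card_iff_nontrivial.1 hV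
  exact hG.preconnected.exists_adj_of_nontrivial v

theorem Connected.card_add_card_face [Finite V] {G : SimpleGraph V} (hG : G.Connected)
    (hV : 2 ≤ Nat.card V) (M : G.PlanarDrawing) :
    Nat.card V + numCycles M.facePerm = Nat.card G.edgeSet + 2 := by
  have h := M.isPlanar
  rw [RotationSystem.IsPlanar, RotationSystem.card_face] at h
  have h1 : Nat.card {v : V // G.IsIsolated v} = 0 := by
    have : IsEmpty {v : V // G.IsIsolated v} := ⟨fun v => by
      obtain ⟨w, hw⟩ := hG.exists_adj hV v.1
      exact v.2 w hw⟩
    exact Nat.card_of_isEmpty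
  have h2 : Nat.card G.ConnectedComponent = 1 := by
    have := hG.preconnected.subsingleton_connectedComponent
    have : Nonempty V := hG.nonempty
    exact Nat.card_eq_one_iff_unique.2
      ⟨inferInstance, ⟨G.connectedComponentMk (Classical.arbitrary V)⟩⟩
  omega

namespace RotationSystem

variable {G : SimpleGraph V}

theorem sameCycle_rot_iff [Finite V] (M : G.RotationSystem) (d d' : G.Dart) :
    M.rot.SameCycle d d' ↔ d.fst = d'.fst :=
  ⟨fun h => apply_eq_of_sameCycle (fun d : G.Dart => d.fst) M.rot_fst h,
    M.sameCycle_of_fst_eq d d'⟩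

theorem numCycles_rot [Finite V] (M : G.RotationSystem) (h : ∀ v, ∃ w, G.Adj v w) :
    numCycles M.rot = Nat.card V := by
  refine Nat.card_congr (Equiv.ofBijective (Quotient.lift (fun d : G.Dart => d.fst)
    fun d d' h => (M.sameCycle_rot_iff d d').1 h) ⟨?_, ?_⟩)
  · intro q r
    induction q using Quotient.inductionOn with | _ d
    induction r using Quotient.inductionOn with | _ d'
    intro h
    exact Quotient.sound (M.sameCycle_of_fst_eq d d' h)
  · intro v
    obtain ⟨w, hw⟩ := h v
    exact ⟨Quotient.mk _ ⟨(v, w), hw⟩, rfl⟩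

/-- In a connected graph, darts at a common vertex and darts of a common edge generate the full
relation. -/
theorem card_quotient_le_one [Finite V] (M : G.RotationSystem) (hG : G.Connected)
    {t : Setoid G.Dart} (ht : SameCycle.setoid M.rot ≤ t) (hs : ∀ d : G.Dart, t d d.symm) :
    Nat.card (Quotient t) ≤ 1 := by
  have key : ∀ (x : G.Dart) (v : V), G.Reachable x.fst v → ∀ y : G.Dart, y.fst = v → t x y := by
    intro x v hv
    obtain ⟨p⟩ := hv.symm
    suffices H : ∀ a b : V, ∀ _ : G.Walk a b, ∀ x y : G.Dart, x.fst = b → y.fst = a → t x y from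
      fun y hy => H v x.fst p x y rfl hy
    intro a b p
    induction p with
    | nil => exact fun x y hx hy => ht (M.sameCycle_of_fst_eq x y (hx.trans hy.symm))
    | cons h _ ih =>
      intro x y hx hy
      have h1 := ih x ⟨(_, _), h.symm⟩ hx rfl
      refine t.trans h1 (t.trans (hs _) (ht (M.sameCycle_of_fst_eq _ _ ?_)))
      exact hy.symm
  have : Subsingleton (Quotient t) := ⟨fun q r => by
    induction q using Quotient.inductionOn with | _ d
    induction r using Quotient.inductionOn with | _ d'
    exact Quotient.sound (key d d'.fst (hG.preconnected _ _) d' rfl)⟩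
  exact Finite.card_le_one_iff_subsingleton.2 this

end RotationSystem

theorem setOf_dartSymm_ne_ncard [Finite V] (G : SimpleGraph V) :
    {d | G.dartSymm d ≠ d}.ncard = 2 * Nat.card G.edgeSet := by
  rw [two_mul_card_edgeSet, ← Set.ncard_univ]
  congr 1
  ext d
  simp [Dart.symm_ne]

namespace PlanarDrawing

variable [Finite V] {G : SimpleGraph V}

/-- An edge with the same face on both sides is a bridge, so it is in no triangle: without the edge
there would be one more face, although the graph would remain connected because of the triangle. -/
theorem not_sameCycle_symm (M : G.PlanarDrawing) (hG : G.Connected) (hV : 2 ≤ Nat.card V)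
    (d : G.Dart) {c : V} (h1 : G.Adj d.fst c) (h2 : G.Adj d.snd c) :
    ¬ M.facePerm.SameCycle d d.symm := by
  classical
  intro hs
  have hne : G.dartSymm d ≠ d := d.symm_ne
  obtain ⟨hinv, hcard⟩ := involutive_swap_mul (β := G.dartSymm) (fun u => u.symm_symm) hne
  rw [setOf_dartSymm_ne_ncard] at hcard
  set β := Equiv.swap d (G.dartSymm d) * G.dartSymm with hβ
  obtain ⟨t, hst, ht, hle⟩ := exists_setoid_genus_le _ M.rot β (SameCycle.setoid M.rot) hinv rfl
    le_rfl
  have hprod : M.rot * β = M.facePerm * Equiv.swap d d.symm := by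
    have : β = G.dartSymm * Equiv.swap d d.symm := by
      rw [hβ, Equiv.swap_mul_eq_mul_swap]
      congr 1
      rw [Equiv.swap_comm]
      rfl
    rw [this, ← mul_assoc]; rfl
  rw [hprod, numCycles_mul_swap hs (Ne.symm hne)] at hle
  have hV' : Nat.card (Quotient (SameCycle.setoid M.rot)) = Nat.card V :=
    M.numCycles_rot (hG.exists_adj hV)
  have hV'' : numCycles M.rot = Nat.card V := hV'
  have hE := hG.card_add_card_face hV M
  have hβe : ∀ e : G.Dart, e ≠ d → e ≠ d.symm → β e = e.symm := by
    intro e h1 h2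
    rw [hβ, Equiv.Perm.mul_apply, Equiv.swap_apply_of_ne_of_ne]
    · rfl
    · intro h; apply h2; rw [← h]; exact e.symm_symm.symm
    · intro h; exact h1 (G.dartSymm.injective h)
  have hrot : ∀ e e' : G.Dart, e.fst = e'.fst → t e e' := fun e e' h =>
    hst (M.sameCycle_of_fst_eq e e' h)
  -- the edge `d` can be replaced by the path through `c`
  have hd : t d d.symm := by
    have e1 : t ⟨(d.fst, c), h1⟩ ⟨(c, d.fst), h1.symm⟩ := by
      have := ht ⟨(d.fst, c), h1⟩
      rw [hβe] at this
      · exact this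
      · intro h; exact h2.ne (congrArg (fun e : G.Dart => e.snd) h).symm
      · intro h; exact d.fst_ne_snd (congrArg (fun e : G.Dart => e.fst) h)
    have e2 : t ⟨(c, d.snd), h2.symm⟩ ⟨(d.snd, c), h2⟩ := by
      have := ht ⟨(c, d.snd), h2.symm⟩
      rw [hβe] at this
      · exact this
      · intro h; exact h1.ne (congrArg (fun e : G.Dart => e.fst) h).symm
      · intro h; exact d.fst_ne_snd (congrArg (fun e : G.Dart => e.snd) h).symm
    exact t.trans (hrot _ ⟨(d.fst, c), h1⟩ rfl) (t.trans e1
      (t.trans (hrot _ ⟨(c, d.snd), h2.symm⟩ rfl) (t.trans e2 (hrot _ _ rfl))))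
  have hsymm : ∀ e : G.Dart, t e e.symm := by
    intro e
    by_cases h1 : e = d
    · rw [h1]; exact hd
    by_cases h2 : e = d.symm
    · rw [h2, Dart.symm_symm]; exact t.symm hd
    rw [← hβe e h1 h2]; exact ht e
  have := M.card_quotient_le_one hG hst hsymm
  omega

end PlanarDrawing

end SimpleGraph

/-! ### Four pairwise adjacent vertices on a face -/

namespace Equiv.Perm

variable {D : Type*} [DecidableEq D]

/-- The cyclic permutation `p ↦ q ↦ r ↦ s ↦ p`. -/
def fourCycle (p q r s : D) : Perm D := swap p r * swap p q * swap r s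

/-- Four elements of one cycle can be arranged so that multiplication by the four-cycle on them
splits this cycle into four. -/
theorem exists_fourCycle_split [Finite D] (f : Perm D) (y : Fin 4 → D)
    (hy : Function.Injective y) (hs : ∀ i j, SameCycle f (y i) (y j)) :
    ∃ e : Perm (Fin 4), numCycles (f * fourCycle (y (e 0)) (y (e 1)) (y (e 2)) (y (e 3))) =
      numCycles f + 3 := by
  have h01 : y 0 ≠ y 1 := fun h => by simpa using hy h
  have h02 : y 0 ≠ y 2 := fun h => by simpa using hy h
  have h03 : y 0 ≠ y 3 := fun h => by simpa using hy h
  have h12 : y 1 ≠ y 2 := fun h => by simpa using hy h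
  have h13 : y 1 ≠ y 3 := fun h => by simpa using hy h
  have h23 : y 2 ≠ y 3 := fun h => by simpa using hy h
  set f1 := f * swap (y 0) (y 1) with hf1
  have n1 : numCycles f1 = numCycles f + 1 := numCycles_mul_swap (hs 0 1) h01
  have c2 := sameCycle_mul_swap_split (hs 0 1) (hs 0 2)
  have c3 := sameCycle_mul_swap_split (hs 0 1) (hs 0 3)
  rw [← hf1] at c2 c3
  -- the cycle of `f * swap (y 0) (y 1) * swap (y i) (y 2)` containing `y 3` contains
  -- one of the other three
  have step : ∀ i : Fin 4, i ≠ 2 → i ≠ 3 → SameCycle f1 (y i) (y 2) →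
      (SameCycle f1 (y 0) (y 3) ∨ SameCycle f1 (y 1) (y 3)) → ∃ j : Fin 4, j ≠ 3 ∧
      numCycles (f1 * swap (y i) (y 2) * swap (y j) (y 3)) = numCycles f + 3 := by
    intro i hi hi3 h2 h3
    have hne : y i ≠ y 2 := fun h => hi (hy h)
    have n2 := numCycles_mul_swap h2 hne
    have : ∃ j : Fin 4, j ≠ 3 ∧ SameCycle (f1 * swap (y i) (y 2)) (y j) (y 3) := by
      have hw : ∀ k : Fin 4, k ≠ 3 → SameCycle f1 (y k) (y 3) → ∃ j : Fin 4, j ≠ 3 ∧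
          SameCycle (f1 * swap (y i) (y 2)) (y j) (y 3) := by
        intro k hk hk3
        have hk3' : SameCycle.setoid f1 (y k) (y 3) := hk3
        rw [setoid_eq_glue_mul_swap h2] at hk3'
        rcases hk3' with h | ⟨-, h⟩ | ⟨-, h⟩
        · exact ⟨k, hk, h⟩
        · exact ⟨2, by decide, h⟩
        · exact ⟨i, hi3, h⟩
      rcases h3 with h3 | h3
      · exact hw 0 (by decide) h3
      · exact hw 1 (by decide) h3
    obtain ⟨j, hj, hj3⟩ := this
    refine ⟨j, hj, ?_⟩
    rw [numCycles_mul_swap hj3 (fun h => hj (hy h)), n2, n1]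
  have hmain : ∃ i : Fin 4, (i = 0 ∨ i = 1) ∧ ∃ j : Fin 4, j ≠ 3 ∧
      numCycles (f1 * swap (y i) (y 2) * swap (y j) (y 3)) = numCycles f + 3 := by
    rcases c2 with h | h
    · exact ⟨0, Or.inl rfl, step 0 (by decide) (by decide) h c3⟩
    · exact ⟨1, Or.inr rfl, step 1 (by decide) (by decide) h c3⟩
  obtain ⟨i, hi, j, hj, hn⟩ := hmain
  -- a product of transpositions along a tree on the four elements is a four-cycle
  have hfin : ∀ i j : Fin 4, (i = 0 ∨ i = 1) → j ≠ 3 → ∃ e : Perm (Fin 4),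
      swap 0 1 * swap i 2 * swap j 3 = fourCycle (e 0) (e 1) (e 2) (e 3) := by
    unfold fourCycle; decide
  obtain ⟨e, he⟩ := hfin i j hi hj
  refine ⟨e, ?_⟩
  have hsw : ∀ a b c : Fin 4, swap (y a) (y b) (y c) = y (swap a b c) := fun a b c =>
    hy.swap_apply a b c
  have : swap (y 0) (y 1) * swap (y i) (y 2) * swap (y j) (y 3) =
      fourCycle (y (e 0)) (y (e 1)) (y (e 2)) (y (e 3)) := by
    ext u
    by_cases hu : ∃ k, y k = u
    · obtain ⟨k, rfl⟩ := hu
      have := congrArg (fun g : Perm (Fin 4) => y (g k)) he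
      simpa only [fourCycle, Perm.mul_apply, hsw] using this
    · push Not at hu
      have hfix : ∀ a b, swap (y a) (y b) u = u := fun a b =>
        swap_apply_of_ne_of_ne (hu a).symm (hu b).symm
      simp only [fourCycle, Perm.mul_apply, hfix]
  rw [← this, ← hn, hf1]
  simp only [mul_assoc]

end Equiv.Perm

namespace SimpleGraph

open Equiv.Perm

variable {V : Type*}

namespace PlanarDrawing

variable [Finite V] {G : SimpleGraph V}

/-- A face contains no four pairwise adjacent vertices: otherwise a new vertex in this face would
lie on two triangles that cross each other there and have no other common vertex. The new vertex is
represented by a four-cycle of darts. -/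
theorem not_four_on_face (M : G.PlanarDrawing) (hG : G.Connected) (hV : 2 ≤ Nat.card V)
    (y : Fin 4 → G.Dart) (hy : Function.Injective fun i => (y i).fst)
    (hadj : ∀ i j, i ≠ j → G.Adj (y i).fst (y j).fst)
    (hs : ∀ i j, M.facePerm.SameCycle (y i) (y j)) : False := by
  classical
  obtain ⟨e, he⟩ := exists_fourCycle_split M.facePerm y
    (fun i j h => hy (congrArg (fun d : G.Dart => d.fst) h)) hs
  set p := y (e 0) with hp
  set q := y (e 1) with hq
  set r := y (e 2) with hr
  set s := y (e 3) with hs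
  have hne : ∀ i j, i ≠ j → (y (e i)).fst ≠ (y (e j)).fst :=
    fun i j hij h => hij (e.injective (hy h))
  have hpq : p.fst ≠ q.fst := hne 0 1 (by decide)
  have hps : p.fst ≠ s.fst := hne 0 3 (by decide)
  have hpr : p.fst ≠ r.fst := hne 0 2 (by decide)
  have hqr : q.fst ≠ r.fst := hne 1 2 (by decide)
  have hqs : q.fst ≠ s.fst := hne 1 3 (by decide)
  have hrs : r.fst ≠ s.fst := hne 2 3 (by decide)
  let a : G.Dart := ⟨(p.fst, r.fst), hadj _ _ (fun h => by simpa using e.injective h)⟩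
  let b : G.Dart := ⟨(q.fst, s.fst), hadj _ _ (fun h => by simpa using e.injective h)⟩
  -- `X` merges the vertices of `p` and `r`, and those of `q` and `s`, along edges
  set X1 := M.rot * Equiv.swap a a.symm with hX1
  set X := X1 * Equiv.swap b b.symm with hX
  have hrot : ∀ d d' : G.Dart, SameCycle.setoid M.rot d d' ↔ d.fst = d'.fst :=
    M.sameCycle_rot_iff
  have n0 : numCycles M.rot = Nat.card V := M.numCycles_rot (hG.exists_adj hV)
  have na : ¬ M.rot.SameCycle a a.symm := fun h => hpr ((hrot a a.symm).1 h)
  have sX1 := setoid_mul_swap_of_not na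
  have n1 := numCycles_mul_swap_of_not na
  rw [← hX1] at sX1 n1
  have rX1 : ∀ d d', X1.SameCycle d d' ↔ d.fst = d'.fst ∨ (d.fst = p.fst ∧ r.fst = d'.fst) ∨
      (d.fst = r.fst ∧ p.fst = d'.fst) := by
    intro d d'
    have : X1.SameCycle d d' ↔ SameCycle.setoid X1 d d' := Iff.rfl
    rw [this, sX1]
    exact or_congr (hrot _ _) (or_congr (and_congr (hrot _ _) (hrot _ _))
      (and_congr (hrot _ _) (hrot _ _)))
  have nb : ¬ X1.SameCycle b b.symm := by
    rw [rX1]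
    rintro (h | ⟨h, -⟩ | ⟨h, -⟩)
    · exact hqs h
    · exact hpq h.symm
    · exact hqr h
  have sX := setoid_mul_swap_of_not nb
  have n2 := numCycles_mul_swap_of_not nb
  rw [← hX] at sX n2
  have rX : ∀ d d', X.SameCycle d d' ↔ X1.SameCycle d d' ∨
      (X1.SameCycle d b ∧ X1.SameCycle b.symm d') ∨
      (X1.SameCycle d b.symm ∧ X1.SameCycle b d') := by
    intro d d'
    have : X.SameCycle d d' ↔ SameCycle.setoid X d d' := Iff.rfl
    rw [this, sX]
    rfl
  have hXpr : X.SameCycle p r := (rX _ _).2 (Or.inl ((rX1 _ _).2 (Or.inr (Or.inl ⟨rfl, rfl⟩))))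
  have hXqs : X.SameCycle q s := (rX _ _).2 (Or.inr (Or.inl ⟨(rX1 _ _).2 (Or.inl rfl),
    (rX1 _ _).2 (Or.inl rfl)⟩))
  have hbf : b.fst = q.fst := rfl
  have hbs : b.symm.fst = s.fst := rfl
  have hXpq : ¬ X.SameCycle p q := by
    rw [rX]; simp only [rX1, hbf, hbs]
    simp [hpq, hps, hpr, hqr.symm, hrs, hpq.symm]
  have hXrs : ¬ X.SameCycle r s := fun h => hXpq (hXpr.trans (h.trans hXqs.symm))
  have hXrq : ¬ X.SameCycle r q := fun h => hXrs (h.trans hXqs)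
  have hpr' : p ≠ r := fun h => hpr (by rw [h])
  have n3 := numCycles_mul_swap hXpr hpr'
  have hYpr := not_sameCycle_mul_swap hXpr hpr'
  have hY : ∀ d d', (X * Equiv.swap p r).SameCycle d d' → X.SameCycle d d' :=
    fun d d' h => sameCycle_of_mul_swap hXpr h
  set Y := X * Equiv.swap p r
  have hYpq : ¬ Y.SameCycle p q := fun h => hXpq (hY _ _ h)
  have n4 := numCycles_mul_swap_of_not hYpq
  have hZrs : ¬ (Y * Equiv.swap p q).SameCycle r s := by
    intro h
    have h' : SameCycle.setoid (Y * Equiv.swap p q) r s := h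
    rw [setoid_mul_swap_of_not hYpq] at h'
    rcases h' with h | ⟨h, -⟩ | ⟨h, -⟩
    · exact hXrs (hY _ _ h)
    · exact hYpr (SameCycle.symm h)
    · exact hXrq (hY _ _ h)
  have n5 := numCycles_mul_swap_of_not hZrs
  set κ := fourCycle p q r s with hκ
  have n6 : numCycles (κ * X) = numCycles (Y * Equiv.swap p q * Equiv.swap r s) := by
    rw [numCycles_mul_comm]
    simp only [Y, κ, fourCycle, mul_assoc]
  -- the components after these edges and the new vertex have been added
  set s0 := glue (SameCycle.setoid X) p q with hs0
  have ns0 : Nat.card (Quotient s0) + 1 = numCycles X :=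
    card_glue_of_not (s := SameCycle.setoid X) hXpq
  have hXs0 : SameCycle.setoid X ≤ s0 := le_glue _ _ _
  have s0pq : s0 p q := glue_rel _ _ _
  have s0pr : s0 p r := hXs0 hXpr
  have s0rs : s0 r s := s0.trans (s0.symm s0pr) (s0.trans s0pq (hXs0 hXqs))
  have hκX : SameCycle.setoid (κ * X) ≤ s0 := by
    apply setoid_le
    intro u
    refine s0.trans (hXs0 (y := X u) (sameCycle_apply_right.2 SameCycle.rfl)) ?_
    exact s0.trans (rel_swap s0rs _) (s0.trans (rel_swap s0pq _) (rel_swap s0pr _))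
  -- the remaining edges
  obtain ⟨inv1, card1⟩ := involutive_swap_mul (β := G.dartSymm) (fun u => u.symm_symm)
    (x := a) a.symm_ne
  rw [setOf_dartSymm_ne_ncard] at card1
  set β1 := Equiv.swap a (G.dartSymm a) * G.dartSymm with hβ1
  have hβ1b : β1 b = b.symm := by
    rw [hβ1, Equiv.Perm.mul_apply, Equiv.swap_apply_of_ne_of_ne]
    · rfl
    · intro h
      have h' : b.symm.fst = a.fst := congrArg (fun d : G.Dart => d.fst) h
      exact hps h'.symm
    · intro h
      have h' : b = a := G.dartSymm.injective h
      exact hpq (congrArg (fun d : G.Dart => d.fst) h').symm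
  obtain ⟨inv2, card2⟩ := involutive_swap_mul inv1 (x := b) (by rw [hβ1b]; exact b.symm_ne)
  rw [hβ1b] at inv2 card2
  set β := Equiv.swap b b.symm * β1 with hβ
  have hαβ : G.dartSymm = Equiv.swap a a.symm * Equiv.swap b b.symm * β := by
    rw [hβ, hβ1, mul_assoc, Equiv.swap_mul_self_mul]
    exact (Equiv.swap_mul_self_mul a a.symm G.dartSymm).symm
  obtain ⟨t, hst, ht, hle⟩ := exists_setoid_genus_le _ (κ * X) β s0 inv2 rfl hκX
  have hprod : κ * X * β = κ * M.facePerm := by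
    rw [hX, hX1, M.facePerm_eq, hαβ]
    simp only [mul_assoc]
  rw [hprod, numCycles_mul_comm, he] at hle
  have hE := hG.card_add_card_face hV M
  have hXt : SameCycle.setoid X ≤ t := hXs0.trans hst
  have hX1X : SameCycle.setoid X1 ≤ SameCycle.setoid X := by rw [sX]; exact le_glue _ _ _
  have hrX1 : SameCycle.setoid M.rot ≤ SameCycle.setoid X1 := by rw [sX1]; exact le_glue _ _ _
  have ha : t a a.symm := hXt (hX1X (by rw [sX1]; exact glue_rel _ _ _))
  have hb : t b b.symm := hXt (by rw [sX]; exact glue_rel _ _ _)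
  have hsymm : ∀ d : G.Dart, t d d.symm := by
    intro d
    have : G.dartSymm d = Equiv.swap a a.symm (Equiv.swap b b.symm (β d)) := by
      conv_lhs => rw [hαβ]
      rfl
    rw [← G.dartSymm_apply, this]
    exact t.trans (ht d) (t.trans (rel_swap hb _) (rel_swap ha _))
  have := M.card_quotient_le_one hG (hrX1.trans (hX1X.trans hXt)) hsymm
  omega

end PlanarDrawing

end SimpleGraph

/-! ### Maximal planar graphs are triangulations -/

namespace SimpleGraph

open Equiv.Perm

variable {V : Type*}

namespace RotationSystem

variable {G : SimpleGraph V}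

theorem facePerm_eq_symm (M : G.RotationSystem) {d : G.Dart}
    (h : M.facePerm (M.facePerm d) = d) : M.facePerm d = d.symm := by
  apply Dart.ext
  apply Prod.ext
  · exact M.facePerm_fst d
  · have := M.facePerm_fst (M.facePerm d)
    rw [h] at this
    exact this.symm

/-- A dart on a face of length two is the only one at its origin. -/
theorem eq_of_facePerm_facePerm (M : G.RotationSystem) {d e : G.Dart}
    (h : M.facePerm (M.facePerm d) = d) (he : e.fst = d.fst) : e = d := by
  have h1 := M.facePerm_eq_symm h
  have h2 : M.rot d = d := by
    conv_rhs => rw [← h, h1, M.facePerm_apply, Dart.symm_symm]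
  exact (M.sameCycle_of_fst_eq e d he).eq_of_right h2

theorem facePerm_facePerm_symm (M : G.RotationSystem) {d : G.Dart}
    (h : M.facePerm (M.facePerm d) = d) : M.facePerm (M.facePerm d.symm) = d.symm := by
  have h1 := M.facePerm_eq_symm h
  rw [← h1, h]

/-- A face of length two is a component with a single edge. -/
theorem eq_or_eq_of_facePerm_facePerm (M : G.RotationSystem) {d : G.Dart}
    (h : M.facePerm (M.facePerm d) = d) {w : V} (hw : G.Reachable w d.fst) :
    w = d.fst ∨ w = d.snd := by
  obtain ⟨p⟩ := hw
  suffices H : ∀ a b : V, ∀ _ : G.Walk a b, b = d.fst → a = d.fst ∨ a = d.snd from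
    H _ _ p rfl
  intro a b p
  induction p with
  | nil => exact fun h => Or.inl h
  | @cons a b c hab _ ih =>
    intro hc
    rcases ih hc with rfl | rfl
    · right
      exact congrArg (fun e : G.Dart => e.snd)
        (M.eq_of_facePerm_facePerm h (e := ⟨(d.fst, a), hab.symm⟩) rfl)
    · left
      exact congrArg (fun e : G.Dart => e.snd)
        (M.eq_of_facePerm_facePerm (M.facePerm_facePerm_symm h)
          (e := ⟨(d.snd, a), hab.symm⟩) rfl)

theorem facePerm_facePerm_ne [Finite V] (M : G.RotationSystem) (hG : G.Connected)
    (hV : 3 ≤ Nat.card V) (d : G.Dart) : M.facePerm (M.facePerm d) ≠ d := by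
  intro h
  have : (Set.univ : Set V) ⊆ {d.fst, d.snd} := fun w _ =>
    M.eq_or_eq_of_facePerm_facePerm h (hG.preconnected w d.fst)
  have h1 := Set.ncard_le_ncard this
  rw [Set.ncard_univ] at h1
  have := Set.ncard_insert_le d.fst {d.snd}
  rw [Set.ncard_singleton] at this
  omega

end RotationSystem

variable [Finite V] {G : SimpleGraph V}

/-- All faces of a drawing of a triangulation are triangles: by Euler's formula their average
length is three, and none is shorter. -/
theorem IsTriangulation.facePerm_facePerm_facePerm (hG : G.IsTriangulation) (M : G.PlanarDrawing)
    (d : G.Dart) : M.facePerm (M.facePerm (M.facePerm d)) = d := by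
  classical
  have h1 := hG.connected.card_add_card_face (by have := hG.three_le; omega) M
  have h2 := hG.card_edgeSet
  have h3 := twelve_mul_numCycles_le M.facePerm M.facePerm_ne
  have h4 : {u | M.facePerm (M.facePerm u) = u} = ∅ :=
    Set.eq_empty_of_forall_notMem fun u hu =>
      M.facePerm_facePerm_ne hG.connected hG.three_le u hu
  rw [h4, Set.ncard_empty, ← two_mul_card_edgeSet] at h3
  have h5 : {u | M.facePerm (M.facePerm (M.facePerm u)) = u} = Set.univ := by
    apply Set.eq_of_subset_of_ncard_le (Set.subset_univ _)
    rw [Set.ncard_univ, ← two_mul_card_edgeSet]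
    omega
  have : d ∈ {u | M.facePerm (M.facePerm (M.facePerm u)) = u} := h5 ▸ Set.mem_univ d
  exact this

theorem IsTriangulation.card_face (hG : G.IsTriangulation) (M : G.PlanarDrawing) :
    Nat.card M.Face + 4 = 2 * Nat.card V := by
  have h1 := hG.connected.card_add_card_face (by have := hG.three_le; omega) M
  have h2 := hG.card_edgeSet
  rw [RotationSystem.card_face]
  omega

theorem IsMaximalPlanar.connected [Nonempty V] (hG : G.IsMaximalPlanar) : G.Connected := by
  refine ⟨fun u v => ?_⟩
  by_contra h
  have h1 := hG.2 (IsPlanar.sup_edge_of_not_reachable hG.1 h) le_sup_left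
  have huv : u ≠ v := by rintro rfl; exact h (Reachable.refl u)
  exact h (Adj.reachable (h1 (Or.inr (by rw [edge_adj]; exact ⟨Or.inl ⟨rfl, rfl⟩, huv⟩))))

theorem IsMaximalPlanar.adj_of_sameCycle (hG : G.IsMaximalPlanar) (M : G.PlanarDrawing)
    {x y : G.Dart} (hxy : M.facePerm.SameCycle x y) (hne : x.fst ≠ y.fst) :
    G.Adj x.fst y.fst := by
  by_contra h
  have h1 := hG.2 (M.isPlanar_sup_edge hne h x y rfl rfl hxy) le_sup_left
  exact h (h1 (Or.inr (by rw [edge_adj]; exact ⟨Or.inl ⟨rfl, rfl⟩, hne⟩)))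

/-- By maximality, the vertices of a face are pairwise adjacent. So a face has at most three
vertices, and its boundary walk repeats no edge in the opposite direction; this leaves only
triangles. -/
theorem IsMaximalPlanar.isTriangulation (hG : G.IsMaximalPlanar) (hV : 3 ≤ Nat.card V) :
    G.IsTriangulation := by
  have : Nonempty V := (Nat.card_pos_iff.1 (by omega : 0 < Nat.card V)).1
  have hc := hG.connected
  obtain ⟨⟨M⟩, -⟩ := id hG
  have hV2 : 2 ≤ Nat.card V := by omega
  have hφ : ∀ d, M.facePerm.SameCycle d (M.facePerm d) :=
    fun d => sameCycle_apply_right.2 SameCycle.rfl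
  -- no face has the same edge on both sides, if it has three pairwise different vertices
  have hbr : ∀ d e : G.Dart, M.facePerm.SameCycle d d.symm → M.facePerm.SameCycle d e →
      e.fst ≠ d.fst → e.fst ≠ d.snd → False := by
    intro d e h1 h2 h3 h4
    refine M.not_sameCycle_symm hc hV2 d (hG.adj_of_sameCycle M h2 h3.symm) ?_ h1
    exact hG.adj_of_sameCycle M (x := d.symm) (h1.symm.trans h2) h4.symm
  have htri : ∀ d, M.facePerm (M.facePerm (M.facePerm d)) = d := by
    intro d0
    set d1 := M.facePerm d0 with h1
    set d2 := M.facePerm d1 with h2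
    set d3 := M.facePerm d2 with h3
    have s1 : M.facePerm.SameCycle d0 d1 := hφ d0
    have s2 : M.facePerm.SameCycle d0 d2 := s1.trans (hφ d1)
    have s3 : M.facePerm.SameCycle d0 d3 := s2.trans (hφ d2)
    have f1 : d1.fst = d0.snd := M.facePerm_fst d0
    have f2 : d2.fst = d1.snd := M.facePerm_fst d1
    have f3 : d3.fst = d2.snd := M.facePerm_fst d2
    have hsymm : ∀ d d' : G.Dart, d'.fst = d.snd → d'.snd = d.fst → d' = d.symm :=
      fun d d' h h' => Dart.ext _ _ (Prod.ext h h')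
    have n1 : d1.snd ≠ d0.fst := by
      intro h
      have hd1 := hsymm d0 d1 f1 h
      have hd2 : d2.snd ≠ d0.snd := by
        intro h'
        exact M.facePerm_facePerm_ne hc hV d0 (Dart.ext _ _ (Prod.ext (f2.trans h) h'))
      refine hbr d0 d3 (hd1 ▸ s1) s3 ?_ (f3 ▸ hd2)
      rw [f3, ← h, ← f2]; exact d2.snd_ne_fst
    have n2 : d1.snd ≠ d0.snd := by rw [← f1]; exact d1.snd_ne_fst
    have n3 : d2.snd ≠ d0.snd := by
      intro h
      have hd2 := hsymm d1 d2 f2 (h.trans f1.symm)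
      refine hbr d1 d0 (hd2 ▸ hφ d1) s1.symm ?_ n1.symm
      rw [f1]; exact d0.fst_ne_snd
    have n4 : d2.snd ≠ d1.snd := by rw [← f2]; exact d2.snd_ne_fst
    have e0 : d2.snd = d0.fst := by
      by_contra hne
      have hs : ∀ i : Fin 4, M.facePerm.SameCycle d0 (![d0, d1, d2, d3] i) := by
        intro i; fin_cases i
        · exact SameCycle.rfl
        · exact s1
        · exact s2
        · exact s3
      have hinj : Function.Injective fun i : Fin 4 => (![d0, d1, d2, d3] i).fst := by
        have g0 : d0.fst ≠ d0.snd := d0.fst_ne_snd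
        intro i j hij
        fin_cases i <;> fin_cases j <;> simp [f1, f2, f3] at hij <;> first
          | rfl
          | exact absurd hij g0
          | exact absurd hij g0.symm
          | exact absurd hij n1
          | exact absurd hij.symm n1
          | exact absurd hij n2
          | exact absurd hij.symm n2
          | exact absurd hij n3
          | exact absurd hij.symm n3
          | exact absurd hij n4
          | exact absurd hij.symm n4
          | exact absurd hij hne
          | exact absurd hij.symm hne
      exact M.not_four_on_face hc hV2 ![d0, d1, d2, d3] hinj
        (fun i j hij => hG.adj_of_sameCycle M ((hs i).symm.trans (hs j))
          fun h => hij (hinj h)) (fun i j => (hs i).symm.trans (hs j))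
    have e3 : d3.fst = d0.fst := f3.trans e0
    have n5 : d3.snd ≠ d1.snd := by
      intro h
      have hd3 := hsymm d2 d3 f3 (h.trans f2.symm)
      refine hbr d2 d1 (hd3 ▸ hφ d2) (s2.symm.trans s1) ?_ ?_
      · rw [f1, f2]; exact n2.symm
      · rw [f1]; exact n3.symm
    -- the third dart back to the first vertex leads on to the second vertex
    apply Dart.ext
    refine Prod.ext e3 ?_
    by_contra hne
    have f4 := M.facePerm_fst d3
    set d4 := M.facePerm d3
    have s4 : M.facePerm.SameCycle d0 d4 := s3.trans (hφ d3)
    have hs : ∀ i : Fin 4, M.facePerm.SameCycle d0 (![d0, d1, d2, d4] i) := by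
      intro i; fin_cases i
      · exact SameCycle.rfl
      · exact s1
      · exact s2
      · exact s4
    have g0 : d0.fst ≠ d0.snd := d0.fst_ne_snd
    have g3 : d3.snd ≠ d0.fst := by rw [← e3]; exact d3.snd_ne_fst
    have hinj : Function.Injective fun i : Fin 4 => (![d0, d1, d2, d4] i).fst := by
      intro i j hij
      fin_cases i <;> fin_cases j <;> simp [f1, f2, f4] at hij <;> first
        | rfl
        | exact absurd hij g0
        | exact absurd hij g0.symm
        | exact absurd hij n1
        | exact absurd hij.symm n1
        | exact absurd hij n2
        | exact absurd hij.symm n2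
        | exact absurd hij g3
        | exact absurd hij.symm g3
        | exact absurd hij n5
        | exact absurd hij.symm n5
        | exact absurd hij hne
        | exact absurd hij.symm hne
    exact M.not_four_on_face hc hV2 ![d0, d1, d2, d4] hinj
      (fun i j hij => hG.adj_of_sameCycle M ((hs i).symm.trans (hs j))
        fun h => hij (hinj h)) (fun i j => (hs i).symm.trans (hs j))
  refine ⟨hc, hV, ?_⟩
  have h1 := hc.card_add_card_face hV2 M
  have h2 := three_mul_numCycles M.facePerm_ne htri
  rw [← two_mul_card_edgeSet] at h2
  omega

end SimpleGraph

/-! ### Kleetopes of triangulations -/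

namespace SimpleGraph

open Equiv.Perm

variable {V : Type*} {G : SimpleGraph V}

namespace RotationSystem

/-- The face to the side of a dart. -/
def face (M : G.RotationSystem) (d : G.Dart) : M.Face :=
  Quotient.mk (SameCycle.setoid M.facePerm) d

theorem face_eq_iff (M : G.RotationSystem) {d e : G.Dart} :
    M.face d = M.face e ↔ M.facePerm.SameCycle d e :=
  ⟨fun h => Quotient.exact h, fun h => Quotient.sound h⟩

theorem exists_face (M : G.RotationSystem) (f : M.Face) : ∃ d, M.face d = f :=
  Quotient.exists_rep f

theorem incident_iff (M : G.RotationSystem) (v : V) (f : M.Face) :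
    M.Incident v f ↔ ∃ d : G.Dart, d.fst = v ∧ M.face d = f := Iff.rfl

/-- The three darts of a triangular face. -/
theorem face_eq_iff_of_triangle [Finite V] (M : G.RotationSystem)
    (h : ∀ d, M.facePerm (M.facePerm (M.facePerm d)) = d) {d e : G.Dart} :
    M.face e = M.face d ↔ e = d ∨ e = M.facePerm d ∨ e = M.facePerm (M.facePerm d) := by
  constructor
  · intro he
    have hs : M.facePerm.SameCycle d e := (M.face_eq_iff.1 he).symm
    obtain ⟨n, rfl⟩ := hs.exists_nat_pow_eq
    clear he hs
    induction n with
    | zero => exact Or.inl rfl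
    | succ n ih =>
      rw [pow_succ', Equiv.Perm.mul_apply]
      rcases ih with ih | ih | ih <;> rw [ih]
      · exact Or.inr (Or.inl rfl)
      · exact Or.inr (Or.inr rfl)
      · exact Or.inl (h d)
  · rw [M.face_eq_iff]
    rintro (rfl | rfl | rfl) <;> simp [SameCycle.rfl]

/-- A triangular face has only one corner at each vertex. -/
theorem eq_of_face_eq [Finite V] (M : G.RotationSystem)
    (h : ∀ d, M.facePerm (M.facePerm (M.facePerm d)) = d) {d e : G.Dart}
    (hf : M.face e = M.face d) (hfst : e.fst = d.fst) : e = d := by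
  rcases (M.face_eq_iff_of_triangle h).1 hf with he | he | he
  · exact he
  · rw [he, M.facePerm_fst] at hfst
    exact absurd hfst d.snd_ne_fst
  · have h1 := M.facePerm_fst (M.facePerm (M.facePerm d))
    rw [h, ← he, ← hfst] at h1
    exact absurd h1 e.fst_ne_snd

end RotationSystem

namespace PlanarDrawing

variable [Finite V]

/-- The darts of a Kleetope: the darts of the graph, and two darts for every corner of a
face, where a corner is given by the dart after it on the boundary of the face. -/
noncomputable def dartKleetope (M : G.PlanarDrawing)
    (h : ∀ d, M.facePerm (M.facePerm (M.facePerm d)) = d) :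
    G.Dart ⊕ (G.Dart ⊕ G.Dart) ≃ M.kleetope.Dart :=
  Equiv.ofBijective
    (Sum.elim (fun d => ⟨(.inl d.fst, .inl d.snd), d.adj⟩)
      (Sum.elim (fun d => ⟨(.inl d.fst, .inr (M.face d)), ⟨d, rfl, rfl⟩⟩)
        (fun d => ⟨(.inr (M.face d), .inl d.fst), ⟨d, rfl, rfl⟩⟩))) <| by
    constructor
    · rintro (d | d | d) (e | e | e) hde <;> have hde := congrArg Dart.toProd hde <;>
        simp only [Sum.elim_inl, Sum.elim_inr, Prod.mk.injEq, Sum.inl.injEq, Sum.inr.injEq,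
          reduceCtorEq, and_false, false_and] at hde
      · rw [Dart.ext d e (Prod.ext hde.1 hde.2)]
      · rw [M.eq_of_face_eq h hde.2 hde.1]
      · rw [M.eq_of_face_eq h hde.1 hde.2]
    · rintro ⟨⟨a | a, b | b⟩, hab⟩
      · exact ⟨.inl ⟨(a, b), hab⟩, rfl⟩
      · obtain ⟨d, rfl, rfl⟩ := hab
        exact ⟨.inr (.inl d), rfl⟩
      · obtain ⟨d, rfl, rfl⟩ := hab
        exact ⟨.inr (.inr d), rfl⟩
      · exact hab.elim

theorem card_edgeSet_kleetope (M : G.PlanarDrawing)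
    (h : ∀ d, M.facePerm (M.facePerm (M.facePerm d)) = d) :
    Nat.card M.kleetope.edgeSet = 3 * Nat.card G.edgeSet := by
  have h1 := two_mul_card_edgeSet M.kleetope
  have h2 := two_mul_card_edgeSet G
  rw [← Nat.card_congr (M.dartKleetope h), Nat.card_sum, Nat.card_sum] at h1
  omega

theorem kleetope_connected (M : G.PlanarDrawing) (hG : G.Connected) : M.kleetope.Connected := by
  have h1 : ∀ u v : V, M.kleetope.Reachable (.inl u) (.inl v) := by
    intro u v
    let φ : G →g M.kleetope := ⟨Sum.inl, fun h => h⟩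
    exact (hG.preconnected u v).map φ
  have : Nonempty V := hG.nonempty
  have h2 : ∀ w, ∃ u, M.kleetope.Reachable (.inl u) w := by
    rintro (u | f)
    · exact ⟨u, Reachable.refl _⟩
    · obtain ⟨d, hd⟩ := M.exists_face f
      have : M.kleetope.Adj (.inl d.fst) (.inr f) := ⟨d, rfl, hd⟩
      exact ⟨d.fst, this.reachable⟩
  have : Nonempty (V ⊕ M.Face) := ⟨.inl (Classical.arbitrary V)⟩
  refine ⟨fun a b => ?_⟩
  obtain ⟨u, hu⟩ := h2 a
  obtain ⟨v, hv⟩ := h2 b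
  exact hu.symm.trans ((h1 u v).trans hv)

theorem kleetope_isTriangulation (M : G.PlanarDrawing) (hG : G.IsTriangulation) :
    M.kleetope.IsTriangulation := by
  have h1 := hG.card_face M
  have h2 := hG.card_edgeSet
  have h3 := hG.three_le
  refine ⟨M.kleetope_connected hG.connected, ?_, ?_⟩
  · rw [Nat.card_sum]; omega
  · rw [M.card_edgeSet_kleetope (hG.facePerm_facePerm_facePerm M), Nat.card_sum]; omega

/-- The rotation of the Kleetope. At an old vertex, the spokes into the corners and the old darts
alternate; at a new vertex, the spokes follow the boundary of the face backwards. -/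
noncomputable def kleetopeRot (M : G.PlanarDrawing) :
    Equiv.Perm (G.Dart ⊕ (G.Dart ⊕ G.Dart)) where
  toFun := Sum.elim (fun d => .inr (.inl (M.rot d)))
    (Sum.elim (fun d => .inl d) (fun d => .inr (.inr (M.facePerm.symm d))))
  invFun := Sum.elim (fun d => .inr (.inl d))
    (Sum.elim (fun d => .inl (M.rot.symm d)) (fun d => .inr (.inr (M.facePerm d))))
  left_inv := by rintro (d | d | d) <;> simp
  right_inv := by rintro (d | d | d) <;> simp

/-- The reversal of the darts of the Kleetope. -/
noncomputable def kleetopeSymm (G : SimpleGraph V) :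
    Equiv.Perm (G.Dart ⊕ (G.Dart ⊕ G.Dart)) :=
  Equiv.sumCongr G.dartSymm (Equiv.sumComm _ _)

theorem kleetope_isPlanar (M : G.PlanarDrawing) (hG : G.IsTriangulation) :
    M.kleetope.IsPlanar := by
  have htri := hG.facePerm_facePerm_facePerm M
  have hK := M.kleetope_isTriangulation hG
  set σ := M.kleetopeRot with hσ
  set α := kleetopeSymm G with hα
  have f1 : ∀ d, (σ * α) (.inl d) = .inr (.inl (M.facePerm d)) := fun d => rfl
  have f2 : ∀ d, (σ * α) (.inr (.inl d)) = .inr (.inr (M.facePerm.symm d)) := fun d => rfl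
  have f3 : ∀ d, (σ * α) (.inr (.inr d)) = .inl d := fun d => rfl
  have hv : ∀ d d' : G.Dart, d.fst = d'.fst → σ.SameCycle (.inl d) (.inl d') := by
    intro d d' h
    refine setoid_le (f := M.rot) (s := (SameCycle.setoid σ).comap Sum.inl) (fun u => ?_)
      (M.sameCycle_of_fst_eq d d' h)
    have : σ (σ (.inl u)) = .inl (M.rot u) := rfl
    show σ.SameCycle (.inl u) (.inl (M.rot u))
    rw [← this, sameCycle_apply_right, sameCycle_apply_right]
  have hf : ∀ d d' : G.Dart, M.face d = M.face d' →
      σ.SameCycle (.inr (.inr d)) (.inr (.inr d')) := by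
    intro d d' h
    refine setoid_le (f := M.facePerm)
      (s := (SameCycle.setoid σ).comap fun d => Sum.inr (Sum.inr d)) (fun u => ?_)
      (M.face_eq_iff.1 h)
    have : σ (.inr (.inr (M.facePerm u))) = .inr (.inr u) := by simp [hσ, kleetopeRot]
    show σ.SameCycle (.inr (.inr u)) (.inr (.inr (M.facePerm u)))
    rw [← this, sameCycle_apply_left]
  have hc : ∀ d : G.Dart, σ.SameCycle (.inr (.inl d)) (.inl d) := by
    intro d
    have : σ (.inr (.inl d)) = .inl d := rfl
    rw [← this, sameCycle_apply_right]
  refine isPlanar_of_model (M.dartKleetope htri) σ α ?_ ?_ ?_ ?_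
  · rintro (d | d | d) <;> rfl
  · rintro (d | d | d)
    · exact congrArg Sum.inl (M.rot_fst d)
    · rfl
    · refine congrArg Sum.inr (M.face_eq_iff.2 ?_)
      exact sameCycle_symm_apply_left.2 SameCycle.rfl
  · rintro (d | d | d) (e | e | e) h
    · exact hv d e (Sum.inl_injective h)
    · exact (hv d e (Sum.inl_injective h)).trans (hc e).symm
    · cases h
    · exact (hc d).trans (hv d e (Sum.inl_injective h))
    · exact (hc d).trans ((hv d e (Sum.inl_injective h)).trans (hc e).symm)
    · cases h
    · cases h
    · cases h
    · exact hf d e (Sum.inr_injective h)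
  · have h3 : 3 * numCycles (σ * α) = Nat.card (G.Dart ⊕ (G.Dart ⊕ G.Dart)) := by
      refine three_mul_numCycles ?_ ?_
      · rintro (d | d | d) h
        · rw [f1] at h; cases h
        · rw [f2] at h; cases h
        · rw [f3] at h; cases h
      · rintro (d | d | d) <;> simp [f1, f2, f3]
    rw [Nat.card_sum, Nat.card_sum, ← two_mul_card_edgeSet] at h3
    have hK2 : 2 ≤ Nat.card (V ⊕ M.Face) := by have := hK.three_le; omega
    have h4 : Nat.card {v // M.kleetope.IsIsolated v} = 0 := by
      have : IsEmpty {v // M.kleetope.IsIsolated v} := ⟨fun v => by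
        obtain ⟨w, hw⟩ := hK.connected.exists_adj hK2 v.1
        exact v.2 w hw⟩
      exact Nat.card_of_isEmpty
    have h5 : Nat.card M.kleetope.ConnectedComponent = 1 := by
      have := hK.connected.preconnected.subsingleton_connectedComponent
      obtain ⟨v⟩ := hK.connected.nonempty
      exact Nat.card_eq_one_iff_unique.2 ⟨inferInstance, ⟨M.kleetope.connectedComponentMk v⟩⟩
    have h6 := hG.card_edgeSet
    have h7 := hG.card_face M
    rw [M.card_edgeSet_kleetope htri, h4, h5, Nat.card_sum]
    omega

/-- The vertices of a face of a triangulation. -/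
theorem exists_vertices_of_face (M : G.PlanarDrawing) (hG : G.IsTriangulation) (f : M.Face) :
    ∃ x : Fin 3 → V, (∀ i j, i ≠ j → G.Adj (x i) (x j)) ∧
      ∀ v, M.Incident v f ↔ ∃ i, v = x i := by
  have htri := hG.facePerm_facePerm_facePerm M
  obtain ⟨d, rfl⟩ := M.exists_face f
  have h1 := M.facePerm_fst d
  have h2 := M.facePerm_fst (M.facePerm d)
  have h3 := M.facePerm_fst (M.facePerm (M.facePerm d))
  rw [htri] at h3
  have a1 := d.adj
  have a2 := (M.facePerm d).adj
  have a3 := (M.facePerm (M.facePerm d)).adj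
  rw [← h1] at a1
  rw [← h2] at a2
  rw [← h3] at a3
  refine ⟨![d.fst, (M.facePerm d).fst, (M.facePerm (M.facePerm d)).fst], ?_, ?_⟩
  · intro i j hij
    fin_cases i <;> fin_cases j <;> simp at hij ⊢ <;>
      first | exact a1 | exact a1.symm | exact a2 | exact a2.symm | exact a3 | exact a3.symm
  · intro v
    rw [M.incident_iff]
    constructor
    · rintro ⟨e, rfl, he⟩
      rcases (M.face_eq_iff_of_triangle htri).1 he with rfl | rfl | rfl
      · exact ⟨0, rfl⟩
      · exact ⟨1, rfl⟩
      · exact ⟨2, rfl⟩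
    · rintro ⟨i, rfl⟩
      fin_cases i
      · exact ⟨d, rfl, rfl⟩
      · exact ⟨M.facePerm d, rfl, (M.face_eq_iff_of_triangle htri).2 (Or.inr (Or.inl rfl))⟩
      · exact ⟨_, rfl, (M.face_eq_iff_of_triangle htri).2 (Or.inr (Or.inr rfl))⟩

/-- The surroundings, in any drawing of the Kleetope, of the vertex added in a face. -/
theorem exists_faces_kleetope (M : G.PlanarDrawing) (hG : G.IsTriangulation)
    (M' : M.kleetope.PlanarDrawing) (s : M.Face) :
    ∃ (x : Fin 3 → V) (t : Fin 3 → M'.Face), (∀ i j, i ≠ j → G.Adj (x i) (x j)) ∧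
      (∀ v, M.Incident v s ↔ ∃ i, v = x i) ∧ Function.Injective t ∧
      (∀ f, M'.Incident (.inr s) f ↔ ∃ i, f = t i) ∧
      ∀ i w, M'.Incident w (t i) ↔ w = .inr s ∨ w = .inl (x (i + 1)) ∨ w = .inl (x (i + 2)) := by
  obtain ⟨x, hx, hxs⟩ := M.exists_vertices_of_face hG s
  have htri := (M.kleetope_isTriangulation hG).facePerm_facePerm_facePerm M'
  have hadj : ∀ i, M.kleetope.Adj (.inr s) (.inl (x i)) := fun i => (hxs _).2 ⟨i, rfl⟩
  let e : Fin 3 → M.kleetope.Dart := fun i => ⟨(.inr s, .inl (x i)), hadj i⟩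
  have xinj : Function.Injective x := fun i j h => by
    by_contra hne; exact (hx i j hne).ne h
  have einj : ∀ i j, e i = e j → i = j := fun i j h =>
    xinj (Sum.inl_injective (congrArg (fun d : M.kleetope.Dart => d.snd) h))
  have hdart : ∀ d : M.kleetope.Dart, d.fst = .inr s → ∃ i, d = e i := by
    rintro ⟨⟨a, b⟩, hab⟩ (rfl : a = _)
    rcases b with v | f
    · obtain ⟨i, rfl⟩ := (hxs v).1 hab
      exact ⟨i, rfl⟩
    · exact hab.elim
  -- the next corner of the vertex `s`
  have hnext : ∀ i, ∃ j, j ≠ i ∧ (M'.facePerm (M'.facePerm (e i))).fst = .inl (x j) ∧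
      M'.rot (e j) = e i := by
    intro i
    set d := M'.facePerm (M'.facePerm (e i)) with hd
    have h1 : M'.rot d.symm = e i := by rw [← M'.facePerm_apply, hd, htri]
    have h2 : d.symm.fst = .inr s := by rw [← M'.rot_fst, h1]
    obtain ⟨j, hj⟩ := hdart _ h2
    have h3 : d.fst = .inl (x j) := congrArg (fun d : M.kleetope.Dart => d.snd) hj
    refine ⟨j, ?_, h3, by rw [← hj, h1]⟩
    rintro rfl
    have h4 := M'.facePerm_fst (M'.facePerm (e j))
    rw [← hd, h3] at h4
    have h5 := M'.facePerm_fst (e j)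
    exact (M'.facePerm (e j)).fst_ne_snd (h5.trans h4)
  choose π hπ1 hπ2 hπ3 using hnext
  have πinj : Function.Injective π := by
    intro i j h
    have := hπ3 i
    rw [h, hπ3 j] at this
    exact (einj _ _ this).symm
  have hinc : ∀ i w, M'.Incident w (M'.face (e i)) ↔
      w = .inr s ∨ w = .inl (x i) ∨ w = .inl (x (π i)) := by
    intro i w
    have hf1 : (M'.facePerm (e i)).fst = .inl (x i) := M'.facePerm_fst (e i)
    rw [M'.incident_iff]
    constructor
    · rintro ⟨d, rfl, hd⟩
      rcases (M'.face_eq_iff_of_triangle htri).1 hd with rfl | rfl | rfl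
      · exact Or.inl rfl
      · exact Or.inr (Or.inl hf1)
      · exact Or.inr (Or.inr (hπ2 i))
    · rintro (rfl | rfl | rfl)
      · exact ⟨e i, rfl, rfl⟩
      · exact ⟨_, hf1, (M'.face_eq_iff_of_triangle htri).2 (Or.inr (Or.inl rfl))⟩
      · exact ⟨_, hπ2 i, (M'.face_eq_iff_of_triangle htri).2 (Or.inr (Or.inr rfl))⟩
  have finj : Function.Injective fun i => M'.face (e i) := fun i j h =>
    einj _ _ (M'.eq_of_face_eq htri h rfl)
  have hs : ∀ f, M'.Incident (.inr s) f ↔ ∃ i, f = M'.face (e i) := by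
    intro f
    rw [M'.incident_iff]
    constructor
    · rintro ⟨d, hd, rfl⟩
      obtain ⟨i, rfl⟩ := hdart d hd
      exact ⟨i, rfl⟩
    · rintro ⟨i, rfl⟩
      exact ⟨e i, rfl, rfl⟩
  have hdec : ∀ π : Fin 3 → Fin 3, (∀ i, π i ≠ i) → Function.Injective π →
      (∀ i, π (i + 1) = i + 2) ∨ (∀ i, π (i + 2) = i + 1) := by decide
  rcases hdec π hπ1 πinj with h | h
  · refine ⟨x, fun i => M'.face (e (i + 1)), hx, hxs,
      fun i j hij => add_right_cancel (finj hij), ?_, ?_⟩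
    · intro f
      rw [hs]
      exact ⟨fun ⟨i, hi⟩ => ⟨i - 1, by simpa using hi⟩, fun ⟨i, hi⟩ => ⟨i + 1, hi⟩⟩
    · intro i w
      rw [hinc, h]
  · refine ⟨x, fun i => M'.face (e (i + 2)), hx, hxs,
      fun i j hij => add_right_cancel (finj hij), ?_, ?_⟩
    · intro f
      rw [hs]
      exact ⟨fun ⟨i, hi⟩ => ⟨i - 2, by simpa using hi⟩, fun ⟨i, hi⟩ => ⟨i + 2, hi⟩⟩
    · intro i w
      rw [hinc, h]
      tauto

end PlanarDrawing

end SimpleGraph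

/-! ### Rotations with triangular faces -/

namespace SimpleGraph

open Equiv.Perm

/-- A map without proper invariant subsets on two elements. -/
theorem two_cycle {X : Type*} {N : Set X} {f : X → X} (hmap : ∀ b ∈ N, f b ∈ N)
    (htrans : ∀ S ⊆ N, S.Nonempty → (∀ b ∈ S, f b ∈ S) → S = N)
    (h2 : N.ncard = 2) {b : X} (hb : b ∈ N) :
    N = {b, f b} ∧ f (f b) = b ∧ f b ≠ b := by
  have hN : N.Finite := Set.finite_of_ncard_ne_zero (by omega)
  have h1 : f b ≠ b := by
    intro h
    have := htrans {b} (by simpa using hb) ⟨b, rfl⟩ (by simp [h])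
    rw [← this, Set.ncard_singleton] at h2
    omega
  have hN2 : N = {b, f b} := by
    refine (Set.eq_of_subset_of_ncard_le ?_ ?_ hN).symm
    · rintro c (rfl | rfl)
      · exact hb
      · exact hmap _ hb
    · rw [h2, Set.ncard_pair h1.symm]
  refine ⟨hN2, ?_, h1⟩
  by_contra h
  have : f (f b) ∈ N := hmap _ (hmap _ hb)
  rw [hN2] at this
  rcases this with h' | h'
  · exact h h'
  · have h' : f (f b) = f b := h'
    have := htrans {f b} (by simpa using hmap _ hb) ⟨_, rfl⟩ (by simp [h'])
    rw [← this, Set.ncard_singleton] at h2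
    omega

/-- An injective map without proper invariant subsets on three elements. -/
theorem three_cycle {X : Type*} {N : Set X} {f : X → X} (hmap : ∀ b ∈ N, f b ∈ N)
    (hinj : Set.InjOn f N) (htrans : ∀ S ⊆ N, S.Nonempty → (∀ b ∈ S, f b ∈ S) → S = N)
    (h3 : N.ncard = 3) {b : X} (hb : b ∈ N) :
    N = {b, f b, f (f b)} ∧ f (f (f b)) = b := by
  have hN : N.Finite := Set.finite_of_ncard_ne_zero (by omega)
  have hb1 := hmap _ hb
  have hb2 := hmap _ hb1
  have h1 : f b ≠ b := by
    intro h
    have := htrans {b} (by simpa using hb) ⟨b, rfl⟩ (by simp [h])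
    rw [← this, Set.ncard_singleton] at h3
    omega
  have h2 : f (f b) ≠ f b := fun h => h1 (hinj hb1 hb h)
  have h4 : f (f b) ≠ b := by
    intro h
    have := htrans {b, f b} (by rintro c (rfl | rfl) <;> assumption) ⟨b, Or.inl rfl⟩ (by simp [h])
    rw [← this, Set.ncard_pair h1.symm] at h3
    omega
  have hN3 : N = {b, f b, f (f b)} := by
    refine (Set.eq_of_subset_of_ncard_le ?_ ?_ hN).symm
    · rintro c (rfl | rfl | rfl) <;> assumption
    · rw [h3, Set.ncard_insert_of_notMem, Set.ncard_pair h2.symm]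
      simp [h1.symm, h4.symm]
  refine ⟨hN3, ?_⟩
  have := hmap _ hb2
  rw [hN3] at this
  rcases this with h | h | h
  · exact h
  · exact absurd (hinj hb2 hb h) h4
  · exact absurd (hinj hb2 hb1 h) h2

namespace RotationSystem

variable {X : Type*} {P : SimpleGraph X} (M : P.RotationSystem)

open Classical in
/-- The neighbor that follows `b` in the rotation around `a`; it is `b` itself if `b` is not a
neighbor of `a`. -/
noncomputable def next (a b : X) : X := if h : P.Adj a b then (M.rot ⟨(a, b), h⟩).snd else b

theorem rot_mk {a b : X} (h : P.Adj a b) :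
    ∃ h' : P.Adj a (M.next a b), M.rot ⟨(a, b), h⟩ = ⟨(a, M.next a b), h'⟩ := by
  have h1 := M.rot_fst ⟨(a, b), h⟩
  have h2 : M.next a b = (M.rot ⟨(a, b), h⟩).snd := by rw [next, dif_pos h]
  have h3 : (M.rot ⟨(a, b), h⟩).toProd = (a, M.next a b) := Prod.ext h1 h2.symm
  have h4 := (M.rot ⟨(a, b), h⟩).adj
  rw [h3] at h4
  exact ⟨h4, Dart.ext _ _ h3⟩

theorem adj_next {a b : X} (h : P.Adj a b) : P.Adj a (M.next a b) := (M.rot_mk h).1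

theorem next_injOn (a : X) : Set.InjOn (M.next a) {b | P.Adj a b} := by
  intro b hb c hc h
  obtain ⟨h1, h2⟩ := M.rot_mk hb
  obtain ⟨h3, h4⟩ := M.rot_mk hc
  have : M.rot ⟨(a, b), hb⟩ = M.rot ⟨(a, c), hc⟩ := by
    rw [h2, h4]; exact Dart.ext _ _ (Prod.ext rfl h)
  exact congrArg (fun d : P.Dart => d.snd) (M.rot.injective this)

/-- The rotation around `a` is a single cycle. -/
theorem subset_of_next_closed [Finite X] {a : X} {S : Set X} {b₀ : X} (hb₀ : b₀ ∈ S)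
    (h₀ : P.Adj a b₀) (hS : ∀ b ∈ S, M.next a b ∈ S) {b : X} (hb : P.Adj a b) : b ∈ S := by
  obtain ⟨n, hn⟩ :=
    (M.sameCycle_of_fst_eq ⟨(a, b₀), h₀⟩ ⟨(a, b), hb⟩ rfl).exists_nat_pow_eq
  have key : ∀ n : ℕ, ((M.rot ^ n) ⟨(a, b₀), h₀⟩).fst = a ∧
      ((M.rot ^ n) ⟨(a, b₀), h₀⟩).snd ∈ S := by
    intro n
    induction n with
    | zero => exact ⟨rfl, hb₀⟩
    | succ n ih =>
      rw [pow_succ', Equiv.Perm.mul_apply]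
      obtain ⟨⟨⟨c, d⟩, hcd⟩, he⟩ : ∃ e, (M.rot ^ n) ⟨(a, b₀), h₀⟩ = e := ⟨_, rfl⟩
      rw [he] at ih ⊢
      obtain ⟨rfl, hd⟩ := ih
      obtain ⟨h1, h2⟩ := M.rot_mk hcd
      rw [h2]
      exact ⟨rfl, hS _ hd⟩
  have := (key n).2
  rw [hn] at this
  exact this

/-- There is a triangular face with boundary walk `a`, `b`, `c`: the walk along a face arrives at
`a` from `c` and leaves along the next dart, to `b`. -/
structure Tri (a b c : X) : Prop where
  adj₁ : P.Adj a b
  adj₂ : P.Adj b c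
  adj₃ : P.Adj c a
  next₁ : M.next a c = b
  next₂ : M.next b a = c
  next₃ : M.next c b = a

/-- All faces at the vertex `a` are triangles. -/
def TrianglesAt (a : X) : Prop := ∀ d : P.Dart, d.fst = a →
  M.facePerm (M.facePerm (M.facePerm d)) = d

variable {M}

theorem TrianglesAt.tri {a c : X} (ha : M.TrianglesAt a) (h : P.Adj a c) :
    M.Tri a (M.next a c) c := by
  set b := M.next a c with hb
  have hab : P.Adj a b := M.adj_next h
  obtain ⟨h1, h2⟩ := M.rot_mk hab.symm
  obtain ⟨h3, h4⟩ := M.rot_mk h1.symm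
  have hφ := ha ⟨(a, b), hab⟩ rfl
  have e1 : M.facePerm ⟨(a, b), hab⟩ = ⟨(b, M.next b a), h1⟩ := h2
  have e2 : M.facePerm ⟨(b, M.next b a), h1⟩ = ⟨(M.next b a, M.next (M.next b a) b), h3⟩ := h4
  rw [e1, e2] at hφ
  have h5 := M.facePerm_fst ⟨(M.next b a, M.next (M.next b a) b), h3⟩
  rw [hφ] at h5
  have h5 : M.next (M.next b a) b = a := h5.symm
  have h6 : P.Adj a (M.next b a) := by
    have h6 := h3.symm
    rwa [h5] at h6
  obtain ⟨h7, h8⟩ := M.rot_mk h6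
  have e3 : M.facePerm ⟨(M.next b a, M.next (M.next b a) b), h3⟩ =
      M.rot ⟨(a, M.next b a), h6⟩ := by
    rw [M.facePerm_apply]
    congr 1
    exact Dart.ext _ _ (Prod.ext h5 rfl)
  rw [e3, h8] at hφ
  have h9 : M.next a (M.next b a) = b := congrArg (fun d : P.Dart => d.snd) hφ
  have h10 : M.next b a = c := M.next_injOn a h6 h (h9.trans hb)
  rw [h10] at h1 h5
  exact ⟨hab, h1, h.symm, rfl, h10, h5⟩

variable (M) in
/-- The vertex `q` has the neighbors `a`, `b`, `c` only, and lies inside the triangle formed by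
these. The orientation of the triangle is left open. -/
def IsCap (q a b c : X) : Prop :=
  (∀ d, P.Adj q d → d = a ∨ d = b ∨ d = c) ∧
    ((M.Tri q a b ∧ M.Tri q b c ∧ M.Tri q c a) ∨ (M.Tri q a c ∧ M.Tri q c b ∧ M.Tri q b a))

theorem IsCap.swap₁₂ {q a b c : X} (h : M.IsCap q a b c) : M.IsCap q b a c := by
  refine ⟨fun d hd => ?_, ?_⟩
  · have := h.1 d hd; tauto
  · rcases h.2 with ⟨h1, h2, h3⟩ | ⟨h1, h2, h3⟩
    · exact Or.inr ⟨h2, h3, h1⟩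
    · exact Or.inl ⟨h3, h1, h2⟩

theorem IsCap.swap₂₃ {q a b c : X} (h : M.IsCap q a b c) : M.IsCap q a c b := by
  refine ⟨fun d hd => ?_, ?_⟩
  · have := h.1 d hd; tauto
  · rcases h.2 with h | h
    · exact Or.inr h
    · exact Or.inl h

theorem IsCap.rotate {q a b c : X} (h : M.IsCap q a b c) : M.IsCap q b c a :=
  h.swap₁₂.swap₂₃

theorem IsCap.adj₁ {q a b c : X} (h : M.IsCap q a b c) : P.Adj q a := by
  rcases h.2 with ⟨h1, -, -⟩ | ⟨h1, -, -⟩ <;> exact h1.adj₁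

theorem IsCap.adj₁₂ {q a b c : X} (h : M.IsCap q a b c) : P.Adj a b := by
  rcases h.2 with ⟨h1, -, -⟩ | ⟨-, -, h1⟩
  · exact h1.adj₂
  · exact h1.adj₂.symm

/-- The two edges of a cap at a corner of its triangle are consecutive in the rotation there. -/
theorem IsCap.next_eq {q a b c : X} (h : M.IsCap q a b c) :
    (M.next a q = b ∧ M.next a c = q) ∨ (M.next a q = c ∧ M.next a b = q) := by
  rcases h.2 with ⟨h1, -, h3⟩ | ⟨h1, -, h3⟩
  · exact Or.inl ⟨h1.next₂, h3.next₃⟩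
  · exact Or.inr ⟨h1.next₂, h3.next₃⟩

/-- If caps `Q` around `b` fill both sides of each of the edges from `b` to `Z`, then `b` has no
other neighbors. -/
theorem neighbors_subset_of_caps [Finite X] {b : X} {Q Z : Set X} (hQ : Q.Nonempty)
    (h₁ : ∀ q ∈ Q, ∃ z ∈ Z, ∃ w ∈ Z, M.IsCap q b z w)
    (h₂ : ∀ z ∈ Z, ∃ q ∈ Q, ∃ q' ∈ Q, q ≠ q' ∧ (∃ w, M.IsCap q b z w) ∧ ∃ w, M.IsCap q' b z w)
    {c : X} (hc : P.Adj b c) : c ∈ Q ∪ Z := by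
  obtain ⟨q₀, hq₀⟩ := hQ
  obtain ⟨z₀, -, w₀, -, hcap₀⟩ := h₁ q₀ hq₀
  refine M.subset_of_next_closed (b₀ := q₀) (Or.inl hq₀) hcap₀.adj₁.symm ?_ hc
  rintro d (hd | hd)
  · obtain ⟨z, hz, w, hw, hcap⟩ := h₁ d hd
    rcases hcap.next_eq with ⟨h, -⟩ | ⟨h, -⟩ <;> rw [h]
    · exact Or.inr hz
    · exact Or.inr hw
  · obtain ⟨q, hq, q', hq', hne, ⟨w, hw⟩, ⟨w', hw'⟩⟩ := h₂ d hd
    rcases hw.next_eq with ⟨h, -⟩ | ⟨-, h⟩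
    · rcases hw'.next_eq with ⟨h', -⟩ | ⟨-, h'⟩
      · exact absurd (M.next_injOn b hw.adj₁.symm hw'.adj₁.symm (h.trans h'.symm)) hne
      · rw [h']; exact Or.inl hq'
    · rw [h]; exact Or.inl hq

theorem next_mapsTo (M : P.RotationSystem) (a : X) :
    ∀ b ∈ {b | P.Adj a b}, M.next a b ∈ {b | P.Adj a b} := fun _ hb => M.adj_next hb

theorem next_transitive [Finite X] (M : P.RotationSystem) (a : X) (S : Set X)
    (hS : S ⊆ {b | P.Adj a b}) (hne : S.Nonempty) (h : ∀ b ∈ S, M.next a b ∈ S) :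
    S = {b | P.Adj a b} := by
  obtain ⟨b, hb⟩ := hne
  exact hS.antisymm fun c hc => M.subset_of_next_closed hb (hS hb) h hc

end RotationSystem

end SimpleGraph

/-! ### Drawings of a blowup around a vertex of degree three -/

namespace SimpleGraph

open Equiv.Perm RotationSystem

/-- The local situation around a vertex `s` of degree three in a triangulation whose three faces
at `s` have received the new vertices `t 0`, `t 1`, `t 2`, in a rotation system of a graph `P` in
which every vertex of the 2-blowup of `H` has two images. The neighbors of `s` in the triangulation
are `x 0`, `x 1`, `x 2`, and `t i` lies in the face opposite to `x i`. An image is a vertex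
`((w, j), k)` where `(w, j)` is the vertex of the blowup.

Every edge of the blowup has an image, and only one image if it is incident to `s`
or `t i`, or connects copies of `x i` and `x j`. The images of `s` and `t i` are not isolated and
have only triangular faces. -/
structure LocalDrawing {W : Type*} (H : SimpleGraph W) (P : SimpleGraph ((W × Fin 2) × Fin 2))
    (M : P.RotationSystem) (s : W) (x t : Fin 3 → W) : Prop where
  x_inj : Function.Injective x
  t_inj : Function.Injective t
  s_ne_x : ∀ i, s ≠ x i
  t_ne_x : ∀ i j, t i ≠ x j
  adj_s : ∀ w, H.Adj s w ↔ (∃ i, w = x i) ∨ ∃ i, w = t i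
  adj_t : ∀ i w, H.Adj (t i) w ↔ w = s ∨ w = x (i + 1) ∨ w = x (i + 2)
  adj_of_adj : ∀ a b, P.Adj a b → H.Adj a.1.1 b.1.1
  exists_adj : ∀ u v : W × Fin 2, H.Adj u.1 v.1 → ∃ k l, P.Adj (u, k) (v, l)
  unique : ∀ a a' b b', (a.1.1 = s ∨ (∃ i, a.1.1 = t i) ∨
    ((∃ i, a.1.1 = x i) ∧ ∃ j, b.1.1 = x j)) → a.1 = a'.1 → b.1 = b'.1 → P.Adj a b →
    P.Adj a' b' → a = a' ∧ b = b'
  exists_adj_of : ∀ a, (a.1.1 = s ∨ ∃ i, a.1.1 = t i) → ∃ b, P.Adj a b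
  trianglesAt : ∀ a, (a.1.1 = s ∨ ∃ i, a.1.1 = t i) → M.TrianglesAt a

/-- A nonempty union of components of `P` that consists of images of `s`, `t i`, and `x i` only and
is not confined to the images of the `x i`. -/
def IsClosedAround {W : Type*} (P : SimpleGraph ((W × Fin 2) × Fin 2)) (s : W)
    (x t : Fin 3 → W) (C : Set ((W × Fin 2) × Fin 2)) : Prop :=
  (∀ a ∈ C, ∀ b, P.Adj a b → b ∈ C) ∧
    (∀ a ∈ C, a.1.1 = s ∨ (∃ i, a.1.1 = t i) ∨ ∃ i, a.1.1 = x i) ∧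
    ∃ a ∈ C, a.1.1 = s ∨ ∃ i, a.1.1 = t i

namespace LocalDrawing

variable {W : Type*} {H : SimpleGraph W} {P : SimpleGraph ((W × Fin 2) × Fin 2)}
  {M : P.RotationSystem} {s : W} {x t : Fin 3 → W}

/-- The two images of a vertex of the blowup have together two neighbors for each adjacent
label. -/
theorem degree_sum [Finite W] (h : LocalDrawing H P M s x t) (u : W × Fin 2)
    (hu : u.1 = s ∨ ∃ i, u.1 = t i) (L : Set W) (hL : ∀ w ∈ L, H.Adj u.1 w) :
    {c | P.Adj (u, 0) c ∧ c.1.1 ∈ L}.ncard + {c | P.Adj (u, 1) c ∧ c.1.1 ∈ L}.ncard =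
      2 * L.ncard := by
  let A : Fin 2 → Set ((W × Fin 2) × Fin 2) := fun k => {c | P.Adj (u, k) c ∧ c.1.1 ∈ L}
  have hinj : ∀ k, Set.InjOn Prod.fst (A k) := by
    rintro k c ⟨hc, -⟩ d ⟨hd, -⟩ hcd
    exact (h.unique (u, k) (u, k) c d (hu.imp_right Or.inl) rfl hcd hc hd).2
  have hdisj : Disjoint (Prod.fst '' A 0) (Prod.fst '' A 1) := by
    rw [Set.disjoint_left]
    rintro v ⟨c, ⟨hc, -⟩, rfl⟩ ⟨d, ⟨hd, -⟩, hcd⟩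
    have := (h.unique (u, 0) (u, 1) c d (hu.imp_right Or.inl) rfl hcd.symm hc hd).1
    simp at this
  have hunion : Prod.fst '' A 0 ∪ Prod.fst '' A 1 = L ×ˢ (Set.univ : Set (Fin 2)) := by
    ext v
    constructor
    · rintro (⟨c, ⟨-, hc⟩, rfl⟩ | ⟨c, ⟨-, hc⟩, rfl⟩) <;> exact ⟨hc, trivial⟩
    · rintro ⟨hv, -⟩
      obtain ⟨k, l, hkl⟩ := h.exists_adj u v (hL _ hv)
      have : k = 0 ∨ k = 1 := by omega
      rcases this with rfl | rfl
      · exact Or.inl ⟨_, ⟨hkl, hv⟩, rfl⟩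
      · exact Or.inr ⟨_, ⟨hkl, hv⟩, rfl⟩
  have h1 := Set.ncard_union_eq hdisj
  rw [hunion, Set.ncard_prod, Set.ncard_univ, (hinj 0).ncard_image,
    (hinj 1).ncard_image, Nat.card_eq_fintype_card, Fintype.card_fin] at h1
  rw [mul_comm, h1]

theorem label_ne (h : LocalDrawing H P M s x t) {a b : (W × Fin 2) × Fin 2} (hab : P.Adj a b) :
    a.1.1 ≠ b.1.1 := (h.adj_of_adj a b hab).ne

theorem fin_add_one_ne : ∀ i : Fin 3, i + 1 ≠ i + 2 := by decide

/-- Every image of `t i` has exactly one neighbor over each neighbor of `t i`, and lies inside the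
triangle formed by these. The two images of a copy of `t i` have six neighbors in total, and an
image with only two would belong to a component that is a single triangle. -/
theorem exists_cap [Finite W] (h : LocalDrawing H P M s x t) (hcl : ∀ C, ¬ IsClosedAround P s x t C)
    (i : Fin 3) (q : (W × Fin 2) × Fin 2) (hq : q.1.1 = t i) :
    ∃ p b c, p.1.1 = s ∧ b.1.1 = x (i + 1) ∧ c.1.1 = x (i + 2) ∧ M.IsCap q p b c := by
  have hlab : ∀ q : (W × Fin 2) × Fin 2, q.1.1 = t i → ∀ c, P.Adj q c →
      c.1.1 = s ∨ c.1.1 = x (i + 1) ∨ c.1.1 = x (i + 2) := by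
    intro q hq c hc
    rw [← h.adj_t, ← hq]
    exact h.adj_of_adj _ _ hc
  have hdeg : ∀ q : (W × Fin 2) × Fin 2, q.1.1 = t i → 3 ≤ {c | P.Adj q c}.ncard := by
    intro q hq
    have htri := h.trianglesAt q (Or.inr ⟨i, hq⟩)
    obtain ⟨b, hb⟩ := h.exists_adj_of q (Or.inr ⟨i, hq⟩)
    have hb' : b ∈ {c | P.Adj q c} := hb
    have h0 : {c | P.Adj q c}.ncard ≠ 0 := ((Set.ncard_pos (Set.toFinite _)).2 ⟨b, hb⟩).ne'
    have h1 : {c | P.Adj q c}.ncard ≠ 1 := by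
      intro h1
      obtain ⟨c, hc⟩ := Set.ncard_eq_one.1 h1
      have h2 : M.next q b ∈ {c | P.Adj q c} := M.adj_next hb
      rw [hc] at h2 hb'
      exact (htri.tri hb).adj₂.ne (h2.trans hb'.symm)
    have h2 : {c | P.Adj q c}.ncard ≠ 2 := by
      intro h2
      obtain ⟨hN, hff, hne⟩ := two_cycle (M.next_mapsTo q) (M.next_transitive q) h2 hb'
      set c := M.next q b with hc
      have hqc : P.Adj q c := M.adj_next hb
      have t1 : M.Tri q c b := htri.tri hb
      have t2 : M.Tri q b c := by simpa [hff] using htri.tri hqc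
      -- the component is the triangle formed by `q`, `b` and `c`
      have cb : ∀ d, P.Adj b d → d ∈ ({q, c} : Set _) := by
        intro d hd
        refine M.subset_of_next_closed (b₀ := q) (Or.inl rfl) hb.symm ?_ hd
        rintro e (he | he)
        · rw [he, t2.next₂]; exact Or.inr rfl
        · have he : e = c := he
          rw [he, t1.next₃]; exact Or.inl rfl
      have cc : ∀ d, P.Adj c d → d ∈ ({q, b} : Set _) := by
        intro d hd
        refine M.subset_of_next_closed (b₀ := q) (Or.inl rfl) hqc.symm ?_ hd
        rintro e (he | he)
        · rw [he, t1.next₂]; exact Or.inr rfl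
        · have he : e = b := he
          rw [he, t2.next₃]; exact Or.inl rfl
      refine hcl {q, b, c} ⟨?_, ?_, q, Or.inl rfl, Or.inr ⟨i, hq⟩⟩
      · intro a ha d hd
        rcases ha with ha | ha | ha
        · have hd' : d ∈ {c | P.Adj q c} := ha ▸ hd
          rw [hN] at hd'
          exact Or.inr hd'
        · rcases cb d (ha ▸ hd) with h | h
          · exact Or.inl h
          · exact Or.inr (Or.inr h)
        · have ha : a = c := ha
          rcases cc d (ha ▸ hd) with h | h
          · exact Or.inl h
          · exact Or.inr (Or.inl h)
      · have hx : ∀ d, P.Adj q d → d.1.1 = s ∨ (∃ i, d.1.1 = t i) ∨ ∃ i, d.1.1 = x i := by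
          intro d hd
          rcases hlab q hq d hd with h | h | h
          · exact Or.inl h
          · exact Or.inr (Or.inr ⟨_, h⟩)
          · exact Or.inr (Or.inr ⟨_, h⟩)
        rintro a (rfl | rfl | rfl)
        · exact Or.inr (Or.inl ⟨i, hq⟩)
        · exact hx _ hb
        · exact hx _ hqc
    omega
  have hdeg3 : {c | P.Adj q c}.ncard = 3 := by
    have hsum := h.degree_sum q.1 (Or.inr ⟨i, hq⟩) {s, x (i + 1), x (i + 2)} (by
      intro w hw; rw [hq, h.adj_t]; exact hw)
    rw [Set.ncard_insert_of_notMem (by simp [h.s_ne_x]),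
      Set.ncard_pair (fun e => fin_add_one_ne i (h.x_inj e))] at hsum
    have hset : ∀ k, {c | P.Adj (q.1, k) c ∧ c.1.1 ∈ ({s, x (i + 1), x (i + 2)} : Set W)} =
        {c | P.Adj (q.1, k) c} := by
      intro k
      ext c
      exact ⟨fun hc => hc.1, fun hc => ⟨hc, hlab (q.1, k) hq c hc⟩⟩
    rw [hset, hset] at hsum
    have h0 := hdeg (q.1, 0) hq
    have h1 := hdeg (q.1, 1) hq
    obtain ⟨u, k⟩ := q
    have : k = 0 ∨ k = 1 := by omega
    rcases this with rfl | rfl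
    · simp only at hsum h0 h1; omega
    · simp only at hsum h0 h1; omega
  have htri := h.trianglesAt q (Or.inr ⟨i, hq⟩)
  have hcyc := fun {b} (hb : b ∈ {c | P.Adj q c}) =>
    three_cycle (M.next_mapsTo q) (M.next_injOn q) (M.next_transitive q) hdeg3 hb
  -- consecutive neighbors have different labels, so one of three has the label `s`
  have hp : ∃ p, P.Adj q p ∧ p.1.1 = s := by
    obtain ⟨b, hb⟩ := h.exists_adj_of q (Or.inr ⟨i, hq⟩)
    obtain ⟨-, h3⟩ := hcyc hb
    have hb1 := M.adj_next hb
    have hb2 := M.adj_next hb1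
    have n1 := h.label_ne (htri.tri hb).adj₂
    have n2 := h.label_ne (htri.tri hb1).adj₂
    have n3 := h.label_ne (htri.tri hb2).adj₂
    rw [h3] at n3
    rcases hlab q hq _ hb with l0 | l0 | l0
    · exact ⟨_, hb, l0⟩
    all_goals
      rcases hlab q hq _ hb1 with l1 | l1 | l1
      · exact ⟨_, hb1, l1⟩
      all_goals
        rcases hlab q hq _ hb2 with l2 | l2 | l2
        · exact ⟨_, hb2, l2⟩
        all_goals
          rw [l0, l1] at n1
          rw [l1, l2] at n2
          rw [l0, l2] at n3
          exact absurd rfl (by assumption)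
  obtain ⟨p, hp, hps⟩ := hp
  obtain ⟨hN, h3⟩ := hcyc hp
  have hb1 := M.adj_next hp
  have hb2 := M.adj_next hb1
  have t1 := htri.tri hp
  have t2 := htri.tri hb1
  have t3 := htri.tri hb2
  rw [h3] at t3
  have n1 := h.label_ne t1.adj₂
  have n2 := h.label_ne t2.adj₂
  have n3 := h.label_ne t3.adj₂
  have hcap : M.IsCap q p (M.next q p) (M.next q (M.next q p)) := by
    refine ⟨fun d hd => ?_, Or.inr ⟨t3, t2, t1⟩⟩
    have : d ∈ {c | P.Adj q c} := hd
    rw [hN] at this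
    exact this
  rw [hps] at n1 n3
  rcases hlab q hq _ hb1 with l1 | l1 | l1
  · exact absurd l1 n1
  · rcases hlab q hq _ hb2 with l2 | l2 | l2
    · exact absurd l2.symm n3
    · rw [l1, l2] at n2; exact absurd rfl n2
    · exact ⟨_, _, _, hps, l1, l2, hcap⟩
  · rcases hlab q hq _ hb2 with l2 | l2 | l2
    · exact absurd l2.symm n3
    · exact ⟨_, _, _, hps, l2, l1, hcap.swap₂₃⟩
    · rw [l1, l2] at n2; exact absurd rfl n2

theorem exists_cap_of_adj [Finite W] (h : LocalDrawing H P M s x t)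
    (hcl : ∀ C, ¬ IsClosedAround P s x t C) {i : Fin 3} {p q : (W × Fin 2) × Fin 2}
    (hq : q.1.1 = t i) (hp : p.1.1 = s) (hpq : P.Adj p q) :
    ∃ b c, b.1.1 = x (i + 1) ∧ c.1.1 = x (i + 2) ∧ M.IsCap q p b c := by
  obtain ⟨p', b, c, hp', hb, hc, hcap⟩ := h.exists_cap hcl i q hq
  rcases hcap.1 p hpq.symm with rfl | rfl | rfl
  · exact ⟨b, c, hb, hc, hcap⟩
  · exact absurd (hp.symm.trans hb) (h.s_ne_x _)
  · exact absurd (hp.symm.trans hc) (h.s_ne_x _)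

/-- Around an image of `s`, one image of each of `x 0`, `x 1`, `x 2` alternates with one of each of
`t 0`, `t 1`, `t 2`, which are caps by `exists_cap`. The two images of a copy of `s` have six
neighbors over the `x i` in total, and an image with only two such neighbors would belong to a
component with five vertices. -/
theorem exists_caps [Finite W] (h : LocalDrawing H P M s x t)
    (hcl : ∀ C, ¬ IsClosedAround P s x t C) (p : (W × Fin 2) × Fin 2) (hp : p.1.1 = s) :
    ∃ b q : Fin 3 → (W × Fin 2) × Fin 2, (∀ i, (b i).1.1 = x i) ∧ (∀ i, (q i).1.1 = t i) ∧
      ∀ i, M.IsCap (q i) p (b (i + 1)) (b (i + 2)) := by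
  -- the neighbors over the `x i`, and those over the `t i`
  let A : (W × Fin 2) × Fin 2 → Set ((W × Fin 2) × Fin 2) :=
    fun p => {c | P.Adj p c ∧ c.1.1 ∈ Set.range x}
  let T : (W × Fin 2) × Fin 2 → Set ((W × Fin 2) × Fin 2) :=
    fun p => {c | P.Adj p c ∧ c.1.1 ∈ Set.range t}
  have hAT : ∀ p : (W × Fin 2) × Fin 2, p.1.1 = s → ∀ c, P.Adj p c → c ∈ A p ∨ c ∈ T p := by
    intro p hp c hc
    have := h.adj_of_adj _ _ hc
    rw [hp, h.adj_s] at this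
    rcases this with ⟨i, hi⟩ | ⟨i, hi⟩
    · exact Or.inl ⟨hc, i, hi.symm⟩
    · exact Or.inr ⟨hc, i, hi.symm⟩
  have hdis : ∀ p c, c ∈ A p → c ∈ T p → False := by
    rintro p c ⟨-, i, hi⟩ ⟨-, j, hj⟩
    exact h.t_ne_x j i (hj.trans hi.symm)
  have hTA : ∀ p : (W × Fin 2) × Fin 2, p.1.1 = s → ∀ q ∈ T p, M.next p q ∈ A p := by
    rintro p hp q ⟨hpq, i, hi⟩
    have htri := (h.trianglesAt p (Or.inl hp)).tri hpq
    refine ⟨htri.adj₁, ?_⟩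
    have := h.adj_of_adj _ _ htri.adj₂.symm
    rw [← hi, h.adj_t] at this
    rcases this with h1 | h1 | h1
    · exact absurd (hp.trans h1.symm) (h.label_ne htri.adj₁)
    · exact ⟨_, h1.symm⟩
    · exact ⟨_, h1.symm⟩
  have hle : ∀ p : (W × Fin 2) × Fin 2, p.1.1 = s → (T p).ncard ≤ (A p).ncard := fun p hp =>
    Set.ncard_le_ncard_of_injOn (M.next p) (hTA p hp)
      (fun _ hb _ hc => M.next_injOn p hb.1 hc.1)
  have hxcard : (Set.range x).ncard = 3 := by
    rw [← Set.image_univ, h.x_inj.injOn.ncard_image, Set.ncard_univ]; simp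
  have htcard : (Set.range t).ncard = 3 := by
    rw [← Set.image_univ, h.t_inj.injOn.ncard_image, Set.ncard_univ]; simp
  have hsumA : ∀ u : W × Fin 2, u.1 = s → (A (u, 0)).ncard + (A (u, 1)).ncard = 6 := by
    intro u hu
    have := h.degree_sum u (Or.inl hu) (Set.range x) (by
      rintro w ⟨i, rfl⟩; rw [hu, h.adj_s]; exact Or.inl ⟨i, rfl⟩)
    rwa [hxcard] at this
  have hsumT : ∀ u : W × Fin 2, u.1 = s → (T (u, 0)).ncard + (T (u, 1)).ncard = 6 := by
    intro u hu
    have := h.degree_sum u (Or.inl hu) (Set.range t) (by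
      rintro w ⟨i, rfl⟩; rw [hu, h.adj_s]; exact Or.inr ⟨i, rfl⟩)
    rwa [htcard] at this
  -- both numbers add up to six, so `next` is a bijection from `T p` to `A p`
  have heq : ∀ p : (W × Fin 2) × Fin 2, p.1.1 = s → (T p).ncard = (A p).ncard := by
    rintro ⟨u, k⟩ hu
    have h1 := hsumA u hu
    have h2 := hsumT u hu
    have h3 := hle (u, 0) hu
    have h4 := hle (u, 1) hu
    have : k = 0 ∨ k = 1 := by omega
    rcases this with rfl | rfl <;> omega
  have hAT' : ∀ p : (W × Fin 2) × Fin 2, p.1.1 = s → ∀ b ∈ A p, M.next p b ∈ T p := by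
    intro p hp b hb
    rcases hAT p hp _ (M.adj_next hb.1) with h1 | h1
    · have himg : M.next p '' T p = A p := by
        refine Set.eq_of_subset_of_ncard_le ?_ ?_ (Set.toFinite _)
        · rintro _ ⟨q, hq, rfl⟩; exact hTA p hp q hq
        · rw [Set.InjOn.ncard_image (fun _ hb _ hc => M.next_injOn p hb.1 hc.1), heq p hp]
      rw [← himg] at h1
      obtain ⟨q, hq, hqb⟩ := h1
      rw [M.next_injOn p hq.1 hb.1 hqb] at hq
      exact (hdis p b hb hq).elim
    · exact h1
  -- the image of `t i` between `b` and the next but one neighbor of `p`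
  have hcap : ∀ p : (W × Fin 2) × Fin 2, p.1.1 = s → ∀ b ∈ A p, ∃ i,
      (M.next p b).1.1 = t i ∧ M.IsCap (M.next p b) p b (M.next p (M.next p b)) ∧
      ((b.1.1 = x (i + 1) ∧ (M.next p (M.next p b)).1.1 = x (i + 2)) ∨
        (b.1.1 = x (i + 2) ∧ (M.next p (M.next p b)).1.1 = x (i + 1))) := by
    intro p hp b hb
    obtain ⟨hpq, i, hi⟩ := hAT' p hp b hb
    obtain ⟨c, d, hc, hd, hcap⟩ := h.exists_cap_of_adj hcl hi.symm hp hpq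
    refine ⟨i, hi.symm, ?_⟩
    rcases hcap.next_eq with ⟨h1, h2⟩ | ⟨h1, h2⟩
    · have : d = b := M.next_injOn p hcap.swap₂₃.adj₁₂ hb.1 h2
      subst this
      rw [h1]
      exact ⟨hcap.swap₂₃, Or.inr ⟨hd, hc⟩⟩
    · have : c = b := M.next_injOn p hcap.adj₁₂ hb.1 h2
      subst this
      rw [h1]
      exact ⟨hcap, Or.inl ⟨hc, hd⟩⟩
  have hψmap : ∀ p : (W × Fin 2) × Fin 2, p.1.1 = s →
      ∀ b ∈ A p, M.next p (M.next p b) ∈ A p := fun p hp b hb => hTA p hp _ (hAT' p hp b hb)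
  have hψinj : ∀ p, Set.InjOn (fun b => M.next p (M.next p b)) (A p) := fun p b hb c hc hbc =>
    M.next_injOn p hb.1 hc.1 (M.next_injOn p (M.adj_next hb.1) (M.adj_next hc.1) hbc)
  have hψtrans : ∀ p : (W × Fin 2) × Fin 2, p.1.1 = s → ∀ S ⊆ A p, S.Nonempty →
      (∀ b ∈ S, M.next p (M.next p b) ∈ S) → S = A p := by
    intro p hp S hS hne hcl
    refine hS.antisymm fun c hc => ?_
    obtain ⟨b, hb⟩ := hne
    have : c ∈ S ∪ M.next p '' S := by
      refine M.subset_of_next_closed (b₀ := b) (Or.inl hb) (hS hb).1 ?_ hc.1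
      rintro d (hd | ⟨d, hd, rfl⟩)
      · exact Or.inr ⟨d, hd, rfl⟩
      · exact Or.inl (hcl d hd)
    rcases this with h1 | ⟨d, hd, rfl⟩
    · exact h1
    · exact (hdis p _ hc (hAT' p hp d (hS hd))).elim
  have hdeg : ∀ p : (W × Fin 2) × Fin 2, p.1.1 = s → 3 ≤ (A p).ncard := by
    intro p hp
    obtain ⟨b, hb⟩ : (A p).Nonempty := by
      obtain ⟨b, hb⟩ := h.exists_adj_of p (Or.inl hp)
      rcases hAT p hp b hb with h1 | h1
      · exact ⟨b, h1⟩
      · exact ⟨_, hTA p hp b h1⟩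
    have h0 : (A p).ncard ≠ 0 := ((Set.ncard_pos (Set.toFinite _)).2 ⟨b, hb⟩).ne'
    have h1 : (A p).ncard ≠ 1 := by
      intro h1
      obtain ⟨c, hc⟩ := Set.ncard_eq_one.1 h1
      have h2 := hψmap p hp b hb
      obtain ⟨i, -, hq, -⟩ := hcap p hp b hb
      rw [hc] at h2 hb
      exact hq.rotate.adj₁₂.ne (Eq.trans hb h2.symm)
    have h2 : (A p).ncard ≠ 2 := by
      intro h2
      obtain ⟨hN, hff, hne⟩ := two_cycle (hψmap p hp) (hψtrans p hp) h2 hb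
      set q := M.next p b with hq
      set c := M.next p q with hc
      set q' := M.next p c with hq'
      have hc' : c ∈ A p := hψmap p hp b hb
      obtain ⟨i, hqi, cap1, hbx⟩ := hcap p hp b hb
      obtain ⟨j, hqj, cap2, -⟩ := hcap p hp c hc'
      rw [← hq', hff] at cap2
      rw [← hq, ← hc] at cap1
      replace cap2 := cap2.swap₂₃
      have hqq : q ≠ q' := fun e =>
        hne (M.next_injOn p hc'.1 hb.1 (hq'.symm.trans (e.symm.trans hq)))
      -- the component has the five vertices `p`, `q`, `q'`, `b`, `c`
      have closed : ∀ a z w, M.IsCap q a z w → M.IsCap q' a z w → ∀ d, P.Adj a d →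
          d ∈ ({q, q'} ∪ {z, w} : Set _) := by
        intro a z w k1 k2 d hd
        refine neighbors_subset_of_caps (M := M) ⟨q, Or.inl rfl⟩ ?_ ?_ hd
        · rintro e (rfl | rfl)
          · exact ⟨z, Or.inl rfl, w, Or.inr rfl, k1⟩
          · exact ⟨z, Or.inl rfl, w, Or.inr rfl, k2⟩
        · rintro e (rfl | rfl)
          · exact ⟨q, Or.inl rfl, q', Or.inr rfl, hqq, ⟨w, k1⟩, ⟨w, k2⟩⟩
          · exact ⟨q, Or.inl rfl, q', Or.inr rfl, hqq, ⟨z, k1.swap₂₃⟩, ⟨z, k2.swap₂₃⟩⟩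
      refine hcl {y | y = p ∨ y = q ∨ y = q' ∨ y = b ∨ y = c} ⟨?_, ?_, p, Or.inl rfl, Or.inl hp⟩
      · rintro a ha d hd
        rcases ha with ha | ha | ha | ha | ha <;> rw [ha] at hd
        · have := closed p b c cap1 cap2 d hd
          simp only [Set.mem_union, Set.mem_insert_iff, Set.mem_singleton_iff] at this
          simp only [Set.mem_ofPred_eq]; tauto
        · have := cap1.1 d hd
          simp only [Set.mem_ofPred_eq]; tauto
        · have := cap2.1 d hd
          simp only [Set.mem_ofPred_eq]; tauto
        · have := closed b p c cap1.swap₁₂ cap2.swap₁₂ d hd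
          simp only [Set.mem_union, Set.mem_insert_iff, Set.mem_singleton_iff] at this
          simp only [Set.mem_ofPred_eq]; tauto
        · have := closed c b p cap1.rotate.swap₁₂ cap2.rotate.swap₁₂ d hd
          simp only [Set.mem_union, Set.mem_insert_iff, Set.mem_singleton_iff] at this
          simp only [Set.mem_ofPred_eq]; tauto
      · rintro a ha
        have hb3 : ∃ i, b.1.1 = x i := hb.2.imp fun _ h => h.symm
        have hc3 : ∃ i, c.1.1 = x i := hc'.2.imp fun _ h => h.symm
        rcases ha with ha | ha | ha | ha | ha <;> rw [ha]
        · exact Or.inl hp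
        · exact Or.inr (Or.inl ⟨i, hqi⟩)
        · exact Or.inr (Or.inl ⟨j, hqj⟩)
        · exact Or.inr (Or.inr hb3)
        · exact Or.inr (Or.inr hc3)
    omega
  have hdeg3 : (A p).ncard = 3 := by
    obtain ⟨u, k⟩ := p
    have h1 := hsumA u hp
    have h2 := hdeg (u, 0) hp
    have h3 := hdeg (u, 1) hp
    have : k = 0 ∨ k = 1 := by omega
    rcases this with rfl | rfl <;> omega
  have hlne : ∀ b ∈ A p, (M.next p (M.next p b)).1.1 ≠ b.1.1 := by
    intro b hb
    obtain ⟨i, -, -, ⟨h1, h2⟩ | ⟨h1, h2⟩⟩ := hcap p hp b hb <;> rw [h1, h2]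
    · exact fun e => fin_add_one_ne i (h.x_inj e).symm
    · exact fun e => fin_add_one_ne i (h.x_inj e)
  -- the three neighbors in `A p` have three different labels
  have hlinj : Set.InjOn (fun c : (W × Fin 2) × Fin 2 => c.1.1) (A p) := by
    intro b hb c hc hbc
    obtain ⟨hN, h3⟩ := three_cycle (hψmap p hp) (hψinj p) (hψtrans p hp) hdeg3 hb
    have h4 := hlne b hb
    have h5 := hlne _ (hψmap p hp _ (hψmap p hp b hb))
    rw [h3] at h5
    rw [hN] at hc
    rcases hc with rfl | rfl | rfl
    · rfl
    · exact absurd hbc.symm h4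
    · exact absurd hbc h5
  have hsurj : ∀ i, ∃ b ∈ A p, b.1.1 = x i := by
    intro i
    have himg : (fun c : (W × Fin 2) × Fin 2 => c.1.1) '' A p = Set.range x := by
      refine Set.eq_of_subset_of_ncard_le ?_ ?_ (Set.toFinite _)
      · rintro _ ⟨c, hc, rfl⟩; exact hc.2
      · rw [hlinj.ncard_image, hdeg3, hxcard]
    have : x i ∈ (fun c : (W × Fin 2) × Fin 2 => c.1.1) '' A p := by
      rw [himg]; exact ⟨i, rfl⟩
    exact this
  choose b hbA hbx using hsurj
  have hπ : ∀ i, ∃ j, M.next p (M.next p (b i)) = b j := by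
    intro i
    have h1 := hψmap p hp _ (hbA i)
    obtain ⟨j, hj⟩ := h1.2
    exact ⟨j, hlinj h1 (hbA j) (hj.symm.trans (hbx j).symm)⟩
  choose π hπ using hπ
  have hbinj : ∀ i j, b i = b j → i = j := fun i j e =>
    h.x_inj ((hbx i).symm.trans ((congrArg (fun c => c.1.1) e).trans (hbx j)))
  have hπne : ∀ i, π i ≠ i := by
    intro i e
    have := hlne _ (hbA i)
    rw [hπ, e] at this
    exact this rfl
  have hπinj : Function.Injective π := by
    intro i j e
    refine hbinj i j (hψinj p (hbA i) (hbA j) ?_)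
    show M.next p (M.next p (b i)) = M.next p (M.next p (b j))
    rw [hπ, hπ, e]
  have hdec : ∀ π : Fin 3 → Fin 3, (∀ i, π i ≠ i) → Function.Injective π →
      ∀ i, π (i + 1) = i + 2 ∨ π (i + 2) = i + 1 := by decide
  have hfin : ∀ i j : Fin 3, (i + 1 = j + 1 ∧ i + 2 = j + 2) ∨ (i + 1 = j + 2 ∧ i + 2 = j + 1) →
      i = j := by decide
  have hq : ∀ i, ∃ q, q.1.1 = t i ∧ M.IsCap q p (b (i + 1)) (b (i + 2)) := by
    intro i
    rcases hdec π hπne hπinj i with e | e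
    · obtain ⟨j, hj, hc, hl⟩ := hcap p hp _ (hbA (i + 1))
      rw [hπ, e] at hc hl
      rw [hbx, hbx] at hl
      have : i = j := hfin i j (hl.imp (fun k => ⟨h.x_inj k.1, h.x_inj k.2⟩)
        (fun k => ⟨h.x_inj k.1, h.x_inj k.2⟩))
      exact ⟨_, this ▸ hj, hc⟩
    · obtain ⟨j, hj, hc, hl⟩ := hcap p hp _ (hbA (i + 2))
      rw [hπ, e] at hc hl
      rw [hbx, hbx] at hl
      have : i = j := hfin i j (hl.symm.imp (fun k => ⟨h.x_inj k.2, h.x_inj k.1⟩)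
        (fun k => ⟨h.x_inj k.2, h.x_inj k.1⟩))
      exact ⟨_, this ▸ hj, hc.swap₂₃⟩
  choose q hqt hqc using hq
  exact ⟨b, q, hbx, hqt, hqc⟩

/-- A component around `s`. Otherwise there are three caps around each of the two images `p`
and `p₁` of the copy `(s, 0)`. The copies of `x i` and `t i` that are adjacent to `p` differ from
those that are adjacent to `p₁`. The other image `q' i` of the copy of `t i` at `p₁` caps a triangle
on a copy of `s`, and its remaining two corners are over the copies of `x (i + 1)` and
`x (i + 2)` adjacent to `p`. As the edge between these has a single image, `q' i` lies on the other
side of the edge that bounds the cap `q i`. The third corner of the three new caps is one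
image `p' 0` of `(s, 1)`, and the component of `p` has the eleven vertices `p`, `p' 0`, `b i`,
`q i`, `q' i`. -/
theorem exists_isClosedAround [Finite W] (h : LocalDrawing H P M s x t) :
    ∃ C, IsClosedAround P s x t C := by
  by_contra hcl
  push Not at hcl
  obtain ⟨b, q, hb, hq, hcap⟩ := h.exists_caps hcl ((s, 0), 0) rfl
  obtain ⟨b₁, q₁, hb₁, hq₁, hcap₁⟩ := h.exists_caps hcl ((s, 0), 1) rfl
  set p : (W × Fin 2) × Fin 2 := ((s, 0), 0) with hp
  set p₁ : (W × Fin 2) × Fin 2 := ((s, 0), 1) with hp₁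
  have hpp : p ≠ p₁ := by simp [p, p₁]
  have fin2 : ∀ u v w : W × Fin 2, u.1 = w.1 → v.1 = w.1 → u ≠ w → v ≠ w → u = v := by
    rintro ⟨u, i⟩ ⟨v, j⟩ ⟨w, k⟩ (rfl : u = w) (rfl : v = u) h1 h2
    have h1 : i ≠ k := fun e => h1 (by rw [e])
    have h2 : j ≠ k := fun e => h2 (by rw [e])
    have : i = j := by omega
    rw [this]
  have hi12 : ∀ i : Fin 3, ∃ k, i = k + 1 := fun i => ⟨i - 1, by simp⟩
  -- the two images of one copy of `s` use different copies of its neighbors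
  have hpb : ∀ i, P.Adj p (b i) ∧ P.Adj p₁ (b₁ i) := by
    intro i
    obtain ⟨k, rfl⟩ := hi12 i
    exact ⟨(hcap k).adj₁₂, (hcap₁ k).adj₁₂⟩
  have hbne : ∀ i, (b i).1 ≠ (b₁ i).1 := fun i e =>
    hpp (h.unique p p₁ (b i) (b₁ i) (Or.inl rfl) rfl e (hpb i).1 (hpb i).2).1
  have hqne : ∀ i, (q i).1 ≠ (q₁ i).1 := fun i e =>
    hpp (h.unique p p₁ (q i) (q₁ i) (Or.inl rfl) rfl e (hcap i).adj₁.symm (hcap₁ i).adj₁.symm).1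
  -- the other image of the copy of `t i` adjacent to `p₁`
  have hother : ∀ i, ∃ q', q'.1 = (q₁ i).1 ∧ q' ≠ q₁ i := by
    intro i
    refine ⟨((q₁ i).1, (q₁ i).2 + 1), rfl, fun e => ?_⟩
    have : (q₁ i).2 + 1 = (q₁ i).2 := congrArg (fun c => c.2) e
    have h2 : ∀ k : Fin 2, k + 1 ≠ k := by decide
    exact h2 _ this
  choose q' hq' hq'ne using hother
  have hq't : ∀ i, (q' i).1.1 = t i := fun i => (congrArg Prod.fst (hq' i)).trans (hq₁ i)
  have hcap' : ∀ i, ∃ p', p'.1 = (s, 1) ∧ M.IsCap (q' i) p' (b (i + 1)) (b (i + 2)) := by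
    intro i
    obtain ⟨p', c, d, hps, hc, hd, hpcd⟩ := h.exists_cap hcl i (q' i) (hq't i)
    have huniq : ∀ y z, P.Adj (q' i) y → P.Adj (q₁ i) z → y.1 ≠ z.1 := fun y z hy hz e =>
      hq'ne i (h.unique (q' i) (q₁ i) y z (Or.inr (Or.inl ⟨i, hq't i⟩)) (hq' i) e hy hz).1
    have e1 : p'.1 = (s, 1) := by
      refine fin2 _ _ (s, 0) hps rfl (huniq p' p₁ hpcd.adj₁ (hcap₁ i).adj₁) (by simp)
    have e2 : c.1 = (b (i + 1)).1 := fin2 _ _ (b₁ (i + 1)).1 (hc.trans (hb₁ _).symm)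
      ((hb _).trans (hb₁ _).symm)
      (huniq c _ hpcd.rotate.adj₁ (hcap₁ i).rotate.adj₁) (hbne _)
    have e3 : d.1 = (b (i + 2)).1 := fin2 _ _ (b₁ (i + 2)).1 (hd.trans (hb₁ _).symm)
      ((hb _).trans (hb₁ _).symm)
      (huniq d _ hpcd.rotate.rotate.adj₁ (hcap₁ i).rotate.rotate.adj₁) (hbne _)
    obtain ⟨e4, e5⟩ := h.unique c (b (i + 1)) d (b (i + 2))
      (Or.inr (Or.inr ⟨⟨_, hc⟩, ⟨_, hd⟩⟩)) e2 e3 hpcd.rotate.adj₁₂ (hcap i).rotate.adj₁₂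
    rw [e4, e5] at hpcd
    exact ⟨p', e1, hpcd⟩
  choose p' hp' hcap' using hcap'
  -- consecutive caps share an edge from `p' i` to an image of some `x j`
  have hpeq : ∀ i, p' i = p' (i + 1) := by
    intro i
    have a1 : P.Adj (p' i) (b (i + 2)) := (hcap' i).rotate.rotate.adj₁₂.symm
    have a2 : P.Adj (p' (i + 1)) (b (i + 1 + 1)) := (hcap' (i + 1)).adj₁₂
    have e : i + 1 + 1 = i + 2 := by rw [add_assoc]; rfl
    rw [e] at a2
    exact (h.unique _ _ _ _ (Or.inl (by rw [hp'])) ((hp' _).trans (hp' _).symm) rfl a1 a2).1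
  have hpall : ∀ i, p' i = p' 0 := by
    intro i
    have e0 := hpeq 0
    have e1 := hpeq 1
    fin_cases i
    · rfl
    · exact e0.symm
    · exact (e0.trans e1).symm
  have hcap'' : ∀ i, M.IsCap (q' i) (p' 0) (b (i + 1)) (b (i + 2)) := fun i => by
    have := hcap' i
    rwa [hpall] at this
  have hqq : ∀ i j, q i ≠ q' j := by
    intro i j e
    have e1 := congrArg (fun c => c.1.1) e
    simp only [hq, hq't] at e1
    have e2 := h.t_inj e1
    subst e2
    exact hqne i ((congrArg Prod.fst e).trans (hq' i))
  have htinj : ∀ i j, i ≠ j → q i ≠ q j := fun i j hij e =>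
    hij (h.t_inj ((hq i).symm.trans ((congrArg (fun c => c.1.1) e).trans (hq j))))
  have htinj' : ∀ i j, i ≠ j → q' i ≠ q' j := fun i j hij e =>
    hij (h.t_inj ((hq't i).symm.trans ((congrArg (fun c => c.1.1) e).trans (hq't j))))
  -- the neighbors of an image of `s` whose caps are known
  have hs : ∀ (p : (W × Fin 2) × Fin 2) (q : Fin 3 → (W × Fin 2) × Fin 2),
      (∀ i j, i ≠ j → q i ≠ q j) → (∀ i, M.IsCap (q i) p (b (i + 1)) (b (i + 2))) →
      ∀ d, P.Adj p d → d ∈ Set.range q ∪ Set.range b := by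
    intro p q hqne hcap d hd
    refine neighbors_subset_of_caps (M := M) (Set.range_nonempty q) ?_ ?_ hd
    · rintro _ ⟨i, rfl⟩
      exact ⟨_, ⟨_, rfl⟩, _, ⟨_, rfl⟩, hcap i⟩
    · rintro _ ⟨i, rfl⟩
      have k1 := hcap (i + 2)
      have k2 := hcap (i + 1)
      have f1 : ∀ i : Fin 3, i + 2 + 1 = i := by decide
      have f2 : ∀ i : Fin 3, i + 1 + 2 = i := by decide
      rw [f1] at k1
      rw [f2] at k2
      exact ⟨q (i + 2), ⟨_, rfl⟩, q (i + 1), ⟨_, rfl⟩,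
        hqne _ _ (fin_add_one_ne i).symm, ⟨_, k1⟩, ⟨_, k2.swap₂₃⟩⟩
  -- the four caps around `b i`
  have hx : ∀ i d, P.Adj (b i) d → d ∈ ({q (i + 1), q (i + 2), q' (i + 1), q' (i + 2)} : Set _) ∪
      {p, p' 0, b (i + 1), b (i + 2)} := by
    intro i d hd
    have f1 : i + 2 + 1 = i := by clear hd; revert i; decide
    have f2 : i + 1 + 2 = i := by clear hd; revert i; decide
    have f3 : i + 1 + 1 = i + 2 := by clear hd; revert i; decide
    have f4 : i + 2 + 2 = i + 1 := by clear hd; revert i; decide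
    have k1 := (hcap (i + 1)).rotate.rotate
    have k2 := (hcap (i + 2)).rotate
    have k3 := (hcap'' (i + 1)).rotate.rotate
    have k4 := (hcap'' (i + 2)).rotate
    rw [f2, f3] at k1 k3
    rw [f1, f4] at k2 k4
    refine neighbors_subset_of_caps (M := M) ⟨q (i + 1), Or.inl rfl⟩ ?_ ?_ hd
    · rintro e (rfl | rfl | rfl | rfl)
      · exact ⟨_, by simp, _, by simp, k1⟩
      · exact ⟨_, by simp, _, by simp, k2⟩
      · exact ⟨_, by simp, _, by simp, k3⟩
      · exact ⟨_, by simp, _, by simp, k4⟩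
    · rintro e (rfl | rfl | rfl | rfl)
      · exact ⟨q (i + 1), by simp, q (i + 2), by simp, htinj _ _ (fin_add_one_ne i), ⟨_, k1⟩,
          ⟨_, k2.swap₂₃⟩⟩
      · exact ⟨q' (i + 1), by simp, q' (i + 2), by simp, htinj' _ _ (fin_add_one_ne i), ⟨_, k3⟩,
          ⟨_, k4.swap₂₃⟩⟩
      · exact ⟨q (i + 2), by simp, q' (i + 2), by simp, hqq _ _, ⟨_, k2⟩, ⟨_, k4⟩⟩
      · exact ⟨q (i + 1), by simp, q' (i + 1), by simp, hqq _ _, ⟨_, k1.swap₂₃⟩,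
          ⟨_, k3.swap₂₃⟩⟩
  refine hcl {y | y = p ∨ y = p' 0 ∨ (∃ i, y = q i) ∨ (∃ i, y = q' i) ∨ ∃ i, y = b i}
    ⟨?_, ?_, p, Or.inl rfl, Or.inl rfl⟩
  · rintro a (rfl | rfl | ⟨i, rfl⟩ | ⟨i, rfl⟩ | ⟨i, rfl⟩) d hd
    · rcases hs _ q htinj hcap d hd with ⟨i, rfl⟩ | ⟨i, rfl⟩
      · exact Or.inr (Or.inr (Or.inl ⟨i, rfl⟩))
      · exact Or.inr (Or.inr (Or.inr (Or.inr ⟨i, rfl⟩)))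
    · rcases hs _ q' htinj' hcap'' d hd with ⟨i, rfl⟩ | ⟨i, rfl⟩
      · exact Or.inr (Or.inr (Or.inr (Or.inl ⟨i, rfl⟩)))
      · exact Or.inr (Or.inr (Or.inr (Or.inr ⟨i, rfl⟩)))
    · rcases (hcap i).1 d hd with rfl | rfl | rfl
      · exact Or.inl rfl
      · exact Or.inr (Or.inr (Or.inr (Or.inr ⟨_, rfl⟩)))
      · exact Or.inr (Or.inr (Or.inr (Or.inr ⟨_, rfl⟩)))
    · rcases (hcap'' i).1 d hd with rfl | rfl | rfl
      · exact Or.inr (Or.inl rfl)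
      · exact Or.inr (Or.inr (Or.inr (Or.inr ⟨_, rfl⟩)))
      · exact Or.inr (Or.inr (Or.inr (Or.inr ⟨_, rfl⟩)))
    · rcases hx i d hd with (rfl | rfl | rfl | rfl) | (rfl | rfl | rfl | rfl)
      · exact Or.inr (Or.inr (Or.inl ⟨_, rfl⟩))
      · exact Or.inr (Or.inr (Or.inl ⟨_, rfl⟩))
      · exact Or.inr (Or.inr (Or.inr (Or.inl ⟨_, rfl⟩)))
      · exact Or.inr (Or.inr (Or.inr (Or.inl ⟨_, rfl⟩)))
      · exact Or.inl rfl
      · exact Or.inr (Or.inl rfl)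
      · exact Or.inr (Or.inr (Or.inr (Or.inr ⟨_, rfl⟩)))
      · exact Or.inr (Or.inr (Or.inr (Or.inr ⟨_, rfl⟩)))
  · rintro a (rfl | rfl | ⟨i, rfl⟩ | ⟨i, rfl⟩ | ⟨i, rfl⟩)
    · exact Or.inl rfl
    · exact Or.inl (by rw [hp'])
    · exact Or.inr (Or.inl ⟨i, hq i⟩)
    · exact Or.inr (Or.inl ⟨i, hq't i⟩)
    · exact Or.inr (Or.inr ⟨i, hb i⟩)

end LocalDrawing

end SimpleGraph

/-! ### Counting the defects of a drawing -/

namespace SimpleGraph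

open Equiv.Perm RotationSystem

/-- If every defect `y` is charged to at most one `s`, then the number of charged `s` is at most the
number of defects. -/
theorem ncard_setOf_exists_le {α β : Type*} [Finite β] (T : Set β) (R : α → β → Prop)
    (h : ∀ s s' y, R s y → R s' y → s = s') : {s | ∃ y ∈ T, R s y}.ncard ≤ T.ncard := by
  have hch : ∀ s : {s | ∃ y ∈ T, R s y}, ∃ y : T, R s.1 y.1 := by
    rintro ⟨s, y, hy, hs⟩; exact ⟨⟨y, hy⟩, hs⟩
  choose g hg using hch
  refine Nat.card_le_card_of_injective g fun a b hab => ?_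
  have := hg b
  rw [← hab] at this
  exact Subtype.ext (h _ _ _ (hg a) this)

theorem ncard_not_unique_add_card_le {α β : Type*} [Finite α] {f : α → β}
    (hf : Function.Surjective f) :
    {y | ∃ a b, a ≠ b ∧ f a = y ∧ f b = y}.ncard + Nat.card β ≤ Nat.card α := by
  choose g hg using hf
  have hother : ∀ y : {y | ∃ a b, a ≠ b ∧ f a = y ∧ f b = y}, ∃ a, a ≠ g y.1 ∧ f a = y.1 := by
    rintro ⟨y, a, b, hab, ha, hb⟩
    by_cases h : a = g y
    · exact ⟨b, fun h' => hab (h.trans h'.symm), hb⟩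
    · exact ⟨a, h, ha⟩
  choose k hk hk' using hother
  have : Finite β := Finite.of_surjective f fun y => ⟨g y, hg y⟩
  have hinj : Function.Injective (Sum.elim k g) := by
    rintro (y | y) (z | z) h
    · rw [Subtype.ext ((hk' y).symm.trans ((congrArg f h).trans (hk' z)))]
    · have h1 : k y = g z := h
      have h2 : y.1 = z := (hk' y).symm.trans ((congrArg f h).trans (hg z))
      exact absurd (h2 ▸ h1) (hk y)
    · have h1 : g y = k z := h
      have h2 : y = z.1 := (hg y).symm.trans ((congrArg f h).trans (hk' z))
      exact absurd (h2 ▸ h1.symm) (hk z)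
    · rw [(hg y).symm.trans ((congrArg f h).trans (hg z))]
  have := Nat.card_le_card_of_injective _ hinj
  rwa [Nat.card_sum] at this

theorem card_dart_blowup {V : Type*} (G : SimpleGraph V) (k : ℕ) :
    Nat.card (G.blowup k).Dart = k * k * Nat.card G.Dart := by
  let e : (G.blowup k).Dart ≃ G.Dart × (Fin k × Fin k) :=
    { toFun := fun y => (⟨(y.fst.1, y.snd.1), y.adj⟩, (y.fst.2, y.snd.2))
      invFun := fun z => ⟨((z.1.fst, z.2.1), (z.1.snd, z.2.2)), z.1.adj⟩
      left_inv := fun _ => rfl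
      right_inv := fun _ => rfl }
  rw [Nat.card_congr e, Nat.card_prod, Nat.card_prod, Nat.card_eq_fintype_card (α := Fin k),
    Fintype.card_fin, mul_comm]

section Defects

variable {V : Type*} [Finite V] {G : SimpleGraph V}

theorem ncard_isIsolated_le (G : SimpleGraph V) :
    {v | G.IsIsolated v}.ncard ≤ Nat.card G.ConnectedComponent := by
  have : Finite G.ConnectedComponent := Quot.finite _
  rw [← Set.ncard_univ]
  refine Set.ncard_le_ncard_of_injOn G.connectedComponentMk (fun _ _ => trivial) ?_
  intro v hv w _ hvw
  obtain ⟨p⟩ := ConnectedComponent.exact hvw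
  cases p with
  | nil => rfl
  | cons h _ => exact absurd h (hv _)

/-- A component with a face of length two is a single edge, with two darts. -/
theorem RotationSystem.ncard_facePerm_facePerm_le (M : G.RotationSystem) :
    {d | M.facePerm (M.facePerm d) = d}.ncard ≤ 2 * Nat.card G.ConnectedComponent := by
  classical
  have : Finite G.ConnectedComponent := Quot.finite _
  have := Fintype.ofFinite G.ConnectedComponent
  have := Fintype.ofFinite G.Dart
  rw [Set.ncard_eq_toFinset_card', Nat.card_eq_fintype_card, ← Finset.card_univ]
  refine Finset.card_le_mul_card_image_of_maps_to (f := fun d => G.connectedComponentMk d.fst)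
    (fun _ _ => Finset.mem_univ _) 2 fun C _ => ?_
  by_cases hne : ∃ d, M.facePerm (M.facePerm d) = d ∧ G.connectedComponentMk d.fst = C
  · obtain ⟨d, hd, rfl⟩ := hne
    refine (Finset.card_le_card (t := {d, d.symm}) ?_).trans Finset.card_le_two
    intro e he
    simp only [Finset.mem_filter, Set.mem_toFinset, Set.mem_ofPred_eq] at he
    rw [Finset.mem_insert, Finset.mem_singleton]
    rcases M.eq_or_eq_of_facePerm_facePerm hd (ConnectedComponent.exact he.2) with h | h
    · exact Or.inl (M.eq_of_facePerm_facePerm hd h)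
    · exact Or.inr (M.eq_of_facePerm_facePerm (M.facePerm_facePerm_symm hd) h)
  · rw [Finset.card_eq_zero.2]
    · omega
    · apply Finset.eq_empty_of_forall_notMem
      intro e he
      simp only [Finset.mem_filter, Set.mem_toFinset, Set.mem_ofPred_eq] at he
      exact hne ⟨e, he⟩

/-- A bound for the number of darts on faces that are not triangles, by Euler's formula. Faces of
length two and isolated vertices only occur in components of their own. -/
theorem PlanarDrawing.ncard_not_triangle_le (M : G.PlanarDrawing) :
    {d | M.facePerm (M.facePerm (M.facePerm d)) ≠ d}.ncard + 2 * Nat.card G.Dart +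
      6 * Nat.card G.ConnectedComponent ≤ 12 * Nat.card V := by
  have h1 := twelve_mul_numCycles_le M.facePerm M.facePerm_ne
  have h2 := M.isPlanar
  rw [RotationSystem.IsPlanar, RotationSystem.card_face] at h2
  have h3 := M.ncard_facePerm_facePerm_le
  have h4 : Nat.card {v // G.IsIsolated v} ≤ Nat.card G.ConnectedComponent := ncard_isIsolated_le G
  have h5 := two_mul_card_edgeSet G
  have h6 : {d | M.facePerm (M.facePerm (M.facePerm d)) = d}.ncard +
      {d | M.facePerm (M.facePerm (M.facePerm d)) ≠ d}.ncard = Nat.card G.Dart := by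
    exact Set.ncard_add_ncard_compl {d | M.facePerm (M.facePerm (M.facePerm d)) = d}
  omega

/-- Two vertices on a face of a triangulation are connected by an edge of the face. -/
theorem PlanarDrawing.exists_dart_of_incident (M : G.PlanarDrawing) (hG : G.IsTriangulation)
    {f : M.Face} {u v : V} (hu : M.Incident u f) (hv : M.Incident v f) (huv : u ≠ v) :
    ∃ e : G.Dart, M.face e = f ∧ ((e.fst = u ∧ e.snd = v) ∨ (e.fst = v ∧ e.snd = u)) := by
  have htri := hG.facePerm_facePerm_facePerm M
  obtain ⟨d, rfl, rfl⟩ := hu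
  obtain ⟨e, rfl, he⟩ := hv
  rcases (M.face_eq_iff_of_triangle htri).1 he with rfl | rfl | rfl
  · exact absurd rfl huv
  · exact ⟨d, rfl, Or.inl ⟨rfl, (M.facePerm_fst d).symm⟩⟩
  · refine ⟨_, he, Or.inr ⟨rfl, ?_⟩⟩
    have := M.facePerm_fst (M.facePerm (M.facePerm d))
    rw [htri] at this
    exact this.symm

end Defects

section Main

variable {V : Type*} [Finite V] {A : SimpleGraph V} {D₁ : A.PlanarDrawing}
  {D₂ : D₁.kleetope.PlanarDrawing}

/-- The vertex `w` is the vertex added in the face `s` in the first step, or one of the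
three vertices added in the second step in the faces around it. -/
def IsInside (D₂ : D₁.kleetope.PlanarDrawing) (w : (V ⊕ D₁.Face) ⊕ D₂.Face) (s : D₁.Face) :
    Prop :=
  w = .inl (.inr s) ∨ ∃ f, w = .inr f ∧ D₂.Incident (.inr s) f

theorem IsInside.unique (hA : A.IsTriangulation) {w : (V ⊕ D₁.Face) ⊕ D₂.Face} {s s' : D₁.Face}
    (h : IsInside D₂ w s) (h' : IsInside D₂ w s') : s = s' := by
  rcases h with rfl | ⟨f, rfl, hf⟩
  · rcases h' with h' | ⟨f, h', -⟩
    · exact Sum.inr_injective (Sum.inl_injective h')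
    · cases h'
  · rcases h' with h' | ⟨f', h', hf'⟩
    · cases h'
    · cases h'
      obtain ⟨x, t, -, -, -, h1, h2⟩ := D₁.exists_faces_kleetope hA D₂ s
      obtain ⟨i, rfl⟩ := (h1 f).1 hf
      rcases (h2 i _).1 hf' with h | h | h
      · exact (Sum.inr_injective h).symm
      · cases h
      · cases h

/-- If a planar graph consists of two images of every vertex of the 2-blowup of the twofold
Kleetope of a triangulation, and of at least one image of every edge, then the triangulation has
at most 96 faces. Each face is charged to a defect that only this face is charged to. -/
theorem card_face_le_of_cover (hA : A.IsTriangulation)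
    {P : SimpleGraph ((((V ⊕ D₁.Face) ⊕ D₂.Face) × Fin 2) × Fin 2)} (M : P.PlanarDrawing)
    (hadj : ∀ a b, P.Adj a b → D₂.kleetope.Adj a.1.1 b.1.1)
    (hex : ∀ u v : ((V ⊕ D₁.Face) ⊕ D₂.Face) × Fin 2, D₂.kleetope.Adj u.1 v.1 →
      ∃ k l, P.Adj (u, k) (v, l)) : Nat.card D₁.Face ≤ 96 := by
  have hK := D₁.kleetope_isTriangulation hA
  have hH := D₂.kleetope_isTriangulation hK
  set B := D₂.kleetope.blowup 2 with hB
  let π : P.Dart → B.Dart := fun d => ⟨(d.fst.1, d.snd.1), hadj _ _ d.adj⟩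
  have hπ : Function.Surjective π := by
    rintro ⟨⟨u, v⟩, huv⟩
    obtain ⟨k, l, hkl⟩ := hex u v huv
    exact ⟨⟨((u, k), (v, l)), hkl⟩, rfl⟩
  have : Finite P.ConnectedComponent := Quot.finite _
  -- the defects: darts on faces that are not triangles, isolated vertices, darts of the blowup with
  -- several images, and components
  let T₁ : Set P.Dart := {d | M.facePerm (M.facePerm (M.facePerm d)) ≠ d}
  let T₂ : Set ((((V ⊕ D₁.Face) ⊕ D₂.Face) × Fin 2) × Fin 2) := {v | P.IsIsolated v}
  let T₃ : Set B.Dart := {y | ∃ d d', d ≠ d' ∧ π d = y ∧ π d' = y}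
  let T₄ : Set P.ConnectedComponent := Set.univ
  -- the faces to which the defects are charged; the edges of `A` belong to the faces on their two
  -- sides, one for each dart
  let R₁ : D₁.Face → P.Dart → Prop := fun s d => IsInside D₂ d.fst.1.1 s
  let R₂ : D₁.Face → ((((V ⊕ D₁.Face) ⊕ D₂.Face) × Fin 2) × Fin 2) → Prop :=
    fun s v => IsInside D₂ v.1.1 s
  let R₃ : D₁.Face → B.Dart → Prop := fun s y => IsInside D₂ y.fst.1 s ∨
    ∃ e : A.Dart, y.fst.1 = .inl (.inl e.fst) ∧ y.snd.1 = .inl (.inl e.snd) ∧ D₁.face e = s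
  let R₄ : D₁.Face → P.ConnectedComponent → Prop := fun s C =>
    (∃ v, P.connectedComponentMk v = C ∧ IsInside D₂ v.1.1 s) ∧
      ∀ v, P.connectedComponentMk v = C → ∀ s', IsInside D₂ v.1.1 s' → s' = s
  have n₁ : {s | ∃ y ∈ T₁, R₁ s y}.ncard ≤ T₁.ncard :=
    ncard_setOf_exists_le T₁ R₁ fun _ _ _ h h' => h.unique hA h'
  have n₂ : {s | ∃ y ∈ T₂, R₂ s y}.ncard ≤ T₂.ncard :=
    ncard_setOf_exists_le T₂ R₂ fun _ _ _ h h' => h.unique hA h'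
  have n₃ : {s | ∃ y ∈ T₃, R₃ s y}.ncard ≤ T₃.ncard := by
    refine ncard_setOf_exists_le T₃ R₃ ?_
    have hno : ∀ (e : A.Dart) s, ¬ IsInside D₂ (.inl (.inl e.fst)) s := by
      rintro e s (h | ⟨f, h, -⟩) <;> cases h
    rintro s s' y (h | ⟨e, h1, h2, h3⟩) (h' | ⟨e', h1', h2', h3'⟩)
    · exact h.unique hA h'
    · rw [h1'] at h; exact absurd h (hno _ _)
    · rw [h1] at h'; exact absurd h' (hno _ _)
    · rw [h1] at h1'
      rw [h2] at h2'
      rw [← h3, ← h3', Dart.ext e e' (Prod.ext (Sum.inl_injective (Sum.inl_injective h1'))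
        (Sum.inl_injective (Sum.inl_injective h2')))]
  have n₄ : {s | ∃ y ∈ T₄, R₄ s y}.ncard ≤ T₄.ncard := by
    refine ncard_setOf_exists_le T₄ R₄ ?_
    rintro s s' C ⟨⟨v, hv, hs⟩, -⟩ ⟨-, h⟩
    exact h v hv s hs
  have hcover : ∀ s, s ∈ {s | ∃ y ∈ T₁, R₁ s y} ∪ {s | ∃ y ∈ T₂, R₂ s y} ∪
      {s | ∃ y ∈ T₃, R₃ s y} ∪ {s | ∃ y ∈ T₄, R₄ s y} := by
    intro s
    by_cases h₁ : ∃ y ∈ T₁, R₁ s y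
    · exact Or.inl (Or.inl (Or.inl h₁))
    by_cases h₂ : ∃ y ∈ T₂, R₂ s y
    · exact Or.inl (Or.inl (Or.inr h₂))
    by_cases h₃ : ∃ y ∈ T₃, R₃ s y
    · exact Or.inl (Or.inr h₃)
    right
    obtain ⟨x, t, hx, hxs, ht, hts, htw⟩ := D₁.exists_faces_kleetope hA D₂ s
    have hin : ∀ w, (w = .inl (.inr s) ∨ ∃ i, w = .inr (t i)) → IsInside D₂ w s := by
      rintro w (rfl | ⟨i, rfl⟩)
      · exact Or.inl rfl
      · exact Or.inr ⟨_, rfl, (hts _).2 ⟨i, rfl⟩⟩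
    have hL : LocalDrawing D₂.kleetope P M.toRotationSystem (.inl (.inr s))
        (fun i => .inl (.inl (x i))) (fun i => .inr (t i)) := by
      refine ⟨?_, ?_, ?_, ?_, ?_, ?_, hadj, hex, ?_, ?_, ?_⟩
      · intro i j hij
        by_contra hne
        exact (hx i j hne).ne (Sum.inl_injective (Sum.inl_injective hij))
      · intro i j hij; exact ht (Sum.inr_injective hij)
      · intro i h; cases h
      · intro i j h; cases h
      · rintro ((v | f) | f)
        · refine (hxs v).trans ⟨fun ⟨i, hi⟩ => Or.inl ⟨i, by rw [hi]⟩, ?_⟩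
          rintro (⟨i, hi⟩ | ⟨i, hi⟩)
          · exact ⟨i, Sum.inl_injective (Sum.inl_injective hi)⟩
          · cases hi
        · refine ⟨fun h => h.elim, ?_⟩
          rintro (⟨i, hi⟩ | ⟨i, hi⟩) <;> cases hi
        · refine (hts f).trans ⟨fun ⟨i, hi⟩ => Or.inr ⟨i, by rw [hi]⟩, ?_⟩
          rintro (⟨i, hi⟩ | ⟨i, hi⟩)
          · cases hi
          · exact ⟨i, Sum.inr_injective hi⟩
      · rintro i (w | f)
        · refine (htw i w).trans ?_
          simp only [Sum.inl.injEq]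
        · refine ⟨fun h => h.elim, ?_⟩
          rintro (h | h | h) <;> cases h
      · intro a a' b b' hlab ha hb hab hab'
        by_contra hne
        have hd : (⟨(a, b), hab⟩ : P.Dart) ≠ ⟨(a', b'), hab'⟩ := by
          intro h
          exact hne ⟨congrArg (fun d : P.Dart => d.fst) h, congrArg (fun d : P.Dart => d.snd) h⟩
        have hd' : (⟨(b, a), hab.symm⟩ : P.Dart) ≠ ⟨(b', a'), hab'.symm⟩ := by
          intro h
          exact hne ⟨congrArg (fun d : P.Dart => d.snd) h, congrArg (fun d : P.Dart => d.fst) h⟩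
        have hy : π ⟨(a, b), hab⟩ ∈ T₃ :=
          ⟨_, _, hd, rfl, Dart.ext _ _ (Prod.ext ha.symm hb.symm)⟩
        have hy' : π ⟨(b, a), hab.symm⟩ ∈ T₃ :=
          ⟨_, _, hd', rfl, Dart.ext _ _ (Prod.ext hb.symm ha.symm)⟩
        rcases hlab with h | h | ⟨⟨i, hi⟩, ⟨j, hj⟩⟩
        · exact h₃ ⟨_, hy, Or.inl (hin _ (Or.inl h))⟩
        · exact h₃ ⟨_, hy, Or.inl (hin _ (Or.inr h))⟩
        · have hij : x i ≠ x j := by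
            intro e
            have := (hadj _ _ hab).ne
            rw [hi, hj, e] at this
            exact this rfl
          obtain ⟨e, he, ⟨h1, h2⟩ | ⟨h1, h2⟩⟩ := D₁.exists_dart_of_incident hA
            ((hxs _).2 ⟨i, rfl⟩) ((hxs _).2 ⟨j, rfl⟩) hij
          · exact h₃ ⟨_, hy, Or.inr ⟨e, by rw [h1]; exact hi, by rw [h2]; exact hj, he⟩⟩
          · exact h₃ ⟨_, hy', Or.inr ⟨e, by rw [h1]; exact hj, by rw [h2]; exact hi, he⟩⟩
      · intro a ha
        exact exists_adj_iff_not_isIsolated.2 fun h => h₂ ⟨a, h, hin _ ha⟩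
      · rintro a ha d rfl
        by_contra hd
        exact h₁ ⟨d, hd, hin _ ha⟩
    obtain ⟨C, hC, hlab, a, ha, has⟩ := hL.exists_isClosedAround
    refine ⟨P.connectedComponentMk a, trivial, ⟨a, rfl, hin _ has⟩, fun v hv s' hs' => ?_⟩
    have hvC : v ∈ C := by
      obtain ⟨p⟩ := (ConnectedComponent.exact hv).symm
      have : ∀ a v, P.Walk a v → a ∈ C → v ∈ C := by
        intro a v p
        induction p with
        | nil => exact id
        | cons h _ ih => exact fun ha => ih (hC _ ha _ h)
      exact this a v p ha
    rcases hlab v hvC with h | h | ⟨i, hi⟩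
    · exact hs'.unique hA (hin _ (Or.inl h))
    · exact hs'.unique hA (hin _ (Or.inr h))
    · rw [hi] at hs'
      rcases hs' with h | ⟨f, h, -⟩ <;> cases h
  have hsum : Nat.card D₁.Face ≤ T₁.ncard + T₂.ncard + T₃.ncard + T₄.ncard := by
    rw [← Set.ncard_univ]
    refine (Set.ncard_le_ncard (fun s _ => hcover s) (Set.toFinite _)).trans ?_
    have u1 := Set.ncard_union_le ({s | ∃ y ∈ T₁, R₁ s y} ∪ {s | ∃ y ∈ T₂, R₂ s y} ∪
      {s | ∃ y ∈ T₃, R₃ s y}) {s | ∃ y ∈ T₄, R₄ s y}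
    have u2 := Set.ncard_union_le ({s | ∃ y ∈ T₁, R₁ s y} ∪ {s | ∃ y ∈ T₂, R₂ s y})
      {s | ∃ y ∈ T₃, R₃ s y}
    have u3 := Set.ncard_union_le {s | ∃ y ∈ T₁, R₁ s y} {s | ∃ y ∈ T₂, R₂ s y}
    omega
  -- with `N` vertices and `6N - 12` darts of the twofold Kleetope, `P` has `4N` vertices and
  -- `T₃` more than `4(6N - 12)` darts, and Euler's formula leaves `96 = 12 * 4N - 2 * 4(6N - 12)`
  have e1 : T₁.ncard + 2 * Nat.card P.Dart + 6 * Nat.card P.ConnectedComponent ≤ _ :=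
    M.ncard_not_triangle_le
  have e2 : T₂.ncard ≤ _ := ncard_isIsolated_le P
  have e3 : T₃.ncard + Nat.card B.Dart ≤ _ := ncard_not_unique_add_card_le hπ
  have e4 : T₄.ncard = Nat.card P.ConnectedComponent := Set.ncard_univ _
  have e5 : Nat.card B.Dart = 2 * 2 * Nat.card D₂.kleetope.Dart := card_dart_blowup _ 2
  have e6 := two_mul_card_edgeSet D₂.kleetope
  have e7 := hH.card_edgeSet
  rw [Nat.card_prod, Nat.card_prod, Nat.card_eq_fintype_card (α := Fin 2), Fintype.card_fin] at e1
  omega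

end Main

end SimpleGraph

/-! ### Planarity of isomorphic graphs and of disjoint unions -/

namespace SimpleGraph

open Equiv.Perm RotationSystem

variable {V W : Type*}

/-- The bijection between the darts of isomorphic graphs. -/
def Iso.mapDart {G : SimpleGraph V} {H : SimpleGraph W} (φ : G ≃g H) : G.Dart ≃ H.Dart where
  toFun := φ.toHom.mapDart
  invFun := φ.symm.toHom.mapDart
  left_inv d := by ext <;> simp [Hom.mapDart]
  right_inv d := by ext <;> simp [Hom.mapDart]

theorem IsPlanar.of_iso [Finite V] [Finite W] {G : SimpleGraph V} {H : SimpleGraph W}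
    (φ : G ≃g H) (hG : G.IsPlanar) : H.IsPlanar := by
  obtain ⟨M⟩ := hG
  have hiso : Nat.card {v // G.IsIsolated v} = Nat.card {w // H.IsIsolated w} :=
    Nat.card_congr <| φ.toEquiv.subtypeEquiv fun v =>
      ⟨fun h w hw => h (φ.symm w) (by
          rw [← φ.map_adj_iff]; simpa using hw),
        fun h w hw => h (φ w) (φ.map_adj_iff.2 hw)⟩
  refine isPlanar_of_model φ.mapDart M.rot G.dartSymm (fun d => rfl)
    (fun d => congrArg φ (M.rot_fst d))
    (fun d d' h => M.sameCycle_of_fst_eq d d' (φ.injective h)) ?_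
  rw [← hiso, ← Nat.card_congr φ.toEquiv, ← Nat.card_congr φ.mapEdgeSet,
    ← Nat.card_congr φ.connectedComponentEquiv]
  exact M.isPlanar

/-- The darts of a disjoint union. -/
noncomputable def dartSumEquiv (G : SimpleGraph V) (H : SimpleGraph W) :
    G.Dart ⊕ H.Dart ≃ (G ⊕g H).Dart :=
  Equiv.ofBijective
    (Sum.elim (Embedding.sumInl : G ↪g G ⊕g H).toHom.mapDart
      (Embedding.sumInr : H ↪g G ⊕g H).toHom.mapDart) <| by
    constructor
    · rintro (d | d) (e | e) h
      · have h1 := congrArg (·.fst) h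
        have h2 := congrArg (·.snd) h
        exact congrArg Sum.inl
          (Dart.ext _ _ (Prod.ext (Sum.inl_injective h1) (Sum.inl_injective h2)))
      · exact absurd (congrArg (·.fst) h) Sum.inl_ne_inr
      · exact absurd (congrArg (·.fst) h) Sum.inr_ne_inl
      · have h1 := congrArg (·.fst) h
        have h2 := congrArg (·.snd) h
        exact congrArg Sum.inr
          (Dart.ext _ _ (Prod.ext (Sum.inr_injective h1) (Sum.inr_injective h2)))
    · rintro ⟨⟨v | v, w | w⟩, h⟩
      · exact ⟨.inl ⟨(v, w), h⟩, rfl⟩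
      · exact absurd h (not_adj_sum_inl_inr v w)
      · exact absurd h.symm (not_adj_sum_inl_inr w v)
      · exact ⟨.inr ⟨(v, w), h⟩, rfl⟩

/-- The components of a disjoint union. -/
noncomputable def connectedComponentSumEquiv (G : SimpleGraph V) (H : SimpleGraph W) :
    G.ConnectedComponent ⊕ H.ConnectedComponent ≃ (G ⊕g H).ConnectedComponent :=
  Equiv.ofBijective
    (Sum.elim (ConnectedComponent.map (Embedding.sumInl : G ↪g G ⊕g H).toHom)
      (ConnectedComponent.map (Embedding.sumInr : H ↪g G ⊕g H).toHom)) <| by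
    have hl : ∀ {x y}, (G ⊕g H).Reachable x y → ∀ v w, x = .inl v → y = .inl w →
        G.Reachable v w := by
      rintro x y ⟨p⟩
      induction p with
      | nil => rintro v w rfl h; cases h; rfl
      | @cons a b c h p ih =>
        rintro v w rfl rfl
        rcases b with b | b
        · exact (Adj.reachable (sum_adj_inl.1 h)).trans (ih b w rfl rfl)
        · exact absurd h (not_adj_sum_inl_inr v b)
    have hr : ∀ {x y}, (G ⊕g H).Reachable x y → ∀ v w, x = .inr v → y = .inr w →
        H.Reachable v w := by
      rintro x y ⟨p⟩
      induction p with
      | nil => rintro v w rfl h; cases h; rfl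
      | @cons a b c h p ih =>
        rintro v w rfl rfl
        rcases b with b | b
        · exact absurd h.symm (not_adj_sum_inl_inr b v)
        · exact (Adj.reachable (sum_adj_inr.1 h)).trans (ih b w rfl rfl)
    constructor
    · rintro (c | c) (d | d) <;> induction c using ConnectedComponent.ind with | _ v =>
        induction d using ConnectedComponent.ind with | _ w =>
        intro h; replace h := ConnectedComponent.exact h
        first
        | rw [ConnectedComponent.sound (hl h v w rfl rfl)]
        | exact absurd h (not_reachable_sum_inl_inr v w)
        | exact absurd h.symm (not_reachable_sum_inl_inr w v)
        | rw [ConnectedComponent.sound (hr h v w rfl rfl)]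
    · intro c
      induction c using ConnectedComponent.ind with | _ x => ?_
      rcases x with v | v
      · exact ⟨.inl (G.connectedComponentMk v), rfl⟩
      · exact ⟨.inr (H.connectedComponentMk v), rfl⟩

theorem card_isIsolated_sum [Finite V] [Finite W] (G : SimpleGraph V) (H : SimpleGraph W) :
    Nat.card {x // (G ⊕g H).IsIsolated x} =
      Nat.card {v // G.IsIsolated v} + Nat.card {w // H.IsIsolated w} := by
  rw [Nat.card_congr Equiv.subtypeSum, Nat.card_sum]
  congr 1
  · refine Nat.card_congr (Equiv.subtypeEquivRight fun v => ⟨fun h w hw => ?_, ?_⟩)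
    · exact h (.inl w) (sum_adj_inl.2 hw)
    · rintro h (w | w) hw
      · exact h w (sum_adj_inl.1 hw)
      · exact not_adj_sum_inl_inr v w hw
  · refine Nat.card_congr (Equiv.subtypeEquivRight fun v => ⟨fun h w hw => ?_, ?_⟩)
    · exact h (.inr w) (sum_adj_inr.2 hw)
    · rintro h (w | w) hw
      · exact not_adj_sum_inl_inr w v hw.symm
      · exact h w (sum_adj_inr.1 hw)

theorem IsPlanar.sum [Finite V] [Finite W] {G : SimpleGraph V} {H : SimpleGraph W}
    (hG : G.IsPlanar) (hH : H.IsPlanar) : (G ⊕g H).IsPlanar := by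
  obtain ⟨M⟩ := hG
  obtain ⟨N⟩ := hH
  have : Finite G.ConnectedComponent := Quot.finite _
  have : Finite H.ConnectedComponent := Quot.finite _
  refine isPlanar_of_model (dartSumEquiv G H) (Equiv.sumCongr M.rot N.rot)
    (Equiv.sumCongr G.dartSymm H.dartSymm) ?_ ?_ ?_ ?_
  · rintro (d | d) <;> rfl
  · rintro (d | d)
    · exact congrArg Sum.inl (M.rot_fst d)
    · exact congrArg Sum.inr (N.rot_fst d)
  · rintro (d | d) (e | e) h
    · exact (sameCycle_sumCongr_inl _ _ _ _).2 (M.sameCycle_of_fst_eq d e (Sum.inl_injective h))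
    · exact absurd h Sum.inl_ne_inr
    · exact absurd h Sum.inr_ne_inl
    · exact (sameCycle_sumCongr_inr _ _ _ _).2 (N.sameCycle_of_fst_eq d e (Sum.inr_injective h))
  · have h1 : (Equiv.sumCongr M.rot N.rot * Equiv.sumCongr G.dartSymm H.dartSymm :
        Equiv.Perm (G.Dart ⊕ H.Dart)) = Equiv.sumCongr M.facePerm N.facePerm := by
      ext (d | d) <;> rfl
    rw [h1, numCycles_sumCongr, card_isIsolated_sum,
      ← Nat.card_congr (connectedComponentSumEquiv G H),
      Nat.card_congr edgeSetSumEquiv, Nat.card_sum, Nat.card_sum, Nat.card_sum]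
    have hM := M.isPlanar
    have hN := N.isPlanar
    rw [RotationSystem.IsPlanar, RotationSystem.card_face] at hM hN
    omega

theorem isPlanar_bot [Finite V] : (⊥ : SimpleGraph V).IsPlanar := by
  have : IsEmpty (⊥ : SimpleGraph V).Dart := ⟨fun d => d.adj⟩
  refine isPlanar_of_model (Equiv.refl _) 1 1 isEmptyElim isEmptyElim isEmptyElim ?_
  have h1 : Nat.card {v // (⊥ : SimpleGraph V).IsIsolated v} = Nat.card V :=
    Nat.card_congr (Equiv.subtypeUnivEquiv fun v w h => h)
  have h2 : Nat.card (⊥ : SimpleGraph V).ConnectedComponent = Nat.card V :=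
    (Nat.card_congr (Equiv.ofBijective (connectedComponentMk ⊥) ⟨fun v w h => by
      obtain ⟨p⟩ := ConnectedComponent.exact h
      cases p with
      | nil => rfl
      | cons h _ => exact h.elim, Quot.mk_surjective⟩)).symm
  have h3 : Nat.card (⊥ : SimpleGraph V).edgeSet = 0 := by simp
  rw [h1, h2, h3, one_mul, numCycles_one, Nat.card_of_isEmpty (α := (⊥ : SimpleGraph V).Dart)]
  omega

end SimpleGraph

/-! ### Blowups of iterated Kleetopes -/

namespace SimpleGraph

variable {V W : Type*}

/-- A biplanar graph has a planar cover with at most two images of each vertex: the disjoint union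
of the two planar graphs. -/
theorem IsBiplanar.exists_isPlanar_cover [Finite V] {G : SimpleGraph V} (h : G.IsBiplanar) :
    ∃ P : SimpleGraph (V × Fin 2), P.IsPlanar ∧ (∀ a b, P.Adj a b → G.Adj a.1 b.1) ∧
      ∀ u v, G.Adj u v → ∃ k l, P.Adj (u, k) (v, l) := by
  obtain ⟨G₁, G₂, h₁, h₂, rfl⟩ := h
  let e : V ⊕ V ≃ V × Fin 2 :=
    (Equiv.boolProdEquivSum V).symm.trans
      ((Equiv.prodComm _ _).trans ((Equiv.refl V).prodCongr finTwoEquiv.symm))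
  have hl : ∀ v, e.symm (v, 0) = .inl v := fun v => (Equiv.symm_apply_eq e).2 rfl
  have hr : ∀ v, e.symm (v, 1) = .inr v := fun v => (Equiv.symm_apply_eq e).2 rfl
  refine ⟨(G₁ ⊕g G₂).comap e.symm, (h₁.sum h₂).of_iso (Iso.comap e.symm _).symm, ?_, ?_⟩
  · rintro ⟨u, k⟩ ⟨v, l⟩ h
    rw [comap_adj] at h
    fin_cases k <;> fin_cases l <;> simp [hl, hr] at h ⊢ <;> simp [h]
  · rintro u v (h | h)
    · exact ⟨0, 0, by simpa [hl] using h⟩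
    · exact ⟨1, 1, by simpa [hr] using h⟩

theorem HasSplitThicknessDrawing.exists_isPlanar_cover [Finite V] {G : SimpleGraph V} {k : ℕ}
    (h : G.HasSplitThicknessDrawing k) :
    ∃ P : SimpleGraph (V × Fin k), P.IsPlanar ∧ (∀ a b, P.Adj a b → G.Adj a.1 b.1) ∧
      ∀ u v, G.Adj u v → ∃ i j, P.Adj (u, i) (v, j) := by
  obtain ⟨H, hH, hadj, hex⟩ := h
  refine ⟨H, hH, hadj, fun u v huv => ?_⟩
  obtain ⟨e, ⟨he, hm⟩, -⟩ := hex s(u, v) huv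
  induction e using Sym2.ind with | _ a b => ?_
  obtain ⟨a, i⟩ := a
  obtain ⟨b, j⟩ := b
  obtain ⟨rfl, rfl⟩ | ⟨rfl, rfl⟩ := Sym2.eq_iff.1 hm
  · exact ⟨i, j, he⟩
  · exact ⟨j, i, Adj.symm he⟩

theorem IsBiplanar.of_iso [Finite V] [Finite W] {G : SimpleGraph V} {H : SimpleGraph W}
    (φ : G ≃g H) (hG : G.IsBiplanar) : H.IsBiplanar := by
  obtain ⟨G₁, G₂, h₁, h₂, rfl⟩ := hG
  refine ⟨G₁.comap φ.symm, G₂.comap φ.symm, h₁.of_iso (Iso.comap φ.symm.toEquiv _).symm,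
    h₂.of_iso (Iso.comap φ.symm.toEquiv _).symm, ?_⟩
  ext u v
  rw [← φ.symm.map_adj_iff]
  rfl

/-- Isomorphic graphs have isomorphic blowups. -/
def Iso.blowup {G : SimpleGraph V} {H : SimpleGraph W} (φ : G ≃g H) (k : ℕ) :
    G.blowup k ≃g H.blowup k where
  toEquiv := φ.toEquiv.prodCongr (Equiv.refl _)
  map_rel_iff' := φ.map_adj_iff

/-- If the blowup of `K³G` has a planar cover, then `KG` has few faces, and so `G` has few
vertices. -/
theorem IsMaximalPlanar.card_lt_of_cover [Finite V] {G : SimpleGraph V} (hG : G.IsMaximalPlanar)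
    (D₀ : G.PlanarDrawing) (D₁ : D₀.kleetope.PlanarDrawing) (D₂ : D₁.kleetope.PlanarDrawing)
    (h : ∃ P : SimpleGraph (((((V ⊕ D₀.Face) ⊕ D₁.Face) ⊕ D₂.Face) × Fin 2) × Fin 2),
      P.IsPlanar ∧ (∀ a b, P.Adj a b → (D₂.kleetope.blowup 2).Adj a.1 b.1) ∧
        ∀ u v, (D₂.kleetope.blowup 2).Adj u v → ∃ k l, P.Adj (u, k) (v, l)) :
    Nat.card V < 49 := by
  by_contra! hV
  have hT := hG.isTriangulation (by omega)
  have hK := D₀.kleetope_isTriangulation hT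
  obtain ⟨P, ⟨M⟩, hadj, hex⟩ := h
  have h1 := card_face_le_of_cover hK M hadj hex
  -- `KG` has `n + (2n - 4)` vertices, and hence `6n - 12` faces
  have h2 := hT.card_face D₀
  have h3 := hK.card_face D₁
  rw [Nat.card_sum] at h3
  omega

theorem exists_isMaximalPlanar (V : Type*) [Finite V] :
    ∃ G : SimpleGraph V, G.IsMaximalPlanar := by
  obtain ⟨G, -, hG⟩ := Finite.exists_le_maximal (p := fun H : SimpleGraph V => H.IsPlanar)
    isPlanar_bot
  exact ⟨G, hG⟩

end SimpleGraph

/-- First part: `D₀`, `D₁`, `D₂` are arbitrary planar drawings of `G`, of its Kleetope `KG`, and of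
the Kleetope `K²G` of that; thus `D₂.kleetope` is the iterated Kleetope `K³G`. (Maximal planar
graphs with at least four vertices have only one planar drawing up to reflection.)
Second part: not every planar graph has a biplanar 2-blowup. -/
theorem mainTheorem1 :
    (∀ (V : Type*) [Finite V] (G : SimpleGraph V), G.IsMaximalPlanar →
      ∀ (D₀ : G.PlanarDrawing) (D₁ : D₀.kleetope.PlanarDrawing) (D₂ : D₁.kleetope.PlanarDrawing),
        (49 ≤ Nat.card V → ¬ (D₂.kleetope.blowup 2).IsBiplanar) ∧
        (73 ≤ Nat.card V → ¬ (D₂.kleetope.blowup 2).HasSplitThicknessDrawing 2)) ∧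
    ¬ ∀ (n : ℕ) (H : SimpleGraph (Fin n)), H.IsPlanar → (H.blowup 2).IsBiplanar := by
  refine ⟨fun V _ G hG D₀ D₁ D₂ => ⟨fun hV h => ?_, fun hV h => ?_⟩, fun hall => ?_⟩
  · exact (hG.card_lt_of_cover D₀ D₁ D₂ h.exists_isPlanar_cover).not_ge hV
  · have := hG.card_lt_of_cover D₀ D₁ D₂ h.exists_isPlanar_cover
    omega
  · obtain ⟨G, hG⟩ := SimpleGraph.exists_isMaximalPlanar (Fin 49)
    obtain ⟨D₀⟩ := hG.prop
    have h₀ := hG.isTriangulation (by simp)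
    obtain ⟨D₁⟩ := D₀.kleetope_isPlanar h₀
    have h₁ := D₀.kleetope_isTriangulation h₀
    obtain ⟨D₂⟩ := D₁.kleetope_isPlanar h₁
    have hK := D₂.kleetope_isPlanar (D₁.kleetope_isTriangulation h₁)
    let e := Finite.equivFin (((Fin 49 ⊕ D₀.Face) ⊕ D₁.Face) ⊕ D₂.Face)
    let φ : D₂.kleetope ≃g D₂.kleetope.comap e.symm := (SimpleGraph.Iso.comap e.symm _).symm
    have hB := (hall _ _ (hK.of_iso φ)).of_iso (φ.symm.blowup 2)
    have := hG.card_lt_of_cover D₀ D₁ D₂ hB.exists_isPlanar_cover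
    simp at this
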